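/- Let $\mathbb F_q$ be a finite field with $q$ elements, $F=\mathbb F_q(\!(t^{-1})\!)$, $\mathcal O=\mathbb F_q[\![t^{-1}]\!]$, $\pi=t^{-1}$, and let $G=PGL(3,F)$, $\Gamma=PGL(3,\mathbb F_q[t])\subset G$, $W=PGL(3,\mathcal O)\subset G$. Let $\mathcal B$ be the Bruhat–Tits building of $G$: its vertices are the homothety classes $[L]$ of $\mathcal O$-lattices $L\subset F^3$ (identified with $G/W$ via $gW\mapsto[g\mathcal O^3]$); two vertices $x,y$ are adjacent, $x\sim y$, if $\pi L\subsetneq L'\subsetneq L$ for some representatives $L$ of $x$ and $L'$ of $y$; and the color of a vertex is $\tau([L])=\log_q[\mathcal O^3:L]\in\mathbb Z/3\mathbb Z$ for $L\subset\mathcal O^3$. For $i=1,2$ let $A_i f(x)=\sum_{y\sim x,\ \tau(y)=\tau(x)+i}f(y)$ on $L^2(\mathcal B)=\ell^2(G/W)$, and $A^+=A_1$. The vertices of $\Gamma\backslash\mathcal B$ are the orbits $\Gamma x$ and its oriented edges are the orbits $\Gamma(x,y)$ of pairs with $x\sim y$; differences of colors along edges are $\Gamma$-invariant. Put $c=q^3(q+1)(q-1)^2$,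 $w(\Gamma x)=c/|\Gamma_x|$ and $w(\Gamma(x,y))=c/|\Gamma_x\cap\Gamma_y|$, where $\Gamma_x$ is the stabilizer of $x$ in $\Gamma$. Let $L^2_w(\Gamma\backslash\mathcal B)$ be the space of functions $f$ on the vertices of $\Gamma\backslash\mathcal B$ with $\sum_u|f(u)|^2w(u)<\infty$, and let $$A_w^+f(u)=\sum_{\substack{e=(u,v)\\ \tau(v)=\tau(u)+1}}\frac{w(e)}{w(u)}\,f(v),$$ the sum being over the edges $e$ of $\Gamma\backslash\mathcal B$ that start at $u$; it is the operator induced by $A^+$. **Theorem 1.1.** $A_w^+$ is a well-defined bounded operator on $L^2_w(\Gamma\backslash\mathcal B)$, and its spectrum contains $\Sigma_0\cup\Sigma_1\cup\Sigma_2$, where * $\Sigma_0=\{q^2+q+1,\ (q^2+q+1)e^{2\pi i/3},\ (q^2+q+1)e^{4\pi i/3}\}$, a set of three distinct points; * $\Sigma_1=\{q^{3/2}e^{i\theta}+qe^{-2i\theta}+q^{1/2}e^{i\theta}:\theta\in\mathbb R\}$, a three-pointed hypotrochoid whose points of largest modulus are exactly the three tips $(q^{3/2}+q+q^{1/2})e^{2k\pi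 i/3}$, $k=0,1,2$; * $\Sigma_2=\{q(s_1+s_2+s_3):|s_1|=|s_2|=|s_3|=1,\ s_1s_2s_3=1\}$, which is the hypocycloid $\{2qe^{i\theta}+qe^{-2i\theta}:\theta\in\mathbb R\}$ together with its interior (the bounded components of its complement); this hypocycloid has exactly three cusps, $3qe^{2k\pi i/3}$, $k=0,1,2$. Moreover $A_1,A_2$ are bounded on $L^2(\mathcal B)$, the spectrum of $A^+=A_1$ equals $\Sigma_2$, and the simultaneous spectrum $\mathcal S^3$ of $(A_1,A_2)$, that is, the set of $(\lambda_1,\lambda_2)\in\mathbb C^2$ for which there are unit vectors $f_n\in L^2(\mathcal B)$ with $\|A_if_n-\lambda_if_n\|\to0$ for $i=1,2$, equals $$\{(q(s_1+s_2+s_3),\ q(s_1s_2+s_1s_3+s_2s_3)):|s_1|=|s_2|=|s_3|=1,\ s_1s_2s_3=1\}.$$ -/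

import Mathlib

open scoped LaurentSeries PowerSeries Polynomial MatrixGroups Pointwise

noncomputable section

namespace A2Quotient

open Matrix MeasureTheory Filter Topology

variable (K : Type*) [Field K]

/-! ### The groups

`K⸨X⸩` is the field of Laurent series and `K⟦X⟧` its valuation ring, with uniformizer `X = t⁻¹`. -/

/-- The embedding `K[t] → K((t⁻¹))`: constants go to constants and `t` goes to `X⁻¹`. -/
def polyToLaurent : K[X] →+* K⸨X⸩ :=
  Polynomial.eval₂RingHom (HahnSeries.C : K →+* K⸨X⸩) (HahnSeries.single (-1 : ℤ) (1 : K))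

/-- `G = PGL(3, K((t⁻¹)))`. -/
abbrev G : Type _ := PGL(3, K⸨X⸩)

/-- `Γ = PGL(3, K[t])`, the image of `GL(3, K[t])` in `G`. -/
def Gam : Subgroup (G K) :=
  ((ProjGenLinGroup.mk (n := Fin 3) (R := K⸨X⸩)).comp
    (GeneralLinearGroup.map (n := Fin 3) (polyToLaurent K))).range

/-- `W = PGL(3, K[[t⁻¹]])`, the image of `GL(3, K[[t⁻¹]])` in `G`. -/
def W : Subgroup (G K) :=
  ((ProjGenLinGroup.mk (n := Fin 3) (R := K⸨X⸩)).comp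
    (GeneralLinearGroup.map (n := Fin 3) (algebraMap K⟦X⟧ K⸨X⸩))).range

/-! ### The building -/

/-- The vertex set `G/W` of the building. The vertex `gW` is the homothety class of the
lattice `g 𝒪³`. -/
abbrev Vertex : Type _ := G K ⧸ W K

variable {K}

/-- The vertex represented by an invertible matrix. -/
def vertexOf (g : GL (Fin 3) K⸨X⸩) : Vertex K :=
  QuotientGroup.mk (ProjGenLinGroup.mk g)

/-- The `𝒪`-lattice `g 𝒪³`, spanned by the columns of `g`. The lattices in the homothety class of a
vertex `x` are exactly the `lattice g` with `vertexOf g = x`. -/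
def lattice (g : GL (Fin 3) K⸨X⸩) : Submodule K⟦X⟧ (Fin 3 → K⸨X⸩) :=
  Submodule.span K⟦X⟧ (Set.range (g : Matrix (Fin 3) (Fin 3) K⸨X⸩).col)

/-- Adjacency in the building: `π L ⊊ L' ⊊ L` for some representatives `L` of `x` and `L'` of `y`
(this relation is symmetric). -/
def Adj (x y : Vertex K) : Prop :=
  ∃ g h : GL (Fin 3) K⸨X⸩, vertexOf g = x ∧ vertexOf h = y ∧
    (PowerSeries.X : K⟦X⟧) • lattice g < lattice h ∧ lattice h < lattice g

theorem vertexOf_surjective : Function.Surjective (vertexOf (K := K)) := by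
  intro x
  obtain ⟨p, rfl⟩ := QuotientGroup.mk_surjective x
  obtain ⟨g, rfl⟩ := ProjGenLinGroup.mk_surjective p
  exact ⟨g, rfl⟩

theorem vertexOf_mul_scalar (g : GL (Fin 3) K⸨X⸩) (u : (K⸨X⸩)ˣ) :
    vertexOf (g * GeneralLinearGroup.scalar (Fin 3) u) = vertexOf g := by
  simp [vertexOf]

/-- Every homothety class contains a lattice inside `𝒪³`. -/
theorem exists_integral_rep (x : Vertex K) :
    ∃ g : GL (Fin 3) K⸨X⸩, vertexOf g = x ∧ lattice g ≤ lattice 1 := by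
  obtain ⟨g, rfl⟩ := vertexOf_surjective x
  obtain ⟨b, hb⟩ := IsLocalization.exist_integer_multiples_of_finite (nonZeroDivisors K⟦X⟧)
    (fun p : Fin 3 × Fin 3 => (g : Matrix (Fin 3) (Fin 3) K⸨X⸩) p.1 p.2)
  have hb0 : algebraMap K⟦X⟧ K⸨X⸩ b ≠ 0 :=
    IsFractionRing.to_map_ne_zero_of_mem_nonZeroDivisors b.2
  refine ⟨g * GeneralLinearGroup.scalar (Fin 3) (Units.mk0 _ hb0), vertexOf_mul_scalar _ _, ?_⟩
  refine Submodule.span_le.2 ?_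
  rintro _ ⟨j, rfl⟩
  choose c hc using fun i => hb (i, j)
  have : (↑(g * GeneralLinearGroup.scalar (Fin 3) (Units.mk0 _ hb0)) :
      Matrix (Fin 3) (Fin 3) K⸨X⸩).col j
      = ∑ i, c i • ((1 : GL (Fin 3) K⸨X⸩) : Matrix (Fin 3) (Fin 3) K⸨X⸩).col i := by
    ext1 k
    have := hc k
    simp only [Algebra.smul_def, LaurentSeries.coe_algebraMap] at this
    simp [Matrix.one_apply, Algebra.smul_def, this, mul_comm]
  rw [this]
  exact Submodule.sum_mem _ fun i _ => Submodule.smul_mem _ _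
    (Submodule.subset_span ⟨i, rfl⟩)

/-- The color `τ([L]) = log_q [𝒪³ : L] mod 3`, for a representative `L ⊆ 𝒪³` of the vertex
(the result does not depend on the representative). -/
def color (x : Vertex K) : ZMod 3 :=
  (Nat.log (Nat.card K)
    ((lattice (Classical.choose (exists_integral_rep x))).toAddSubgroup.relIndex
      (lattice (1 : GL (Fin 3) K⸨X⸩)).toAddSubgroup) : ℕ)

/-- `y` is a neighbor of `x` with `τ(y) = τ(x) + i`. -/
def ColoredAdj (i : ZMod 3) (x y : Vertex K) : Prop :=
  Adj x y ∧ color y = color x + i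

/-- The colored adjacency operator `A_i` on functions on the vertices of the building. -/
def coloredAdjacency (i : ZMod 3) (f : Vertex K → ℂ) (x : Vertex K) : ℂ :=
  ∑ᶠ y ∈ {y : Vertex K | ColoredAdj i x y}, f y

/-! ### The quotient `Γ \ 𝓑(G)` with its weights -/

variable (K) in
/-- The vertices of the quotient: `Γ`-orbits of vertices. -/
def QVertex : Type _ := MulAction.orbitRel.Quotient (Gam K) (Vertex K)

variable (K) in
/-- `Γ`-orbits of ordered pairs of vertices (for the diagonal action). The oriented edges of the
quotient are the orbits of pairs of adjacent vertices. -/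
def QPair : Type _ := MulAction.orbitRel.Quotient (Gam K) (Vertex K × Vertex K)

/-- The orbit `Γx`. -/
def QVertex.mk (x : Vertex K) : QVertex K := Quotient.mk'' x

/-- The orbit `Γ(x, y)`. -/
def QPair.mk (p : Vertex K × Vertex K) : QPair K := Quotient.mk'' p

/-- `Γ(x, y) ↦ Γx`. -/
def QPair.origin (e : QPair K) : QVertex K :=
  Quotient.liftOn' e (fun p => QVertex.mk p.1) (by
    rintro _ p ⟨γ, rfl⟩
    exact Quotient.sound' ⟨γ, rfl⟩)

/-- `Γ(x, y) ↦ Γy`. -/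
def QPair.terminus (e : QPair K) : QVertex K :=
  Quotient.liftOn' e (fun p => QVertex.mk p.2) (by
    rintro _ p ⟨γ, rfl⟩
    exact Quotient.sound' ⟨γ, rfl⟩)

/-- `e` is the orbit of an edge `(x, y)` with `τ(y) = τ(x) + i`. -/
def QPair.IsEdge (i : ZMod 3) (e : QPair K) : Prop :=
  ∃ x y : Vertex K, QPair.mk (x, y) = e ∧ ColoredAdj i x y

variable (K) in
/-- The normalizing constant `q³ (q + 1) (q - 1)²` of the weights. -/
def weightConst : ℝ := (Nat.card K : ℝ) ^ 3 * (Nat.card K + 1) * ((Nat.card K : ℝ) - 1) ^ 2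

/-- The weight `w(Γx) = q³ (q + 1) (q - 1)² / |Γ_x|` of a vertex. -/
def vertexWeight (u : QVertex K) : ℝ :=
  weightConst K / Nat.card (MulAction.stabilizer (Gam K) (Quotient.out u : Vertex K))

/-- The weight `w(Γ(x, y)) = q³ (q + 1) (q - 1)² / |Γ_x ∩ Γ_y|` of an edge. -/
def edgeWeight (e : QPair K) : ℝ :=
  weightConst K / Nat.card
    (MulAction.stabilizer (Gam K) (Quotient.out e : Vertex K × Vertex K) : Subgroup (Gam K))

/-- The weighted adjacency operator on functions on the vertices of the quotient:
`A_w f(u) = ∑ (w(e) / w(u)) f(v)`, over the edges `e` from `u` to `v` with `τ(v) = τ(u) + i`. -/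
def weightedAdjacency (i : ZMod 3) (f : QVertex K → ℂ) (u : QVertex K) : ℂ :=
  ∑ᶠ e ∈ {e : QPair K | e.IsEdge i ∧ e.origin = u},
    ((edgeWeight e / vertexWeight u : ℝ) : ℂ) * f e.terminus

instance : MeasurableSpace (QVertex K) := ⊤

variable (K) in
/-- The measure `μ(S) = ∑_{v ∈ S} w(v)` on the vertices of the quotient. -/
def weightMeasure : Measure (QVertex K) :=
  Measure.sum fun u => ENNReal.ofReal (vertexWeight u) • Measure.dirac u

variable (K) in
/-- `L²` of the vertices of the building. -/
abbrev L2Building : Type _ := lp (fun _ : Vertex K => ℂ) 2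

variable (K) in
/-- `L²_w(Γ \ 𝓑(G))`. -/
abbrev L2Quotient : Type _ := Lp ℂ 2 (weightMeasure K)

/-- The simultaneous spectrum of two operators: pairs of simultaneous approximate eigenvalues. -/
def simultaneousSpectrum {E : Type*} [NormedAddCommGroup E] [NormedSpace ℂ E]
    (A B : E →L[ℂ] E) : Set (ℂ × ℂ) :=
  {l | ∃ f : ℕ → E, (∀ n, ‖f n‖ = 1) ∧
    Tendsto (fun n => ‖A (f n) - l.1 • f n‖) atTop (𝓝 0) ∧
    Tendsto (fun n => ‖B (f n) - l.2 • f n‖) atTop (𝓝 0)}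

/-! ### Sets in the complex plane -/

/-- `r` times the three cube roots of unity. -/
def rootTriple (r : ℝ) : Set ℂ :=
  {(r : ℂ), r * Complex.exp (2 * Real.pi * Complex.I / 3),
    r * Complex.exp (4 * Real.pi * Complex.I / 3)}

/-- The three trivial points. -/
def Sigma0 (q : ℝ) : Set ℂ := rootTriple (q ^ 2 + q + 1)

/-- The curve `q^{3/2} e^{iθ} + q e^{-2iθ} + q^{1/2} e^{iθ}`. -/
def Sigma1 (q : ℝ) : Set ℂ :=
  Set.range fun θ : ℝ =>
    ((q ^ (3 / 2 : ℝ) : ℝ) : ℂ) * Complex.exp (θ * Complex.I)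
      + q * Complex.exp (-2 * θ * Complex.I)
      + ((q ^ (1 / 2 : ℝ) : ℝ) : ℂ) * Complex.exp (θ * Complex.I)

/-- The triples of complex numbers of modulus one with product one. -/
def unitTriples : Set (ℂ × ℂ × ℂ) :=
  {s | ‖s.1‖ = 1 ∧ ‖s.2.1‖ = 1 ∧ ‖s.2.2‖ = 1 ∧ s.1 * s.2.1 * s.2.2 = 1}

/-- The set of all `q (s₁ + s₂ + s₃)`. -/
def Sigma2 (q : ℝ) : Set ℂ :=
  (fun s : ℂ × ℂ × ℂ => (q : ℂ) * (s.1 + s.2.1 + s.2.2)) '' unitTriples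

/-- The image of `s ↦ (q σ₁(s), q σ₂(s))`, with `σₖ` the elementary symmetric functions. -/
def Sigma2Pairs (q : ℝ) : Set (ℂ × ℂ) :=
  (fun s : ℂ × ℂ × ℂ => ((q : ℂ) * (s.1 + s.2.1 + s.2.2),
    (q : ℂ) * (s.1 * s.2.1 + s.1 * s.2.2 + s.2.1 * s.2.2))) '' unitTriples

/-- The hypocycloid traced by a point of a circle of radius `r` rolling inside a circle of
radius `3 r` centered at the origin. -/
def hypocycloid (r θ : ℝ) : ℂ :=
  (3 * r - r : ℝ) * Complex.exp (θ * Complex.I)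
    + r * Complex.exp (-((3 * r - r) / r : ℝ) * θ * Complex.I)

/-- `z` is an (ordinary, semicubical) cusp of the parametrized curve `γ`. -/
def IsCusp (γ : ℝ → ℂ) (z : ℂ) : Prop :=
  ∃ θ : ℝ, γ θ = z ∧ deriv γ θ = 0 ∧
    LinearIndependent ℝ ![iteratedDeriv 2 γ θ, iteratedDeriv 3 γ θ]

/-- The interior of a closed curve: the union of the bounded components of its complement. -/
def curveInterior (C : Set ℂ) : Set ℂ :=
  {z | z ∉ C ∧ Bornology.IsBounded (connectedComponentIn Cᶜ z)}

end A2Quotient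

end

/-!
Both halves of the theorem rest on explicit upper triangular representatives. By the Iwasawa
decomposition every vertex of the building is `[n d 𝒪³]` with `n` unipotent upper triangular and
`d = diag(X^a, X^b, X^c)`, and its horospherical coordinate `typ = (a - b, b - c)` is well defined.

**The building.** The `q² + q + 1` neighbors of color `+1` of a vertex have three possible relative
horospherical coordinates, so `A₁ = U₁ + U₂ + U₃`, where `Uᵢ` has norm at most `q`
(`norm_U_le`): it is given by a relation with at most `q²`, `q`, `1` successors and `1`, `q`, `q²`
predecessors. Multiplying the representatives gives `U₁U₂ + U₁U₃ + U₂U₃ = q A₂` and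
`U₁U₂U₃ = q³`, hence `hecke_factorization`:
`(1 - Y U₁)(1 - Y U₂)(1 - Y U₃) = 1 - Y A₁ + q Y² A₂ - q³ Y³`. The left side is invertible for
`|Y| < 1/q`. Since `A₂ = A₁*` commutes with `A₁`, the functional calculus shows that for `λ` in the
spectrum of `A₁` the cubic `1 - λ Y + q λ̄ Y² - q³ Y³` has no root in `|Y| < 1/q`. This cubic is
self-reciprocal, so its roots all have modulus `1/q`, which says exactly that `λ` lies in `Σ₂`
(`spectrum_A1_subset`). Conversely, the set of vertices `[n d 𝒪³]` with `n` integral and `d`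
fixed in the cone `a ≥ b ≥ c` has `q^{2(a - c)}` elements. On functions that are constant
on these sets and supported deep in the cone, `A₁` is a convolution operator on `ℤ²`, and truncated
multiples of characters are approximate eigenvectors (`exists_lattice_approx`). The
simultaneous spectrum follows from normality.

**The quotient.** A unipotent step from a diagonal vertex with sorted exponents can be undone in `Γ`;
as the building is connected, every vertex is `Γ`-equivalent to a diagonal one
(`exists_eq_diagOrbit`), with unique sorted exponents (`diagOrbit_injective`). So `Γ \ 𝓑` is the
cone `ℕ²`, the orbit `(i, j)` being that of `diag(1, X^i, X^{i + j})`, with a stabilizer of order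
between `q^{2(i + j)}` and `q^{2(i + j) + 9}`. By orbit counting
`A_w⁺` is induced by `A₁`: it is the sum of three terms `q² f(i - 1, j)`, `q f(i + 1, j - 1)`,
`f(i, j + 1)`, with folding at the walls, and it is bounded. The function `β^{2i + j}` satisfies
the eigenvalue equation with eigenvalue `q² β⁻² + q β + β` except at the wall `i = 0`. For `β³ = 1`
it is an eigenvector, as the total weight is finite, which gives `Σ₀`. As `|β|` increases to
`q^{1/2}` its norm tends to infinity while the error stays bounded, which gives `Σ₁`. Functions
supported far from the walls give `Σ₂`, by `exists_lattice_approx` again.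

**The plane curves.** The discriminant `|z|⁴ - 8 Re z³ + 18 |z|² - 27` of the cubic
`X³ - z X² + z̄ X - 1` is nonpositive exactly when the three roots lie on the unit circle, and
vanishes exactly when moreover two of them agree, that is, on the hypocycloid. Off the region, a root
`ρ E` with `ρ > 1`, `|E| = 1` gives `z = (ρ + ρ⁻¹) E + E⁻²`; the curve `T ↦ T E + E⁻²` connects `z`
to infinity outside of the hypocycloid. So the region is the hypocycloid with its interior.
-/

noncomputable section

namespace A2Quotient

open Matrix MeasureTheory Filter Topology

/-! ### Integral Laurent series and integral matrices -/

section

variable {K : Type*} [Field K]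

variable (K) in
/-- The valuation ring `𝒪 = K⟦X⟧`, as a subring of the field of Laurent series. -/
def intRing : Subring K⸨X⸩ := (algebraMap K⟦X⟧ K⸨X⸩).range

theorem mem_intRing_iff {x : K⸨X⸩} : x ∈ intRing K ↔ ∀ n < 0, x.coeff n = 0 := by
  constructor
  · rintro ⟨p, rfl⟩ n hn
    simp only [LaurentSeries.coe_algebraMap, PowerSeries.coeff_coe]
    simp [hn]
  · intro h
    refine ⟨PowerSeries.mk fun n => x.coeff n, ?_⟩
    ext n
    simp only [LaurentSeries.coe_algebraMap, PowerSeries.coeff_coe]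
    split_ifs with hn
    · exact (h n hn).symm
    · rw [PowerSeries.coeff_mk, Int.natAbs_of_nonneg (not_lt.1 hn)]

theorem mem_intRing_iff_order {x : K⸨X⸩} (hx : x ≠ 0) : x ∈ intRing K ↔ 0 ≤ x.order := by
  rw [mem_intRing_iff]
  constructor
  · intro h
    by_contra hlt
    exact HahnSeries.coeff_order_eq_zero.not.2 hx (h _ (not_le.1 hlt))
  · intro h n hn
    exact HahnSeries.coeff_eq_zero_of_lt_order (hn.trans_le h)

/-- The power `X ^ a` of the uniformizer, for `a : ℤ`. -/
def unif (K : Type*) [Field K] (a : ℤ) : K⸨X⸩ := HahnSeries.single a 1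

@[simp] theorem unif_zero : unif K 0 = 1 := rfl

theorem unif_add (a b : ℤ) : unif K (a + b) = unif K a * unif K b := by
  simp [unif]

@[simp] theorem unif_ne_zero (a : ℤ) : unif K a ≠ 0 := by
  simp [unif]

theorem order_unif (a : ℤ) : (unif K a).order = a := by
  simp [unif]

theorem unif_mem_intRing {a : ℤ} : unif K a ∈ intRing K ↔ 0 ≤ a := by
  rw [mem_intRing_iff_order (unif_ne_zero a), order_unif]

theorem C_mem_intRing (c : K) : (HahnSeries.C c : K⸨X⸩) ∈ intRing K :=
  ⟨PowerSeries.C c, by simp⟩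

theorem exists_unif_mul_unit {x : K⸨X⸩} (hx : x ≠ 0) :
    ∃ y ∈ intRing K, y⁻¹ ∈ intRing K ∧ y ≠ 0 ∧ x = unif K x.order * y := by
  have hu := unif_ne_zero (K := K) x.order
  have h0 : x / unif K x.order ≠ 0 := div_ne_zero hx hu
  have ho : (x / unif K x.order).order = 0 := by
    have h1 : (unif K x.order * (x / unif K x.order)).order = _ := HahnSeries.order_mul hu h0
    rw [mul_div_cancel₀ _ hu, order_unif] at h1
    omega
  have ho' : (x / unif K x.order)⁻¹.order = 0 := by
    have h1 : ((x / unif K x.order) * (x / unif K x.order)⁻¹).order = _ :=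
      HahnSeries.order_mul h0 (inv_ne_zero h0)
    rw [mul_inv_cancel₀ h0, HahnSeries.order_one] at h1
    omega
  refine ⟨x / unif K x.order, (mem_intRing_iff_order h0).2 ho.ge,
    (mem_intRing_iff_order (inv_ne_zero h0)).2 ho'.ge, h0, (mul_div_cancel₀ _ hu).symm⟩

/-- Division with remainder by the uniformizer. -/
theorem exists_const_add {x : K⸨X⸩} (hx : x ∈ intRing K) :
    ∃ c : K, ∃ y ∈ intRing K, x = HahnSeries.C c + unif K 1 * y := by
  obtain ⟨p, rfl⟩ := hx
  refine ⟨PowerSeries.coeff 0 p, algebraMap _ _ (PowerSeries.mk fun n => PowerSeries.coeff (n + 1) p),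
    ⟨_, rfl⟩, ?_⟩
  have := PowerSeries.eq_X_mul_shift_add_const p
  conv_lhs => rw [this]
  simp only [map_add, map_mul, LaurentSeries.coe_algebraMap, HahnSeries.ofPowerSeries_X,
    HahnSeries.ofPowerSeries_C, unif]
  rw [add_comm]
  simp

theorem C_eq_zero_of_mem {c : K} {y : K⸨X⸩} (hy : y ∈ intRing K)
    (h : HahnSeries.C c = unif K 1 * y) : c = 0 := by
  have := congrArg (fun z => HahnSeries.coeff z 0) h
  simp only [HahnSeries.C_apply, HahnSeries.coeff_single_same] at this
  rw [this, show (0 : ℤ) = -1 + 1 by norm_num, unif, HahnSeries.coeff_single_mul_add]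
  simp [mem_intRing_iff.1 hy (-1) (by norm_num)]

/-- A matrix over the Laurent series with entries in `𝒪`. -/
def IntMat (m : Matrix (Fin 3) (Fin 3) K⸨X⸩) : Prop := ∀ i j, m i j ∈ intRing K

theorem IntMat.mul {m n : Matrix (Fin 3) (Fin 3) K⸨X⸩} (hm : IntMat m) (hn : IntMat n) :
    IntMat (m * n) := fun i j => by
  rw [Matrix.mul_apply]
  exact sum_mem fun k _ => mul_mem (hm i k) (hn k j)

theorem IntMat.one : IntMat (1 : Matrix (Fin 3) (Fin 3) K⸨X⸩) := fun i j => by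
  rw [Matrix.one_apply]; split_ifs
  exacts [one_mem _, zero_mem _]

theorem IntMat.det {m : Matrix (Fin 3) (Fin 3) K⸨X⸩} (hm : IntMat m) : m.det ∈ intRing K := by
  rw [Matrix.det_fin_three]
  have := hm
  exact sub_mem (add_mem (add_mem (sub_mem (sub_mem (mul_mem (mul_mem (hm _ _) (hm _ _)) (hm _ _))
    (mul_mem (mul_mem (hm _ _) (hm _ _)) (hm _ _))) (mul_mem (mul_mem (hm _ _) (hm _ _)) (hm _ _)))
    (mul_mem (mul_mem (hm _ _) (hm _ _)) (hm _ _))) (mul_mem (mul_mem (hm _ _) (hm _ _)) (hm _ _)))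
    (mul_mem (mul_mem (hm _ _) (hm _ _)) (hm _ _))

theorem IntMat.exists_lift {m : Matrix (Fin 3) (Fin 3) K⸨X⸩} (hm : IntMat m) :
    ∃ p : Matrix (Fin 3) (Fin 3) K⟦X⟧, p.map (algebraMap K⟦X⟧ K⸨X⸩) = m := by
  choose p hp using hm
  exact ⟨Matrix.of p, by ext1 i j; simpa using hp i j⟩

variable (K) in
/-- `GL(3, 𝒪)` inside `GL(3, K((X)))`. -/
def intGL : Subgroup (GL (Fin 3) K⸨X⸩) :=
  (GeneralLinearGroup.map (n := Fin 3) (algebraMap K⟦X⟧ K⸨X⸩)).range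

theorem mem_intGL_iff {k : GL (Fin 3) K⸨X⸩} :
    k ∈ intGL K ↔ IntMat k.1 ∧ IntMat (k⁻¹).1 := by
  constructor
  · rintro ⟨k, rfl⟩
    refine ⟨fun i j => ⟨k.1 i j, rfl⟩, fun i j => ?_⟩
    rw [← map_inv]
    exact ⟨(k⁻¹).1 i j, rfl⟩
  · rintro ⟨h1, h2⟩
    obtain ⟨p, hp⟩ := h1.exists_lift
    obtain ⟨p', hp'⟩ := h2.exists_lift
    have hinj : Function.Injective
        (fun m : Matrix (Fin 3) (Fin 3) K⟦X⟧ => m.map (algebraMap K⟦X⟧ K⸨X⸩)) :=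
      Matrix.map_injective (IsFractionRing.injective K⟦X⟧ K⸨X⸩)
    refine ⟨⟨p, p', hinj ?_, hinj ?_⟩, ?_⟩
    · simp only [Matrix.map_mul, hp, hp']
      simp
    · simp only [Matrix.map_mul, hp, hp']
      simp
    · exact Units.ext hp

theorem det_ne_zero' (g : GL (Fin 3) K⸨X⸩) : g.1.det ≠ 0 := g.det_ne_zero

theorem det_inv_val (g : GL (Fin 3) K⸨X⸩) : (g⁻¹).1.det = (g.1.det)⁻¹ := by
  refine eq_inv_of_mul_eq_one_left ?_
  rw [← Matrix.det_mul, ← Units.val_mul]; simp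

variable (K) in
/-- The valuation of the determinant. -/
def ordDet (g : GL (Fin 3) K⸨X⸩) : ℤ := g.1.det.order

theorem ordDet_mul (g h : GL (Fin 3) K⸨X⸩) : ordDet K (g * h) = ordDet K g + ordDet K h := by
  rw [ordDet, Units.val_mul, Matrix.det_mul,
    HahnSeries.order_mul (det_ne_zero' g) (det_ne_zero' h)]; rfl

theorem ordDet_inv (g : GL (Fin 3) K⸨X⸩) : ordDet K g⁻¹ = -ordDet K g := by
  have := ordDet_mul g g⁻¹
  rw [mul_inv_cancel] at this
  simp [ordDet] at this ⊢
  omega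

theorem ordDet_nonneg {g : GL (Fin 3) K⸨X⸩} (hg : IntMat g.1) : 0 ≤ ordDet K g :=
  (mem_intRing_iff_order (det_ne_zero' g)).1 hg.det

theorem ordDet_of_mem_intGL {k : GL (Fin 3) K⸨X⸩} (hk : k ∈ intGL K) : ordDet K k = 0 := by
  rw [mem_intGL_iff] at hk
  have h1 := ordDet_nonneg hk.1
  have h2 := ordDet_nonneg hk.2
  rw [ordDet_inv] at h2
  omega

theorem mem_intGL_of_ordDet {k : GL (Fin 3) K⸨X⸩} (hk : IntMat k.1) (h : ordDet K k = 0) :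
    k ∈ intGL K := by
  obtain ⟨p, hp⟩ := hk.exists_lift
  rw [mem_intGL_iff]
  refine ⟨hk, fun i j => ?_⟩
  have hinv : k.1.det⁻¹ ∈ intRing K := by
    rw [mem_intRing_iff_order (inv_ne_zero (det_ne_zero' k)), ← det_inv_val]
    change 0 ≤ ordDet K k⁻¹
    rw [ordDet_inv, h]; rfl
  have h1 : (k⁻¹).1 = k.1.det⁻¹ • k.1.adjugate := by
    rw [Matrix.coe_units_inv, Matrix.inv_def, Ring.inverse_eq_inv']
  rw [h1, Matrix.smul_apply, smul_eq_mul]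
  refine mul_mem hinv ?_
  rw [← hp]
  have h2 := RingHom.map_adjugate (algebraMap K⟦X⟧ K⸨X⸩) p
  have h3 : (p.map (algebraMap K⟦X⟧ K⸨X⸩)).adjugate i j = algebraMap K⟦X⟧ K⸨X⸩ (p.adjugate i j) :=
    (congrFun (congrFun h2 i) j).symm
  rw [h3]
  exact ⟨_, rfl⟩

/-! ### Vertices and lattices in terms of matrices -/

theorem ordDet_scalar (z : (K⸨X⸩)ˣ) :
    ordDet K (GeneralLinearGroup.scalar (Fin 3) z) = 3 * z.1.order := by
  have : (GeneralLinearGroup.scalar (Fin 3) z).1.det = z.1 * z.1 * z.1 := by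
    simp [GeneralLinearGroup.coe_scalar, Matrix.scalar_apply,
      Matrix.det_diagonal]
    ring
  rw [ordDet, this, HahnSeries.order_mul (mul_ne_zero z.ne_zero z.ne_zero) z.ne_zero,
    HahnSeries.order_mul z.ne_zero z.ne_zero]
  ring

theorem vertexOf_eq_iff {g h : GL (Fin 3) K⸨X⸩} :
    vertexOf g = vertexOf h ↔
      ∃ k ∈ intGL K, ∃ z : (K⸨X⸩)ˣ, h = g * k * GeneralLinearGroup.scalar (Fin 3) z := by
  rw [vertexOf, vertexOf, QuotientGroup.eq]
  constructor
  · rintro ⟨k, hk⟩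
    have h1 : ProjGenLinGroup.mk (g * GeneralLinearGroup.map (algebraMap K⟦X⟧ K⸨X⸩) k)
        = ProjGenLinGroup.mk h := by
      rw [map_mul, show ProjGenLinGroup.mk (GeneralLinearGroup.map (algebraMap K⟦X⟧ K⸨X⸩) k) = _
        from hk, mul_inv_cancel_left]
    obtain ⟨z, hz⟩ := ProjGenLinGroup.mk_eq_mk_iff.1 h1
    exact ⟨_, ⟨k, rfl⟩, z, hz.symm⟩
  · rintro ⟨_, ⟨k, rfl⟩, z, rfl⟩
    refine ⟨k, ?_⟩
    simp [mul_assoc]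

theorem vertexOf_mul_intGL (g : GL (Fin 3) K⸨X⸩) {k : GL (Fin 3) K⸨X⸩} (hk : k ∈ intGL K) :
    vertexOf (g * k) = vertexOf g :=
  (vertexOf_eq_iff.2 ⟨k, hk, 1, by simp⟩).symm

theorem mk_smul_vertexOf (g h : GL (Fin 3) K⸨X⸩) :
    ProjGenLinGroup.mk g • vertexOf h = vertexOf (g * h) := by
  simp [vertexOf]

theorem vertexOf_mul_left_eq_iff (g : GL (Fin 3) K⸨X⸩) {h h' : GL (Fin 3) K⸨X⸩} :
    vertexOf (g * h) = vertexOf (g * h') ↔ vertexOf h = vertexOf h' := by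
  rw [← mk_smul_vertexOf, ← mk_smul_vertexOf, smul_left_cancel_iff]

theorem mem_lattice_iff {g : GL (Fin 3) K⸨X⸩} {v : Fin 3 → K⸨X⸩} :
    v ∈ lattice g ↔ ∀ i, (g⁻¹.1 *ᵥ v) i ∈ intRing K := by
  rw [lattice, Submodule.mem_span_range_iff_exists_fun]
  constructor
  · rintro ⟨c, rfl⟩ i
    have h1 : ∑ j, c j • g.1.col j = g.1 *ᵥ (fun j => algebraMap K⟦X⟧ K⸨X⸩ (c j)) := by
      ext1 k
      simp [Matrix.mulVec, dotProduct, Algebra.smul_def, mul_comm]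
    rw [h1, Matrix.mulVec_mulVec, ← Units.val_mul, inv_mul_cancel, Units.val_one,
      Matrix.one_mulVec]
    exact ⟨_, rfl⟩
  · intro h
    choose c hc using h
    refine ⟨c, ?_⟩
    have h1 : ∑ j, c j • g.1.col j = g.1 *ᵥ (fun j => algebraMap K⟦X⟧ K⸨X⸩ (c j)) := by
      ext1 k
      simp [Matrix.mulVec, dotProduct, Algebra.smul_def, mul_comm]
    rw [h1, funext hc, Matrix.mulVec_mulVec, ← Units.val_mul, mul_inv_cancel, Units.val_one,
      Matrix.one_mulVec]

theorem lattice_le_iff {g h : GL (Fin 3) K⸨X⸩} : lattice h ≤ lattice g ↔ IntMat (g⁻¹ * h).1 := by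
  constructor
  · intro hle i j
    have h1 : h.1.col j ∈ lattice g := hle (Submodule.subset_span ⟨j, rfl⟩)
    have h2 := mem_lattice_iff.1 h1 i
    rwa [Units.val_mul, Matrix.mul_apply]
  · intro hint v hv
    rw [mem_lattice_iff] at hv ⊢
    have h1 : g⁻¹.1 *ᵥ v = (g⁻¹ * h).1 *ᵥ (h⁻¹.1 *ᵥ v) := by
      rw [Matrix.mulVec_mulVec, ← Units.val_mul, mul_assoc, mul_inv_cancel, mul_one]
    intro i
    rw [h1]
    rw [Matrix.mulVec, dotProduct]
    exact sum_mem fun j _ => mul_mem (hint i j) (hv j)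

/-- The uniformizer as a unit of the field of Laurent series. -/
def unifUnit (K : Type*) [Field K] : (K⸨X⸩)ˣ := Units.mk0 (unif K 1) (unif_ne_zero 1)

theorem X_smul_lattice (g : GL (Fin 3) K⸨X⸩) :
    (PowerSeries.X : K⟦X⟧) • lattice g
      = lattice (g * GeneralLinearGroup.scalar (Fin 3) (unifUnit K)) := by
  have hX : (algebraMap K⟦X⟧ K⸨X⸩) PowerSeries.X = unif K 1 := by
    simp [unif]
  have hcol : ∀ j, (g * GeneralLinearGroup.scalar (Fin 3) (unifUnit K)).1.col j
      = (PowerSeries.X : K⟦X⟧) • g.1.col j := by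
    intro j; ext1 i
    simp only [Pi.smul_apply, Algebra.smul_def, hX]
    simp [Matrix.scalar_apply, unifUnit, mul_comm]
  rw [lattice, lattice, Submodule.smul_span]
  congr 1
  ext v
  simp only [Set.mem_smul_set, Set.mem_range, exists_exists_eq_and]
  constructor
  · rintro ⟨j, rfl⟩; exact ⟨j, hcol j⟩
  · rintro ⟨j, rfl⟩; exact ⟨j, (hcol j).symm⟩

end

/-! ### Upper triangular matrices and the Iwasawa decomposition -/

section

variable {K : Type*} [Field K]

/-- The upper triangular matrix with diagonal `X ^ a, X ^ b, X ^ c` and entries `u, v, w` above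
it. -/
def ut (a b c : ℤ) (u v w : K⸨X⸩) : GL (Fin 3) K⸨X⸩ :=
  GeneralLinearGroup.mkOfDetNeZero !![unif K a, u, v; 0, unif K b, w; 0, 0, unif K c] (by
    simp [Matrix.det_fin_three])

theorem ut_val (a b c : ℤ) (u v w : K⸨X⸩) :
    (ut a b c u v w).1 = !![unif K a, u, v; 0, unif K b, w; 0, 0, unif K c] := rfl

theorem ut_mul (a b c a' b' c' : ℤ) (u v w u' v' w' : K⸨X⸩) :
    ut a b c u v w * ut a' b' c' u' v' w' = ut (a + a') (b + b') (c + c')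
      (unif K a * u' + u * unif K b') (unif K a * v' + u * w' + v * unif K c')
      (unif K b * w' + w * unif K c') := by
  apply Units.ext
  rw [Units.val_mul, ut_val, ut_val, ut_val]
  ext1 i j
  fin_cases i <;> fin_cases j <;> simp [Matrix.mul_apply, Fin.sum_univ_three, unif_add]

theorem ut_one : ut 0 0 0 0 0 0 = (1 : GL (Fin 3) K⸨X⸩) := by
  apply Units.ext
  rw [ut_val]
  ext1 i j
  fin_cases i <;> fin_cases j <;> simp

theorem ut_inv (a b c : ℤ) (u v w : K⸨X⸩) :
    (ut a b c u v w)⁻¹ = ut (-a) (-b) (-c) (-(unif K (-a) * u * unif K (-b)))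
      (unif K (-a) * (u * unif K (-b) * w - v) * unif K (-c))
      (-(unif K (-b) * w * unif K (-c))) := by
  rw [inv_eq_iff_mul_eq_one, ut_mul, ← ut_one]
  have ha : unif K a * unif K (-a) = 1 := by rw [← unif_add]; simp
  have hb : unif K b * unif K (-b) = 1 := by rw [← unif_add]; simp
  congr 1
  · ring
  · ring
  · ring
  · linear_combination (-u * unif K (-b)) * ha
  · linear_combination ((u * unif K (-b) * w - v) * unif K (-c)) * ha
  · linear_combination (-w * unif K (-c)) * hb

theorem ordDet_ut (a b c : ℤ) (u v w : K⸨X⸩) : ordDet K (ut a b c u v w) = a + b + c := by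
  have : (ut a b c u v w).1.det = unif K (a + b + c) := by
    rw [ut_val, Matrix.det_fin_three, unif_add, unif_add]; simp
  rw [ordDet, this, order_unif]

theorem intMat_ut {a b c : ℤ} {u v w : K⸨X⸩} : IntMat (ut a b c u v w).1 ↔
    0 ≤ a ∧ 0 ≤ b ∧ 0 ≤ c ∧ u ∈ intRing K ∧ v ∈ intRing K ∧ w ∈ intRing K := by
  rw [← unif_mem_intRing (K := K) (a := a), ← unif_mem_intRing (K := K) (a := b),
    ← unif_mem_intRing (K := K) (a := c)]
  constructor
  · intro h
    exact ⟨h 0 0, h 1 1, h 2 2, h 0 1, h 0 2, h 1 2⟩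
  · rintro ⟨h1, h2, h3, h4, h5, h6⟩ i j
    rw [ut_val]
    fin_cases i <;> fin_cases j <;> simp [*, zero_mem]

theorem ut_mem_intGL {x y z : K⸨X⸩} (hx : x ∈ intRing K) (hy : y ∈ intRing K)
    (hz : z ∈ intRing K) : ut 0 0 0 x y z ∈ intGL K :=
  mem_intGL_of_ordDet (intMat_ut.2 ⟨le_rfl, le_rfl, le_rfl, hx, hy, hz⟩) (by simp [ordDet_ut])

theorem vertexOf_ut_add (a b c : ℤ) (u v w : K⸨X⸩) (n : ℤ) :
    vertexOf (ut (a + n) (b + n) (c + n) (unif K n * u) (unif K n * v) (unif K n * w))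
      = vertexOf (ut a b c u v w) := by
  refine (vertexOf_eq_iff.2 ⟨1, one_mem _, Units.mk0 _ (unif_ne_zero n), ?_⟩).symm
  apply Units.ext
  rw [mul_one, Units.val_mul, ut_val, ut_val, GeneralLinearGroup.coe_scalar]
  ext1 i j
  fin_cases i <;> fin_cases j <;> simp [Matrix.scalar_apply, unif_add, mul_comm]

theorem exists_intGL_of_order {m : Matrix (Fin 3) (Fin 3) K⸨X⸩} (hm : IntMat m)
    (h0 : m.det ≠ 0) (h : m.det.order = 0) : ∃ k ∈ intGL K, k.1 = m :=
  ⟨GeneralLinearGroup.mkOfDetNeZero m h0, mem_intGL_of_ordDet hm h, rfl⟩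

theorem exists_intGL_of_det {m : Matrix (Fin 3) (Fin 3) K⸨X⸩} (hm : IntMat m)
    (h : m.det = 1 ∨ m.det = -1) : ∃ k ∈ intGL K, k.1 = m := by
  rcases h with h | h
  · exact exists_intGL_of_order hm (by simp [h]) (by simp [h])
  · exact exists_intGL_of_order hm (by simp [h]) (by simp [h])

/-- A Euclidean step: two entries of a row can be combined integrally to zero. -/
theorem exists_int_combination (x y : K⸨X⸩) : ∃ α ∈ intRing K, ∃ β ∈ intRing K,
    ∃ γ ∈ intRing K, ∃ δ ∈ intRing K, x * α + y * γ = 0 ∧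
      (α * δ - β * γ = 1 ∨ α * δ - β * γ = -1) := by
  have h1 := one_mem (intRing K)
  have h0 := zero_mem (intRing K)
  by_cases hx : x = 0
  · exact ⟨1, h1, 0, h0, 0, h0, 1, h1, by simp [hx], by simp⟩
  by_cases hxy : y ≠ 0 ∧ x / y ∈ intRing K
  · exact ⟨1, h1, 0, h0, -(x / y), neg_mem hxy.2, 1, h1, by field_simp [hxy.1]; ring, by simp⟩
  · have hyx : y / x ∈ intRing K := by
      by_cases hy : y = 0
      · simp [hy, zero_mem]
      · have h2 : ¬ x / y ∈ intRing K := fun h => hxy ⟨hy, h⟩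
        rw [mem_intRing_iff_order (div_ne_zero hx hy)] at h2
        rw [mem_intRing_iff_order (div_ne_zero hy hx)]
        have h3 := HahnSeries.order_mul (div_ne_zero hx hy) (div_ne_zero hy hx)
        rw [div_mul_div_cancel₀ hy, div_self hx, HahnSeries.order_one] at h3
        omega
    exact ⟨-(y / x), neg_mem hyx, 1, h1, 1, h1, 0, h0, by field_simp; ring, by simp⟩

/-- The Iwasawa decomposition. -/
theorem exists_ut_mul (g : GL (Fin 3) K⸨X⸩) : ∃ a b c : ℤ, ∃ u v w : K⸨X⸩, ∃ k ∈ intGL K,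
    g = ut a b c u v w * k := by
  have h1 := one_mem (intRing K)
  have h0 := zero_mem (intRing K)
  -- Clear the entries `(2,0)`, `(2,1)`, `(1,0)` by integral column operations, then make the
  -- diagonal entries powers of the uniformizer.
  obtain ⟨k₁, hk₁, e₁⟩ : ∃ k ∈ intGL K, (g * k).1 2 0 = 0 := by
    obtain ⟨α, hα, β, hβ, γ, hγ, δ, hδ, h, hd⟩ := exists_int_combination (g.1 2 0) (g.1 2 2)
    obtain ⟨k, hk, e⟩ := exists_intGL_of_det (m := !![α, 0, β; 0, 1, 0; γ, 0, δ])
      (by intro i j; fin_cases i <;> fin_cases j <;> simp [*])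
      (by simpa [Matrix.det_fin_three] using hd)
    refine ⟨k, hk, ?_⟩
    rw [Units.val_mul, e, Matrix.mul_apply, Fin.sum_univ_three]
    simpa using h
  obtain ⟨k₂, hk₂, e₂, e₂'⟩ : ∃ k ∈ intGL K, (g * k).1 2 0 = 0 ∧ (g * k).1 2 1 = 0 := by
    obtain ⟨α, hα, β, hβ, γ, hγ, δ, hδ, h, hd⟩ :=
      exists_int_combination ((g * k₁).1 2 1) ((g * k₁).1 2 2)
    obtain ⟨k, hk, e⟩ := exists_intGL_of_det (m := !![1, 0, 0; 0, α, β; 0, γ, δ])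
      (by intro i j; fin_cases i <;> fin_cases j <;> simp [*])
      (by simpa [Matrix.det_fin_three] using hd)
    refine ⟨k₁ * k, mul_mem hk₁ hk, ?_, ?_⟩
    · rw [← mul_assoc, Units.val_mul, e, Matrix.mul_apply, Fin.sum_univ_three]
      simpa using e₁
    · rw [← mul_assoc, Units.val_mul, e, Matrix.mul_apply, Fin.sum_univ_three]
      simpa using h
  obtain ⟨k₃, hk₃, e₃, e₃', e₃''⟩ : ∃ k ∈ intGL K,
      (g * k).1 2 0 = 0 ∧ (g * k).1 2 1 = 0 ∧ (g * k).1 1 0 = 0 := by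
    obtain ⟨α, hα, β, hβ, γ, hγ, δ, hδ, h, hd⟩ :=
      exists_int_combination ((g * k₂).1 1 0) ((g * k₂).1 1 1)
    obtain ⟨k, hk, e⟩ := exists_intGL_of_det (m := !![α, β, 0; γ, δ, 0; 0, 0, 1])
      (by intro i j; fin_cases i <;> fin_cases j <;> simp [*])
      (by simpa [Matrix.det_fin_three] using hd)
    refine ⟨k₂ * k, mul_mem hk₂ hk, ?_, ?_, ?_⟩
    · rw [← mul_assoc, Units.val_mul, e, Matrix.mul_apply, Fin.sum_univ_three]
      simp [e₂, e₂']
    · rw [← mul_assoc, Units.val_mul, e, Matrix.mul_apply, Fin.sum_univ_three]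
      simp [e₂, e₂']
    · rw [← mul_assoc, Units.val_mul, e, Matrix.mul_apply, Fin.sum_univ_three]
      simpa using h
  have hdet : (g * k₃).1 0 0 * (g * k₃).1 1 1 * (g * k₃).1 2 2 ≠ 0 := by
    have := det_ne_zero' (g * k₃)
    rw [Matrix.det_fin_three] at this
    simpa [e₃, e₃', e₃''] using this
  have d0 := left_ne_zero_of_mul (left_ne_zero_of_mul hdet)
  have d1 := right_ne_zero_of_mul (left_ne_zero_of_mul hdet)
  have d2 := right_ne_zero_of_mul hdet
  obtain ⟨y₀, hy₀, hy₀', n₀, r₀⟩ := exists_unif_mul_unit d0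
  obtain ⟨y₁, hy₁, hy₁', n₁, r₁⟩ := exists_unif_mul_unit d1
  obtain ⟨y₂, hy₂, hy₂', n₂, r₂⟩ := exists_unif_mul_unit d2
  obtain ⟨k₄, hk₄, e₄⟩ := exists_intGL_of_order (m := !![y₀, 0, 0; 0, y₁, 0; 0, 0, y₂])
      (by intro i j; fin_cases i <;> fin_cases j <;> simp [*])
      (by simp [Matrix.det_fin_three, *])
      (by
        have q₀ := (mem_intRing_iff_order n₀).1 hy₀
        have q₁ := (mem_intRing_iff_order n₁).1 hy₁
        have q₂ := (mem_intRing_iff_order n₂).1 hy₂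
        have h' := mul_mem (mul_mem hy₀' hy₁') hy₂'
        rw [← mul_inv, ← mul_inv, mem_intRing_iff_order
          (inv_ne_zero (mul_ne_zero (mul_ne_zero n₀ n₁) n₂))] at h'
        have h'' := HahnSeries.order_mul (mul_ne_zero (mul_ne_zero n₀ n₁) n₂)
          (inv_ne_zero (mul_ne_zero (mul_ne_zero n₀ n₁) n₂))
        rw [mul_inv_cancel₀ (mul_ne_zero (mul_ne_zero n₀ n₁) n₂), HahnSeries.order_one,
          HahnSeries.order_mul (mul_ne_zero n₀ n₁) n₂, HahnSeries.order_mul n₀ n₁] at h''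
        have h3 : (!![y₀, 0, 0; 0, y₁, 0; 0, 0, y₂] : Matrix (Fin 3) (Fin 3) K⸨X⸩).det
            = y₀ * y₁ * y₂ := by simp [Matrix.det_fin_three]
        rw [h3, HahnSeries.order_mul (mul_ne_zero n₀ n₁) n₂, HahnSeries.order_mul n₀ n₁]
        omega)
  refine ⟨((g * k₃).1 0 0).order, ((g * k₃).1 1 1).order, ((g * k₃).1 2 2).order,
    (g * k₃).1 0 1 * y₁⁻¹, (g * k₃).1 0 2 * y₂⁻¹, (g * k₃).1 1 2 * y₂⁻¹,
    k₄ * k₃⁻¹, mul_mem hk₄ (inv_mem hk₃), ?_⟩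
  rw [← mul_assoc, eq_mul_inv_iff_mul_eq]
  apply Units.ext
  rw [Units.val_mul (ut _ _ _ _ _ _), e₄, ut_val]
  ext1 i j
  rw [Matrix.mul_apply, Fin.sum_univ_three]
  clear hdet e₄
  fin_cases i <;> fin_cases j <;> simp [e₃, e₃', e₃'', n₁, n₂]
  · exact r₀
  · exact r₁
  · exact r₂

theorem exists_vertexOf_ut (x : Vertex K) : ∃ a b c : ℤ, ∃ u v w : K⸨X⸩,
    x = vertexOf (ut a b c u v w) := by
  obtain ⟨g, rfl⟩ := vertexOf_surjective x
  obtain ⟨a, b, c, u, v, w, k, hk, rfl⟩ := exists_ut_mul g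
  exact ⟨a, b, c, u, v, w, vertexOf_mul_intGL _ hk⟩

theorem ut_inj {a b c a' b' c' : ℤ} {u v w u' v' w' : K⸨X⸩}
    (h : ut a b c u v w = ut a' b' c' u' v' w') : u = u' ∧ v = v' ∧ w = w' := by
  have f : ∀ i j, (ut a b c u v w).1 i j = (ut a' b' c' u' v' w').1 i j := by simp [h]
  exact ⟨f 0 1, f 0 2, f 1 2⟩

theorem mul_scalar_apply (k : GL (Fin 3) K⸨X⸩) (s : (K⸨X⸩)ˣ) (i j : Fin 3) :
    (k * GeneralLinearGroup.scalar (Fin 3) s : GL (Fin 3) K⸨X⸩).1 i j = k.1 i j * s.1 := by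
  simp [Matrix.scalar_apply]

/-- The equality of two vertices given by upper triangular matrices. -/
theorem vertexOf_ut_eq {a b c a' b' c' : ℤ} {u v w u' v' w' : K⸨X⸩}
    (h : vertexOf (ut a b c u v w) = vertexOf (ut a' b' c' u' v' w')) :
    ∃ n : ℤ, a' = a + n ∧ b' = b + n ∧ c' = c + n ∧ ∃ x ∈ intRing K, ∃ y ∈ intRing K,
      ∃ z ∈ intRing K, u' = unif K n * (unif K a * x + u) ∧
        v' = unif K n * (unif K a * y + u * z + v) ∧ w' = unif K n * (unif K b * z + w) := by
  obtain ⟨k, hk, s, hs⟩ := vertexOf_eq_iff.1 h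
  have hk1 := (mem_intGL_iff.1 hk).1
  have hm : (ut a b c u v w)⁻¹ * ut a' b' c' u' v' w' = k * GeneralLinearGroup.scalar (Fin 3) s := by
    rw [hs]; group
  rw [ut_inv, ut_mul] at hm
  have e := mul_scalar_apply k s
  rw [← hm] at e
  have e00 : unif K (-a + a') = _ := e 0 0
  have e11 : unif K (-b + b') = _ := e 1 1
  have e22 : unif K (-c + c') = _ := e 2 2
  have e01 := e 0 1
  have e02 := e 0 2
  have e12 := e 1 2
  have ho : ∀ {n : ℤ} {x : K⸨X⸩}, x ∈ intRing K → unif K n = x * s.1 →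
      0 ≤ x.order ∧ n = x.order + s.1.order := by
    intro n x hx hn
    have hx0 : x ≠ 0 := by rintro rfl; simp at hn
    refine ⟨(mem_intRing_iff_order hx0).1 hx, ?_⟩
    rw [← HahnSeries.order_mul hx0 s.ne_zero, ← hn, order_unif]
  -- The diagonal entries of `k` have nonnegative orders with sum zero, so the orders vanish.
  obtain ⟨p0, q0⟩ := ho (hk1 0 0) e00
  obtain ⟨p1, q1⟩ := ho (hk1 1 1) e11
  obtain ⟨p2, q2⟩ := ho (hk1 2 2) e22
  have hd := congrArg (ordDet K) hs
  rw [ordDet_mul, ordDet_mul, ordDet_ut, ordDet_ut, ordDet_of_mem_intGL hk, ordDet_scalar] at hd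
  have A : a' = a + s.1.order := by omega
  have B : b' = b + s.1.order := by omega
  have C : c' = c + s.1.order := by omega
  obtain ⟨y, hy, -, -, hy4⟩ := exists_unif_mul_unit s.ne_zero
  refine ⟨s.1.order, A, B, C, k.1 0 1 * y, mul_mem (hk1 _ _) hy, k.1 0 2 * y,
    mul_mem (hk1 _ _) hy, k.1 1 2 * y, mul_mem (hk1 _ _) hy, ?_⟩
  have hkk : k * GeneralLinearGroup.scalar (Fin 3) s
      = ut s.1.order s.1.order s.1.order (k.1 0 1 * s.1) (k.1 0 2 * s.1) (k.1 1 2 * s.1) := by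
    rw [← hm]
    congr 1 <;> first | assumption | omega
  rw [mul_assoc, hkk, ut_mul] at hs
  obtain ⟨f01, f02, f12⟩ := ut_inj hs
  rw [f01, f02, f12]
  generalize hn : s.1.order = n at *
  rw [hy4]
  refine ⟨by ring, by ring, by ring⟩

theorem exists_typ (x : Vertex K) : ∃ p : ℤ × ℤ, ∃ a b c : ℤ, ∃ u v w : K⸨X⸩,
    x = vertexOf (ut a b c u v w) ∧ p = (a - b, b - c) := by
  obtain ⟨a, b, c, u, v, w, h⟩ := exists_vertexOf_ut x
  exact ⟨_, a, b, c, u, v, w, h, rfl⟩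

/-- The horospherical coordinate of a vertex relative to the standard flag: the differences of the
diagonal exponents of an upper triangular representative. -/
def typ (x : Vertex K) : ℤ × ℤ := (exists_typ x).choose

theorem typ_vertexOf_ut (a b c : ℤ) (u v w : K⸨X⸩) :
    typ (vertexOf (ut a b c u v w)) = (a - b, b - c) := by
  obtain ⟨a', b', c', u', v', w', h, hp⟩ := (exists_typ (vertexOf (ut a b c u v w))).choose_spec
  obtain ⟨n, h1, h2, h3, -⟩ := vertexOf_ut_eq h
  rw [typ, hp, h1, h2, h3]
  ext <;> simp

end

/-! ### The color as the valuation of the determinant -/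

section

variable {K : Type*} [Field K]

/-- The index of `g 𝒪³` in `𝒪³`, for an integral matrix `g`. -/
def latIndex (g : GL (Fin 3) K⸨X⸩) : ℕ :=
  (lattice g).toAddSubgroup.relIndex (lattice (1 : GL (Fin 3) K⸨X⸩)).toAddSubgroup

theorem lattice_mul (g h : GL (Fin 3) K⸨X⸩) : (lattice (g * h)).toAddSubgroup =
    (lattice h).toAddSubgroup.map (Matrix.mulVecLin g.1).toAddMonoidHom := by
  ext v
  simp only [Submodule.mem_toAddSubgroup, AddSubgroup.mem_map, LinearMap.toAddMonoidHom_coe,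
    Matrix.mulVecLin_apply, mem_lattice_iff]
  constructor
  · intro hv
    refine ⟨g⁻¹.1 *ᵥ v, ?_, ?_⟩
    · rw [Matrix.mulVec_mulVec, ← Units.val_mul, ← _root_.mul_inv_rev]; exact hv
    · rw [Matrix.mulVec_mulVec, ← Units.val_mul]; simp
  · rintro ⟨x, hx, rfl⟩
    rw [Matrix.mulVec_mulVec, ← Units.val_mul, _root_.mul_inv_rev]; simpa using hx

theorem latIndex_mul {g h : GL (Fin 3) K⸨X⸩} (hg : IntMat g.1) (hh : IntMat h.1) :
    latIndex (g * h) = latIndex g * latIndex h := by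
  have h1 : (lattice (g * h)).toAddSubgroup.relIndex (lattice g).toAddSubgroup = latIndex h := by
    conv_lhs => rw [lattice_mul, ← mul_one g, lattice_mul g 1, mul_one g]
    apply AddSubgroup.relIndex_map_map_of_injective
    intro x y hxy
    have h2 : g⁻¹.1 *ᵥ (g.1 *ᵥ x) = g⁻¹.1 *ᵥ (g.1 *ᵥ y) := congrArg _ hxy
    simpa [Matrix.mulVec_mulVec, ← Units.val_mul] using h2
  rw [← h1, mul_comm]
  refine (AddSubgroup.relIndex_mul_relIndex _ _ _ ?_ ?_).symm
  · exact lattice_le_iff.2 (by simpa using hh)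
  · exact lattice_le_iff.2 (by simpa using hg)

theorem latIndex_of_mem_intGL {k : GL (Fin 3) K⸨X⸩} (hk : k ∈ intGL K) : latIndex k = 1 := by
  rw [latIndex, AddSubgroup.relIndex_eq_one]
  exact lattice_le_iff.2 (by simpa using (mem_intGL_iff.1 hk).2)

theorem latIndex_of_mem_iff {g : GL (Fin 3) K⸨X⸩} (i : Fin 3)
    (h : ∀ v, v ∈ lattice g ↔ v ∈ lattice (1 : GL (Fin 3) K⸨X⸩) ∧ (v i).coeff 0 = 0) :
    latIndex g = Nat.card K := by
  let φ : (lattice (1 : GL (Fin 3) K⸨X⸩)).toAddSubgroup →+ K :=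
    { toFun := fun v => (v.1 i).coeff 0
      map_zero' := by simp
      map_add' := by simp }
  have hker : φ.ker = (lattice g).toAddSubgroup.addSubgroupOf
      (lattice (1 : GL (Fin 3) K⸨X⸩)).toAddSubgroup := by
    ext v
    rw [AddMonoidHom.mem_ker, AddSubgroup.mem_addSubgroupOf, Submodule.mem_toAddSubgroup, h]
    exact ⟨fun hv => ⟨v.2, hv⟩, fun hv => hv.2⟩
  have hsurj : Function.Surjective φ := by
    intro c
    refine ⟨⟨fun _ => HahnSeries.C c, ?_⟩, by simp [φ, HahnSeries.C_apply]⟩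
    rw [Submodule.mem_toAddSubgroup, mem_lattice_iff]
    intro j
    simpa using C_mem_intRing c
  rw [latIndex, AddSubgroup.relIndex, ← hker, AddSubgroup.index_ker]
  exact Nat.card_congr ((Equiv.setCongr (by
    rw [AddMonoidHom.coe_range, hsurj.range_eq])).trans (Equiv.Set.univ K))

theorem unif_mul_mem_iff {x : K⸨X⸩} :
    unif K (-1) * x ∈ intRing K ↔ x ∈ intRing K ∧ x.coeff 0 = 0 := by
  have hc : ∀ n, (unif K (-1) * x).coeff n = x.coeff (n + 1) := by
    intro n
    have := HahnSeries.coeff_single_mul_add (r := (1 : K)) (x := x) (a := n + 1) (b := -1)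
    rw [unif, ← one_mul (x.coeff _), ← this]
    congr 1; ring
  rw [mem_intRing_iff, mem_intRing_iff]
  simp only [hc]
  constructor
  · intro h
    refine ⟨fun n hn => ?_, by simpa using h (-1) (by norm_num)⟩
    have := h (n - 1) (by omega)
    rwa [sub_add_cancel] at this
  · rintro ⟨h1, h2⟩ n hn
    rcases (show n + 1 < 0 ∨ n + 1 = 0 by omega) with h | h
    · exact h1 _ h
    · rw [h, h2]

theorem latIndex_unif :
    latIndex (ut 1 0 0 0 0 0 : GL (Fin 3) K⸨X⸩) = Nat.card K ∧
    latIndex (ut 0 1 0 0 0 0 : GL (Fin 3) K⸨X⸩) = Nat.card K ∧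
    latIndex (ut 0 0 1 0 0 0 : GL (Fin 3) K⸨X⸩) = Nat.card K := by
  refine ⟨latIndex_of_mem_iff 0 fun v => ?_, latIndex_of_mem_iff 1 fun v => ?_,
    latIndex_of_mem_iff 2 fun v => ?_⟩ <;>
  · rw [mem_lattice_iff, mem_lattice_iff, ut_inv, ut_val]
    have := unif_mul_mem_iff (x := v 0)
    have := unif_mul_mem_iff (x := v 1)
    have := unif_mul_mem_iff (x := v 2)
    simp only [Matrix.mulVec, dotProduct, Fin.sum_univ_three, Fin.forall_fin_succ]
    simp [*]
    try tauto

theorem latIndex_pow {g : GL (Fin 3) K⸨X⸩} (hg : IntMat g.1) (n : ℕ) :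
    latIndex (g ^ n) = latIndex g ^ n ∧ IntMat (g ^ n).1 := by
  induction n with
  | zero => exact ⟨by simpa using latIndex_of_mem_intGL (one_mem _), by simpa using IntMat.one⟩
  | succ n ih =>
    rw [pow_succ, pow_succ, latIndex_mul ih.2 hg, ih.1, Units.val_mul]
    exact ⟨rfl, ih.2.mul hg⟩

theorem diag_pow (a b c : ℤ) (n : ℕ) :
    (ut a b c 0 0 0 : GL (Fin 3) K⸨X⸩) ^ n = ut (n * a) (n * b) (n * c) 0 0 0 := by
  induction n with
  | zero => simp [ut_one]
  | succ n ih =>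
    rw [pow_succ, ih, ut_mul]
    congr 1 <;> push_cast <;> ring

/-- The index is `q ^ ord(det)`: it is multiplicative, and an upper triangular matrix is a product
of integral unipotent matrices and of matrices `diag(X, 1, 1)`, `diag(1, X, 1)`, `diag(1, 1, X)`. -/
theorem latIndex_eq_pow {g : GL (Fin 3) K⸨X⸩} (hg : IntMat g.1) :
    latIndex g = Nat.card K ^ (ordDet K g).toNat := by
  obtain ⟨a, b, c, u, v, w, k, hk, rfl⟩ := exists_ut_mul g
  have hk' := mem_intGL_iff.1 hk
  have hu : IntMat (ut a b c u v w).1 := by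
    have := hg.mul hk'.2
    rwa [← Units.val_mul, mul_inv_cancel_right] at this
  rw [latIndex_mul hu hk'.1, latIndex_of_mem_intGL hk, ordDet_mul, ordDet_of_mem_intGL hk,
    ordDet_ut]
  obtain ⟨ha, hb, hc, hu', hv', hw'⟩ := intMat_ut.1 hu
  lift a to ℕ using ha
  lift b to ℕ using hb
  lift c to ℕ using hc
  have z := zero_mem (intRing K)
  have i1 : IntMat (ut 1 0 0 0 0 0 : GL (Fin 3) K⸨X⸩).1 := intMat_ut.2 (by simp [z])
  have i2 : IntMat (ut 0 1 0 0 0 0 : GL (Fin 3) K⸨X⸩).1 := intMat_ut.2 (by simp [z])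
  have i3 : IntMat (ut 0 0 1 0 0 0 : GL (Fin 3) K⸨X⸩).1 := intMat_ut.2 (by simp [z])
  have n1 := ut_mem_intGL z z hw'
  have n2 := ut_mem_intGL hu' hv' z
  have e : ut (a : ℤ) b c u v w = ut 0 0 1 0 0 0 ^ c * (ut 0 0 0 0 0 w * (ut 0 1 0 0 0 0 ^ b *
      (ut 0 0 0 u v 0 * ut 1 0 0 0 0 0 ^ a))) := by
    rw [diag_pow, diag_pow, diag_pow, ut_mul, ut_mul, ut_mul, ut_mul]
    simp
  have j2 := (mem_intGL_iff.1 n2).1.mul (latIndex_pow i1 a).2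
  have j3 := (latIndex_pow i2 b).2.mul j2
  have j4 := (mem_intGL_iff.1 n1).1.mul j3
  rw [e, latIndex_mul (latIndex_pow i3 c).2 j4, latIndex_mul (mem_intGL_iff.1 n1).1 j3,
    latIndex_mul (latIndex_pow i2 b).2 j2, latIndex_mul (mem_intGL_iff.1 n2).1
    (latIndex_pow i1 a).2, (latIndex_pow i1 a).1, (latIndex_pow i2 b).1, (latIndex_pow i3 c).1,
    latIndex_of_mem_intGL n1, latIndex_of_mem_intGL n2, latIndex_unif.1, latIndex_unif.2.1,
    latIndex_unif.2.2, show ((a : ℤ) + b + c + 0).toNat = c + (b + a) by omega]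
  simp [pow_add]

/-- Homotheties change the order of the determinant by multiples of `3`. -/
theorem color_vertexOf [Finite K] (g : GL (Fin 3) K⸨X⸩) :
    color (vertexOf g) = (ordDet K g : ZMod 3) := by
  obtain ⟨h1, h2⟩ := Classical.choose_spec (exists_integral_rep (vertexOf g))
  obtain ⟨k, hk, z, hz⟩ := vertexOf_eq_iff.1 h1.symm
  set g₀ := Classical.choose (exists_integral_rep (vertexOf g)) with hg₀
  have hint : IntMat g₀.1 := by simpa using lattice_le_iff.1 h2
  have h3 : color (vertexOf g) = (Nat.log (Nat.card K) (latIndex g₀) : ℕ) := rfl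
  have h4 := ordDet_nonneg hint
  rw [h3, latIndex_eq_pow hint, Nat.log_pow Finite.one_lt_card]
  have h5 : ((ordDet K g₀).toNat : ZMod 3) = ((ordDet K g₀ : ℤ) : ZMod 3) := by
    conv_rhs => rw [← Int.toNat_of_nonneg h4]
    rw [Int.cast_natCast]
  rw [h5, hz, ordDet_mul, ordDet_mul, ordDet_of_mem_intGL hk, ordDet_scalar]
  have h6 : (3 : ZMod 3) = 0 := rfl
  push_cast
  simp [h6]

/-! ### Adjacency in terms of matrices -/

theorem scalar_mul_comm (z : (K⸨X⸩)ˣ) (g : GL (Fin 3) K⸨X⸩) :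
    GeneralLinearGroup.scalar (Fin 3) z * g = g * GeneralLinearGroup.scalar (Fin 3) z :=
  GeneralLinearGroup.scalar_commute z g

theorem ordDet_scalar_unif : ordDet K (GeneralLinearGroup.scalar (Fin 3) (unifUnit K)) = 3 := by
  rw [ordDet_scalar, unifUnit, Units.val_mk0, order_unif]; norm_num

theorem ordDet_pos_of_not_intMat_inv {m : GL (Fin 3) K⸨X⸩} (h : IntMat m.1)
    (h' : ¬ IntMat (m⁻¹).1) : 0 < ordDet K m := by
  refine lt_of_le_of_ne (ordDet_nonneg h) fun h0 => h' ?_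
  exact (mem_intGL_iff.1 (mem_intGL_of_ordDet h h0.symm)).2

/-- Neighbors of a vertex of a given relative color, in terms of matrices. -/
theorem coloredAdj_iff [Finite K] {i : ZMod 3} {g : GL (Fin 3) K⸨X⸩} {y : Vertex K} :
    ColoredAdj i (vertexOf g) y ↔ ∃ m : GL (Fin 3) K⸨X⸩, y = vertexOf (g * m) ∧ IntMat m.1 ∧
      IntMat (m⁻¹ * GeneralLinearGroup.scalar (Fin 3) (unifUnit K)).1 ∧
      0 < ordDet K m ∧ ordDet K m < 3 ∧ (ordDet K m : ZMod 3) = i := by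
  set s := GeneralLinearGroup.scalar (Fin 3) (unifUnit K) with hs
  have hsc : ∀ m : GL (Fin 3) K⸨X⸩, s * m = m * s := scalar_mul_comm _
  constructor
  · rintro ⟨⟨g₀, h₀, hg, rfl, h1, h2⟩, hc⟩
    obtain ⟨k, hk, z, rfl⟩ := vertexOf_eq_iff.1 hg.symm
    rw [X_smul_lattice, ← hs, lt_iff_le_not_ge, lattice_le_iff, lattice_le_iff] at h1
    rw [lt_iff_le_not_ge, lattice_le_iff, lattice_le_iff] at h2
    set g₀ := g * k * GeneralLinearGroup.scalar (Fin 3) z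
    have hk' := mem_intGL_iff.1 hk
    have p1 := ordDet_pos_of_not_intMat_inv h2.1 (by simpa using h2.2)
    have p2 := ordDet_pos_of_not_intMat_inv h1.1 (by simpa using h1.2)
    have e : ordDet K (k * (g₀⁻¹ * h₀)) = ordDet K (g₀⁻¹ * h₀) := by
      rw [ordDet_mul, ordDet_of_mem_intGL hk, zero_add]
    rw [ordDet_mul, ordDet_inv, ordDet_mul g₀ s, ordDet_scalar_unif] at p2
    have e' := ordDet_mul g₀⁻¹ h₀
    rw [ordDet_inv] at e'
    refine ⟨k * (g₀⁻¹ * h₀), ?_, ?_, ?_, by omega, by omega, ?_⟩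
    · rw [← vertexOf_mul_scalar (g * (k * (g₀⁻¹ * h₀))) z, mul_assoc, mul_assoc k,
        ← scalar_mul_comm, ← mul_assoc k, ← mul_assoc, ← mul_assoc g, ← mul_assoc,
        mul_inv_cancel, one_mul]
    · rw [Units.val_mul]; exact hk'.1.mul h2.1
    · rw [show (k * (g₀⁻¹ * h₀))⁻¹ * s = h₀⁻¹ * (g₀ * s) * k⁻¹ by
        simp only [_root_.mul_inv_rev, _root_.inv_inv, mul_assoc, hsc], Units.val_mul]
      exact h1.1.mul hk'.2
    · rw [color_vertexOf, ← hg, color_vertexOf] at hc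
      rw [e, e']
      push_cast
      rw [hc]; ring
  · rintro ⟨m, rfl, h1, h2, h3, h4, h5⟩
    refine ⟨⟨g, g * m, rfl, rfl, ?_, ?_⟩, ?_⟩
    · rw [X_smul_lattice, ← hs, lt_iff_le_not_ge, lattice_le_iff, lattice_le_iff]
      refine ⟨?_, fun h => ?_⟩
      · rwa [show (g * m)⁻¹ * (g * s) = m⁻¹ * s by group]
      · have := ordDet_nonneg h
        rw [show (g * s)⁻¹ * (g * m) = s⁻¹ * m by group, ordDet_mul, ordDet_inv,
          ordDet_scalar_unif] at this
        omega
    · rw [lt_iff_le_not_ge, lattice_le_iff, lattice_le_iff]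
      refine ⟨by simpa using h1, fun h => ?_⟩
      have := ordDet_nonneg h
      rw [show (g * m)⁻¹ * g = m⁻¹ by group, ordDet_inv] at this
      omega
    · rw [color_vertexOf, color_vertexOf, ordDet_mul]
      push_cast
      rw [h5]

theorem coloredAdj_smul_iff [Finite K] {i : ZMod 3} (p : G K) {x y : Vertex K} :
    ColoredAdj i (p • x) (p • y) ↔ ColoredAdj i x y := by
  suffices H : ∀ (p : G K) (x y : Vertex K), ColoredAdj i x y → ColoredAdj i (p • x) (p • y) from
    ⟨fun h => by simpa using H p⁻¹ _ _ h, H p x y⟩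
  intro p x y h
  obtain ⟨g, rfl⟩ := ProjGenLinGroup.mk_surjective p
  obtain ⟨x, rfl⟩ := vertexOf_surjective x
  obtain ⟨m, rfl, hm⟩ := coloredAdj_iff.1 h
  rw [mk_smul_vertexOf, mk_smul_vertexOf]
  exact coloredAdj_iff.2 ⟨m, by rw [mul_assoc], hm⟩

/-- The relation `π L ⊂ L' ⊂ L` gives `π L' ⊂ π L ⊂ L'`: adjacency is symmetric, and the color
difference changes sign. -/
theorem coloredAdj_two_of_one [Finite K] {i j : ZMod 3} (hij : i + j = 0) {x y : Vertex K}
    (h : ColoredAdj i x y) : ColoredAdj j y x := by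
  obtain ⟨g, rfl⟩ := vertexOf_surjective x
  obtain ⟨m, rfl, h1, h2, h3, h4, h5⟩ := coloredAdj_iff.1 h
  set s := GeneralLinearGroup.scalar (Fin 3) (unifUnit K) with hs
  have e : ordDet K (m⁻¹ * s) = 3 - ordDet K m := by
    rw [ordDet_mul, ordDet_inv, ordDet_scalar_unif]; ring
  refine coloredAdj_iff.2 ⟨m⁻¹ * s, ?_, h2, ?_, by omega, by omega, ?_⟩
  · rw [show g * m * (m⁻¹ * s) = g * s by group]
    exact (vertexOf_mul_scalar _ _).symm
  · rw [show (m⁻¹ * s)⁻¹ * s = m by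
      rw [_root_.mul_inv_rev, inv_inv, mul_assoc, ← scalar_mul_comm, inv_mul_cancel_left]]
    exact h1
  · rw [e, ← sub_eq_zero]
    push_cast
    rw [h5, show (3 : ZMod 3) = 0 from rfl]
    linear_combination -hij

theorem coloredAdj_two_iff [Finite K] {x y : Vertex K} : ColoredAdj 2 x y ↔ ColoredAdj 1 y x :=
  ⟨coloredAdj_two_of_one rfl, coloredAdj_two_of_one rfl⟩

end

/-! ### The neighbors of a vertex, sorted by horospherical direction -/

section

variable {K : Type*} [Field K]

theorem intMat_ut_inv_mul_unif {a b c : ℤ} {u v w : K⸨X⸩}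
    (h : IntMat ((ut a b c u v w)⁻¹ * GeneralLinearGroup.scalar (Fin 3) (unifUnit K)).1) :
    a ≤ 1 ∧ b ≤ 1 ∧ c ≤ 1 ∧ unif K (-a) * u * unif K (-b) * unif K 1 ∈ intRing K ∧
      unif K (-a) * (u * unif K (-b) * w - v) * unif K (-c) * unif K 1 ∈ intRing K ∧
      unif K (-b) * w * unif K (-c) * unif K 1 ∈ intRing K := by
  rw [ut_inv] at h
  have e := fun i j => h i j
  simp only [mul_scalar_apply] at e
  have e00 : unif K (-a) * unif K 1 ∈ intRing K := e 0 0
  have e11 : unif K (-b) * unif K 1 ∈ intRing K := e 1 1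
  have e22 : unif K (-c) * unif K 1 ∈ intRing K := e 2 2
  have e01 : -(unif K (-a) * u * unif K (-b)) * unif K 1 ∈ intRing K := e 0 1
  have e12 : -(unif K (-b) * w * unif K (-c)) * unif K 1 ∈ intRing K := e 1 2
  rw [← unif_add, unif_mem_intRing] at e00 e11 e22
  rw [neg_mul, neg_mem_iff] at e01 e12
  exact ⟨by omega, by omega, by omega, e01, e 0 2, e12⟩

/-- The colored neighbors are represented by upper triangular matrices with entries of valuation
`0` or `1` on the diagonal. -/
theorem coloredAdj_iff_ut [Finite K] {i : ZMod 3} {g : GL (Fin 3) K⸨X⸩} {y : Vertex K} :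
    ColoredAdj i (vertexOf g) y ↔ ∃ a b c : ℤ, ∃ u v w : K⸨X⸩,
      y = vertexOf (g * ut a b c u v w) ∧ IntMat (ut a b c u v w).1 ∧
      IntMat ((ut a b c u v w)⁻¹ * GeneralLinearGroup.scalar (Fin 3) (unifUnit K)).1 ∧
      0 < a + b + c ∧ a + b + c < 3 ∧ ((a + b + c : ℤ) : ZMod 3) = i := by
  rw [coloredAdj_iff]
  constructor
  · rintro ⟨m, rfl, h1, h2, h3, h4, h5⟩
    obtain ⟨a, b, c, u, v, w, k, hk, rfl⟩ := exists_ut_mul m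
    have hk' := mem_intGL_iff.1 hk
    rw [ordDet_mul, ordDet_ut, ordDet_of_mem_intGL hk, add_zero] at h3 h4 h5
    refine ⟨a, b, c, u, v, w, ?_, ?_, ?_, h3, h4, h5⟩
    · rw [← mul_assoc, vertexOf_mul_intGL _ hk]
    · have := h1.mul hk'.2
      rwa [← Units.val_mul, mul_inv_cancel_right] at this
    · have := hk'.1.mul h2
      rwa [← Units.val_mul, _root_.mul_inv_rev, mul_assoc, mul_inv_cancel_left] at this
  · rintro ⟨a, b, c, u, v, w, rfl, h1, h2, h3, h4, h5⟩
    exact ⟨_, rfl, h1, h2, by rwa [ordDet_ut], by rwa [ordDet_ut], by rwa [ordDet_ut]⟩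

theorem vertexOf_mul_ut_eq (g : GL (Fin 3) K⸨X⸩) {m m' : GL (Fin 3) K⸨X⸩} {x y z : K⸨X⸩}
    (hx : x ∈ intRing K) (hy : y ∈ intRing K) (hz : z ∈ intRing K)
    (h : m = m' * ut 0 0 0 x y z) : vertexOf (g * m) = vertexOf (g * m') := by
  rw [h, ← mul_assoc, vertexOf_mul_intGL _ (ut_mem_intGL hx hy hz)]

local notation "𝐜" => (HahnSeries.C : K →+* K⸨X⸩)

theorem unif_neg_mul {a : ℤ} (x : K⸨X⸩) : unif K a * (unif K (-a) * x) = x := by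
  rw [← mul_assoc, ← unif_add]; simp

theorem ut_inv_mul_unif (a b c : ℤ) (x y z : K⸨X⸩) :
    (ut a b c x y z)⁻¹ * GeneralLinearGroup.scalar (Fin 3) (unifUnit K)
      = ut (1 - a) (1 - b) (1 - c) (-(unif K (-a) * x * unif K (-b)) * unif K 1)
        (unif K (-a) * (x * unif K (-b) * z - y) * unif K (-c) * unif K 1)
        (-(unif K (-b) * z * unif K (-c)) * unif K 1) := by
  rw [ut_inv]
  apply Units.ext
  ext1 i j
  rw [mul_scalar_apply, ut_val, ut_val]
  fin_cases i <;> fin_cases j <;> simp [unifUnit, sub_eq_neg_add, unif_add]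

theorem coloredAdj_one_iff [Finite K] {g : GL (Fin 3) K⸨X⸩} {y : Vertex K} :
    ColoredAdj 1 (vertexOf g) y ↔
      (∃ p : K × K, vertexOf (g * ut 1 0 0 (𝐜 p.1) (𝐜 p.2) 0) = y) ∨
      (∃ s : K, vertexOf (g * ut 0 1 0 0 0 (𝐜 s)) = y) ∨ vertexOf (g * ut 0 0 1 0 0 0) = y := by
  rw [coloredAdj_iff_ut]
  have z := zero_mem (intRing K)
  constructor
  · rintro ⟨a, b, c, u, v, w, rfl, h1, h2, h3, h4, h5⟩
    obtain ⟨ha, hb, hc, hu, hv, hw⟩ := intMat_ut.1 h1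
    obtain ⟨ha', hb', hc', hu', hv', hw'⟩ := intMat_ut_inv_mul_unif h2
    have hs : a + b + c = 1 := by
      rcases (show a + b + c = 1 ∨ a + b + c = 2 by omega) with h | h
      · exact h
      · rw [h] at h5; exact absurd h5 (by decide)
    rcases (show (a = 1 ∧ b = 0 ∧ c = 0) ∨ (a = 0 ∧ b = 1 ∧ c = 0) ∨ (a = 0 ∧ b = 0 ∧ c = 1) by
      omega) with ⟨rfl, rfl, rfl⟩ | ⟨rfl, rfl, rfl⟩ | ⟨rfl, rfl, rfl⟩
    · obtain ⟨u₀, x, hx, rfl⟩ := exists_const_add hu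
      obtain ⟨v₀, y, hy, e⟩ := exists_const_add (sub_mem hv (mul_mem (C_mem_intRing u₀) hw))
      refine Or.inl ⟨(u₀, v₀), (vertexOf_mul_ut_eq g hx hy hw ?_).symm⟩
      rw [ut_mul]
      simp only [unif_zero]
      congr 1
      · ring
      · linear_combination e
      · ring
    · obtain ⟨w₀, x, hx, rfl⟩ := exists_const_add hw
      refine Or.inr (Or.inl ⟨w₀, (vertexOf_mul_ut_eq g hu hv hx ?_).symm⟩)
      rw [ut_mul]
      simp [add_comm]
    · refine Or.inr (Or.inr (vertexOf_mul_ut_eq g hu hv hw ?_).symm)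
      rw [ut_mul]
      simp
  · rintro (⟨p, rfl⟩ | ⟨s, rfl⟩ | rfl)
    · refine ⟨_, _, _, _, _, _, rfl, intMat_ut.2 ?_, ?_, by norm_num, by norm_num, by norm_num⟩
      · simp [-HahnSeries.C_apply, C_mem_intRing, z]
      · rw [ut_inv_mul_unif, intMat_ut]
        simp only [unif_zero, mul_one, one_mul, neg_zero, mul_zero, zero_sub, zero_mul,
          neg_mul, mul_right_comm _ _ (unif K 1), ← unif_add, neg_add_cancel]
        simp [-HahnSeries.C_apply, C_mem_intRing, z]
    · refine ⟨_, _, _, _, _, _, rfl, intMat_ut.2 ?_, ?_, by norm_num, by norm_num, by norm_num⟩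
      · simp [-HahnSeries.C_apply, C_mem_intRing, z]
      · rw [ut_inv_mul_unif, intMat_ut]
        simp only [unif_zero, mul_one, one_mul, neg_zero, mul_zero, zero_sub, zero_mul,
          neg_mul, mul_right_comm _ _ (unif K 1), ← unif_add, neg_add_cancel]
        simp [-HahnSeries.C_apply, C_mem_intRing, z]
    · refine ⟨_, _, _, _, _, _, rfl, intMat_ut.2 ?_, ?_, by norm_num, by norm_num, by norm_num⟩
      · simp [z]
      · rw [ut_inv_mul_unif, intMat_ut]
        simp [z]

theorem coloredAdj_two_iff_ut [Finite K] {g : GL (Fin 3) K⸨X⸩} {y : Vertex K} :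
    ColoredAdj 2 (vertexOf g) y ↔
      (∃ p : K × K, vertexOf (g * ut 1 1 0 0 (𝐜 p.1) (𝐜 p.2)) = y) ∨
      (∃ s : K, vertexOf (g * ut 1 0 1 (𝐜 s) 0 0) = y) ∨ vertexOf (g * ut 0 1 1 0 0 0) = y := by
  rw [coloredAdj_iff_ut]
  have z := zero_mem (intRing K)
  constructor
  · rintro ⟨a, b, c, u, v, w, rfl, h1, h2, h3, h4, h5⟩
    obtain ⟨ha, hb, hc, hu, hv, hw⟩ := intMat_ut.1 h1
    obtain ⟨ha', hb', hc', hu', hv', hw'⟩ := intMat_ut_inv_mul_unif h2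
    have hs : a + b + c = 2 := by
      rcases (show a + b + c = 1 ∨ a + b + c = 2 by omega) with h | h
      · rw [h] at h5; exact absurd h5 (by decide)
      · exact h
    rcases (show (a = 1 ∧ b = 1 ∧ c = 0) ∨ (a = 1 ∧ b = 0 ∧ c = 1) ∨ (a = 0 ∧ b = 1 ∧ c = 1) by
      omega) with ⟨rfl, rfl, rfl⟩ | ⟨rfl, rfl, rfl⟩ | ⟨rfl, rfl, rfl⟩
    · obtain ⟨v₀, y, hy, rfl⟩ := exists_const_add hv
      obtain ⟨w₀, x, hx, rfl⟩ := exists_const_add hw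
      refine Or.inl ⟨(v₀, w₀), (vertexOf_mul_ut_eq g (x := unif K (-1) * u) ?_ hy hx ?_).symm⟩
      · rwa [mul_assoc (_ * u), ← unif_add, neg_add_cancel, unif_zero, mul_one] at hu'
      · rw [ut_mul]
        simp [unif_neg_mul, add_comm]
    · obtain ⟨u₀, x, hx, rfl⟩ := exists_const_add hu
      refine Or.inr (Or.inl ⟨u₀, (vertexOf_mul_ut_eq g (y := x * w - unif K (-1) *
        ((𝐜 u₀ + unif K 1 * x) * w - v)) hx ?_ hw ?_).symm⟩)
      · refine sub_mem (mul_mem hx hw) ?_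
        rwa [mul_assoc (_ * _), ← unif_add, neg_add_cancel, neg_zero, unif_zero, mul_one,
          mul_one] at hv'
      · rw [ut_mul, mul_sub, unif_neg_mul]
        simp only [unif_zero]
        congr 1 <;> ring
    · refine Or.inr (Or.inr (vertexOf_mul_ut_eq g (z := unif K (-1) * w) hu hv ?_ ?_).symm)
      · rwa [mul_assoc (_ * w), ← unif_add, neg_add_cancel, unif_zero, mul_one] at hw'
      rw [ut_mul]
      simp [unif_neg_mul]
  · rintro (⟨p, rfl⟩ | ⟨s, rfl⟩ | rfl)
    · refine ⟨_, _, _, _, _, _, rfl, intMat_ut.2 ?_, ?_, by norm_num, by norm_num, by norm_num⟩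
      · simp [-HahnSeries.C_apply, C_mem_intRing, z]
      · rw [ut_inv_mul_unif, intMat_ut]
        simp only [unif_zero, mul_one, one_mul, neg_zero, mul_zero, zero_sub, zero_mul,
          neg_mul, mul_right_comm _ _ (unif K 1), ← unif_add, neg_add_cancel]
        simp [-HahnSeries.C_apply, C_mem_intRing, z]
    · refine ⟨_, _, _, _, _, _, rfl, intMat_ut.2 ?_, ?_, by norm_num, by norm_num, by norm_num⟩
      · simp [-HahnSeries.C_apply, C_mem_intRing, z]
      · rw [ut_inv_mul_unif, intMat_ut]
        simp only [unif_zero, mul_one, one_mul, neg_zero, mul_zero, zero_sub, zero_mul,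
          neg_mul, mul_right_comm _ _ (unif K 1), ← unif_add, neg_add_cancel]
        simp [-HahnSeries.C_apply, C_mem_intRing, z]
    · refine ⟨_, _, _, _, _, _, rfl, intMat_ut.2 ?_, ?_, by norm_num, by norm_num, by norm_num⟩
      · simp [z]
      · rw [ut_inv_mul_unif, intMat_ut]
        simp [z]

theorem C_eq_of_unif {c c' : K} {x : K⸨X⸩} (hx : x ∈ intRing K)
    (h : 𝐜 c' = 𝐜 c + unif K 1 * x) : c' = c := by
  rw [← sub_eq_zero]
  refine C_eq_zero_of_mem hx ?_
  rw [map_sub, h]; ring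

theorem injective_step_one (g : GL (Fin 3) K⸨X⸩) : Function.Injective
    (fun p : K × K => vertexOf (g * ut 1 0 0 (𝐜 p.1) (𝐜 p.2) 0)) := by
  intro p p' h
  obtain ⟨n, hn, -, -, x, hx, y, hy, z, hz, e1, e2, e3⟩ :=
    vertexOf_ut_eq ((vertexOf_mul_left_eq_iff g).1 h)
  obtain rfl : n = 0 := by omega
  have hz0 : z = 0 := by simpa using e3.symm
  subst hz0
  have h1 := C_eq_of_unif hx (c := p.1) (c' := p'.1) (by rw [e1, unif_zero]; ring)
  have h2 := C_eq_of_unif hy (c := p.2) (c' := p'.2) (by rw [e2, unif_zero]; ring)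
  exact Prod.ext h1.symm h2.symm

theorem injective_step_two (g : GL (Fin 3) K⸨X⸩) : Function.Injective
    (fun s : K => vertexOf (g * ut 0 1 0 0 0 (𝐜 s))) := by
  intro p p' h
  obtain ⟨n, hn, -, -, x, hx, y, hy, z, hz, e1, e2, e3⟩ :=
    vertexOf_ut_eq ((vertexOf_mul_left_eq_iff g).1 h)
  obtain rfl : n = 0 := by omega
  exact (C_eq_of_unif hz (by rw [e3, unif_zero]; ring)).symm

theorem injective_costep_three (g : GL (Fin 3) K⸨X⸩) : Function.Injective
    (fun p : K × K => vertexOf (g * ut 1 1 0 0 (𝐜 p.1) (𝐜 p.2))) := by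
  intro p p' h
  obtain ⟨n, hn, -, -, x, hx, y, hy, z, hz, e1, e2, e3⟩ :=
    vertexOf_ut_eq ((vertexOf_mul_left_eq_iff g).1 h)
  obtain rfl : n = 0 := by omega
  have h1 := C_eq_of_unif hy (c := p.1) (c' := p'.1) (by rw [e2, unif_zero]; ring)
  have h2 := C_eq_of_unif hz (c := p.2) (c' := p'.2) (by rw [e3, unif_zero]; ring)
  exact Prod.ext h1.symm h2.symm

theorem injective_costep_two (g : GL (Fin 3) K⸨X⸩) : Function.Injective
    (fun s : K => vertexOf (g * ut 1 0 1 (𝐜 s) 0 0)) := by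
  intro p p' h
  obtain ⟨n, hn, -, -, x, hx, y, hy, z, hz, e1, e2, e3⟩ :=
    vertexOf_ut_eq ((vertexOf_mul_left_eq_iff g).1 h)
  obtain rfl : n = 0 := by omega
  exact (C_eq_of_unif hx (by rw [e1, unif_zero]; ring)).symm

/-- `y` is an out-neighbor of `x`, the color increasing by one, in the horospherical
direction `d`. -/
def StepRel (d : ℤ × ℤ) (x y : Vertex K) : Prop := ColoredAdj 1 x y ∧ typ y = typ x + d

theorem typ_ut_mul_ut (a b c a' b' c' : ℤ) (u v w u' v' w' : K⸨X⸩) :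
    typ (vertexOf (ut a b c u v w * ut a' b' c' u' v' w'))
      = typ (vertexOf (ut a b c u v w)) + (a' - b', b' - c') := by
  rw [ut_mul, typ_vertexOf_ut, typ_vertexOf_ut]
  ext <;> simp <;> ring

section

variable [Finite K] (a b c : ℤ) (u v w : K⸨X⸩) {y : Vertex K}

theorem stepRel_one_iff : StepRel (1, 0) (vertexOf (ut a b c u v w)) y ↔
    ∃ p : K × K, vertexOf (ut a b c u v w * ut 1 0 0 (𝐜 p.1) (𝐜 p.2) 0) = y := by
  rw [StepRel, coloredAdj_one_iff]
  constructor
  · rintro ⟨⟨p, rfl⟩ | ⟨s, rfl⟩ | rfl, h⟩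
    · exact ⟨p, rfl⟩
    all_goals rw [typ_ut_mul_ut, add_right_inj] at h; simp at h
  · rintro ⟨p, rfl⟩
    exact ⟨Or.inl ⟨p, rfl⟩, by rw [typ_ut_mul_ut]; simp⟩

theorem stepRel_two_iff : StepRel (-1, 1) (vertexOf (ut a b c u v w)) y ↔
    ∃ s : K, vertexOf (ut a b c u v w * ut 0 1 0 0 0 (𝐜 s)) = y := by
  rw [StepRel, coloredAdj_one_iff]
  constructor
  · rintro ⟨⟨p, rfl⟩ | ⟨s, rfl⟩ | rfl, h⟩
    · rw [typ_ut_mul_ut, add_right_inj] at h; simp at h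
    · exact ⟨s, rfl⟩
    · rw [typ_ut_mul_ut, add_right_inj] at h; simp at h
  · rintro ⟨p, rfl⟩
    exact ⟨Or.inr (Or.inl ⟨p, rfl⟩), by rw [typ_ut_mul_ut]; simp⟩

theorem stepRel_three_iff : StepRel (0, -1) (vertexOf (ut a b c u v w)) y ↔
    vertexOf (ut a b c u v w * ut 0 0 1 0 0 0) = y := by
  rw [StepRel, coloredAdj_one_iff]
  constructor
  · rintro ⟨⟨p, rfl⟩ | ⟨s, rfl⟩ | rfl, h⟩
    · rw [typ_ut_mul_ut, add_right_inj] at h; simp at h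
    · rw [typ_ut_mul_ut, add_right_inj] at h; simp at h
    · rfl
  · rintro rfl
    exact ⟨Or.inr (Or.inr rfl), by rw [typ_ut_mul_ut]; simp⟩

theorem stepRel_one_iff' : StepRel (1, 0) y (vertexOf (ut a b c u v w)) ↔
    vertexOf (ut a b c u v w * ut 0 1 1 0 0 0) = y := by
  rw [StepRel, ← coloredAdj_two_iff, coloredAdj_two_iff_ut, ← sub_eq_iff_eq_add, eq_comm]
  constructor
  · rintro ⟨⟨p, rfl⟩ | ⟨s, rfl⟩ | rfl, h⟩
    · rw [typ_ut_mul_ut, sub_eq_add_neg, add_right_inj] at h; simp at h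
    · rw [typ_ut_mul_ut, sub_eq_add_neg, add_right_inj] at h; simp at h
    · rfl
  · rintro rfl
    exact ⟨Or.inr (Or.inr rfl), by rw [typ_ut_mul_ut, sub_eq_add_neg]; simp⟩

theorem stepRel_two_iff' : StepRel (-1, 1) y (vertexOf (ut a b c u v w)) ↔
    ∃ s : K, vertexOf (ut a b c u v w * ut 1 0 1 (𝐜 s) 0 0) = y := by
  rw [StepRel, ← coloredAdj_two_iff, coloredAdj_two_iff_ut, ← sub_eq_iff_eq_add, eq_comm]
  constructor
  · rintro ⟨⟨p, rfl⟩ | ⟨s, rfl⟩ | rfl, h⟩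
    · rw [typ_ut_mul_ut, sub_eq_add_neg, add_right_inj] at h; simp at h
    · exact ⟨s, rfl⟩
    · rw [typ_ut_mul_ut, sub_eq_add_neg, add_right_inj] at h; simp at h
  · rintro ⟨p, rfl⟩
    exact ⟨Or.inr (Or.inl ⟨p, rfl⟩), by rw [typ_ut_mul_ut, sub_eq_add_neg]; simp⟩

theorem stepRel_three_iff' : StepRel (0, -1) y (vertexOf (ut a b c u v w)) ↔
    ∃ p : K × K, vertexOf (ut a b c u v w * ut 1 1 0 0 (𝐜 p.1) (𝐜 p.2)) = y := by
  rw [StepRel, ← coloredAdj_two_iff, coloredAdj_two_iff_ut, ← sub_eq_iff_eq_add, eq_comm]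
  constructor
  · rintro ⟨⟨p, rfl⟩ | ⟨s, rfl⟩ | rfl, h⟩
    · exact ⟨p, rfl⟩
    · rw [typ_ut_mul_ut, sub_eq_add_neg, add_right_inj] at h; simp at h
    · rw [typ_ut_mul_ut, sub_eq_add_neg, add_right_inj] at h; simp at h
  · rintro ⟨p, rfl⟩
    exact ⟨Or.inl ⟨p, rfl⟩, by rw [typ_ut_mul_ut, sub_eq_add_neg]; simp⟩

theorem coloredAdj_one_iff_stepRel (x y : Vertex K) : ColoredAdj 1 x y ↔
    StepRel (1, 0) x y ∨ StepRel (-1, 1) x y ∨ StepRel (0, -1) x y := by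
  obtain ⟨a, b, c, u, v, w, rfl⟩ := exists_vertexOf_ut x
  rw [stepRel_one_iff, stepRel_two_iff, stepRel_three_iff, coloredAdj_one_iff]

end

end

/-! ### Operators on `ℓ²` given by locally finite relations -/

section

section RelOp

open scoped ENNReal NNReal

variable {V : Type*}

/-- A relation with at most `a` successors and at most `b` predecessors of each point. -/
structure BddRel (R : V → V → Prop) (a b : ℕ) : Prop where
  out_fin : ∀ x, {y | R x y}.Finite
  out_card : ∀ x, {y | R x y}.ncard ≤ a
  in_fin : ∀ y, {x | R x y}.Finite
  in_card : ∀ y, {x | R x y}.ncard ≤ b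

theorem BddRel.flip {R : V → V → Prop} {a b : ℕ} (h : BddRel R a b) :
    BddRel (fun x y => R y x) b a :=
  ⟨h.in_fin, h.in_card, h.out_fin, h.out_card⟩

theorem memlp_two_iff {f : V → ℂ} : Memℓp f 2 ↔ ∑' x, (‖f x‖₊ ^ 2 : ℝ≥0∞) ≠ ∞ := by
  rw [memℓp_gen_iff (by norm_num)]
  have h := ENNReal.tsum_coe_ne_top_iff_summable_coe (f := fun x => ‖f x‖₊ ^ 2)
  push_cast at h
  rw [h]
  simp

theorem ofReal_norm_sq_lp (f : lp (fun _ : V => ℂ) 2) :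
    ENNReal.ofReal (‖f‖ ^ 2) = ∑' x, (‖f x‖₊ ^ 2 : ℝ≥0∞) := by
  have h := lp.norm_rpow_eq_tsum (p := 2) (by norm_num) f
  have h2 := (memℓp_gen_iff (by norm_num)).1 (lp.memℓp f)
  simp only [ENNReal.toReal_ofNat, Real.rpow_ofNat] at h h2
  rw [h, ENNReal.ofReal_tsum_of_nonneg (fun _ => by positivity) h2]
  refine tsum_congr fun x => ?_
  rw [ENNReal.ofReal_pow (norm_nonneg _), ofReal_norm]
  rfl

/-- Schur's test for a relation, by Cauchy-Schwarz at each point and an exchange of the sums. -/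
theorem tsum_sq_finsum_le {R : V → V → Prop} {a b : ℕ} (h : BddRel R a b) (f : V → ℂ) :
    ∑' x, (‖∑ᶠ y ∈ {y | R x y}, f y‖₊ ^ 2 : ℝ≥0∞) ≤ (a * b : ℕ) * ∑' y, (‖f y‖₊ ^ 2 : ℝ≥0∞) := by
  classical
  have h1 : ∀ x, (‖∑ᶠ y ∈ {y | R x y}, f y‖₊ ^ 2 : ℝ≥0∞)
      ≤ a * ∑' y, if R x y then (‖f y‖₊ ^ 2 : ℝ≥0∞) else 0 := by
    intro x
    have hs : ∑' y, (if R x y then (‖f y‖₊ ^ 2 : ℝ≥0∞) else 0)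
        = ∑ y ∈ (h.out_fin x).toFinset, (‖f y‖₊ ^ 2 : ℝ≥0∞) := by
      rw [tsum_eq_sum (s := (h.out_fin x).toFinset)]
      · refine Finset.sum_congr rfl fun y hy => ?_
        rw [if_pos (by simpa using hy)]
      · intro y hy
        rw [if_neg (by simpa using hy)]
    rw [hs, finsum_mem_eq_finite_toFinset_sum _ (h.out_fin x)]
    have h2 : ‖∑ y ∈ (h.out_fin x).toFinset, f y‖₊ ^ 2
        ≤ a * ∑ y ∈ (h.out_fin x).toFinset, ‖f y‖₊ ^ 2 := by
      calc _ ≤ (∑ y ∈ (h.out_fin x).toFinset, ‖f y‖₊) ^ 2 := by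
            gcongr; exact nnnorm_sum_le _ _
        _ ≤ (h.out_fin x).toFinset.card * ∑ y ∈ (h.out_fin x).toFinset, ‖f y‖₊ ^ 2 :=
            sq_sum_le_card_mul_sum_sq
        _ ≤ _ := by
            gcongr
            rw [← Set.ncard_eq_toFinset_card _ (h.out_fin x)]
            exact h.out_card x
    exact_mod_cast h2
  calc _ ≤ ∑' x, (a * ∑' y, if R x y then (‖f y‖₊ ^ 2 : ℝ≥0∞) else 0) := ENNReal.tsum_le_tsum h1
    _ = a * ∑' y, ∑' x, if R x y then (‖f y‖₊ ^ 2 : ℝ≥0∞) else 0 := by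
        rw [ENNReal.tsum_mul_left, ENNReal.tsum_comm]
    _ ≤ a * ∑' y, (b * ‖f y‖₊ ^ 2 : ℝ≥0∞) := by
        gcongr with y
        rw [tsum_eq_sum (s := (h.in_fin y).toFinset)]
        · calc _ ≤ ∑ x ∈ (h.in_fin y).toFinset, (‖f y‖₊ ^ 2 : ℝ≥0∞) := by
                gcongr; split_ifs <;> simp
            _ ≤ _ := by
                rw [Finset.sum_const, nsmul_eq_mul, ← Set.ncard_eq_toFinset_card _ (h.in_fin y)]
                gcongr
                exact h.in_card y
        · intro x hx
          rw [if_neg (by simpa using hx)]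
    _ = _ := by rw [ENNReal.tsum_mul_left]; push_cast; ring

theorem finsum_mem_add_apply {R : V → V → Prop} (h : ∀ x, {y | R x y}.Finite) (f g : V → ℂ)
    (x : V) : ∑ᶠ y ∈ {y | R x y}, (f y + g y)
      = ∑ᶠ y ∈ {y | R x y}, f y + ∑ᶠ y ∈ {y | R x y}, g y := by
  simp only [finsum_mem_eq_finite_toFinset_sum _ (h x), Finset.sum_add_distrib]

theorem exists_relOp {R : V → V → Prop} {a b : ℕ} (h : BddRel R a b) :
    ∃ T : lp (fun _ : V => ℂ) 2 →L[ℂ] lp (fun _ : V => ℂ) 2,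
      (∀ f x, T f x = ∑ᶠ y ∈ {y | R x y}, f y) ∧ ‖T‖ ≤ √(a * b : ℕ) := by
  have hmem : ∀ f : lp (fun _ : V => ℂ) 2,
      Memℓp (fun x => ∑ᶠ y ∈ {y | R x y}, f y) 2 := by
    intro f
    rw [memlp_two_iff]
    refine ne_top_of_le_ne_top ?_ (tsum_sq_finsum_le h f)
    exact ENNReal.mul_ne_top (ENNReal.natCast_ne_top _) (memlp_two_iff.1 (lp.memℓp f))
  let L : lp (fun _ : V => ℂ) 2 →ₗ[ℂ] lp (fun _ : V => ℂ) 2 :=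
    { toFun := fun f => ⟨_, hmem f⟩
      map_add' := fun f g => by
        ext x
        exact finsum_mem_add_apply h.out_fin f g x
      map_smul' := fun c f => by
        ext x
        change ∑ᶠ y ∈ {y | R x y}, c * f y = c * ∑ᶠ y ∈ {y | R x y}, f y
        simp only [finsum_mem_eq_finite_toFinset_sum _ (h.out_fin x), Finset.mul_sum] }
  have hb : ∀ f, ‖L f‖ ≤ √(a * b : ℕ) * ‖f‖ := by
    intro f
    refine le_of_sq_le_sq ?_ (by positivity)
    rw [mul_pow, Real.sq_sqrt (by positivity)]
    rw [← ENNReal.ofReal_le_ofReal_iff (by positivity), ENNReal.ofReal_mul (by positivity),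
      ofReal_norm_sq_lp, ofReal_norm_sq_lp, ENNReal.ofReal_natCast]
    exact tsum_sq_finsum_le h f
  exact ⟨L.mkContinuous _ hb, fun f x => rfl, L.mkContinuous_norm_le (by positivity) hb⟩

open Classical in
/-- The operator `f ↦ (x ↦ ∑ f(y))` on `ℓ²`, the sum being over the `y` related to `x`; it has the
junk value `0` if this is not a bounded operator. -/
def relOp (R : V → V → Prop) : lp (fun _ : V => ℂ) 2 →L[ℂ] lp (fun _ : V => ℂ) 2 :=
  if h : ∃ T : lp (fun _ : V => ℂ) 2 →L[ℂ] lp (fun _ : V => ℂ) 2,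
      ∀ f x, T f x = ∑ᶠ y ∈ {y | R x y}, f y then h.choose else 0

theorem relOp_apply {R : V → V → Prop} {a b : ℕ} (h : BddRel R a b)
    (f : lp (fun _ : V => ℂ) 2) (x : V) : relOp R f x = ∑ᶠ y ∈ {y | R x y}, f y := by
  have h' : ∃ T : lp (fun _ : V => ℂ) 2 →L[ℂ] lp (fun _ : V => ℂ) 2,
      ∀ f x, T f x = ∑ᶠ y ∈ {y | R x y}, f y := (exists_relOp h).imp fun _ => And.left
  rw [relOp, dif_pos h', h'.choose_spec]

theorem norm_relOp_le {R : V → V → Prop} {a b : ℕ} (h : BddRel R a b) :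
    ‖relOp R‖ ≤ √(a * b : ℕ) := by
  obtain ⟨T, hT, hn⟩ := exists_relOp h
  have : relOp R = T := by
    ext f x
    rw [relOp_apply h, hT]
  rwa [this]

theorem adjoint_relOp {R : V → V → Prop} {a b : ℕ} (h : BddRel R a b) :
    ContinuousLinearMap.adjoint (relOp R) = relOp fun x y => R y x := by
  classical
  ext f x
  have h1 : (ContinuousLinearMap.adjoint (relOp R) f) x
      = inner ℂ (relOp R (lp.single 2 x (1 : ℂ))) f := by
    rw [← ContinuousLinearMap.adjoint_inner_right, lp.inner_single_left]
    simp
  have h2 : ∀ z, relOp R (lp.single 2 x (1 : ℂ)) z = if R z x then 1 else 0 := by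
    intro z
    rw [relOp_apply h, finsum_mem_eq_finite_toFinset_sum _ (h.out_fin z)]
    simp [Pi.single_apply]
  rw [h1, lp.inner_eq_tsum, relOp_apply h.flip,
    finsum_mem_eq_finite_toFinset_sum _ (h.in_fin x), tsum_eq_sum (s := (h.in_fin x).toFinset)]
  · refine Finset.sum_congr rfl fun z hz => ?_
    rw [h2, if_pos (by simpa using hz)]
    simp
  · intro z hz
    rw [h2, if_neg (by simpa using hz)]
    simp

end RelOp

end

/-! ### The horospherical factors of the adjacency operators -/

section

variable {K : Type*} [Field K]

local notation "𝐜" => (HahnSeries.C : K →+* K⸨X⸩)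

/-- Being an upper triangular matrix with powers of `X` on the diagonal. -/
def IsUT (g : GL (Fin 3) K⸨X⸩) : Prop :=
  ∃ a b c : ℤ, ∃ u v w : K⸨X⸩, g = ut a b c u v w

theorem IsUT.mul {g : GL (Fin 3) K⸨X⸩} (hg : IsUT g) (a b c : ℤ) (u v w : K⸨X⸩) :
    IsUT (g * ut a b c u v w) := by
  obtain ⟨a', b', c', u', v', w', rfl⟩ := hg
  rw [ut_mul]
  exact ⟨_, _, _, _, _, _, rfl⟩

theorem exists_isUT (x : Vertex K) : ∃ g : GL (Fin 3) K⸨X⸩, IsUT g ∧ x = vertexOf g := by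
  obtain ⟨a, b, c, u, v, w, h⟩ := exists_vertexOf_ut x
  exact ⟨_, ⟨a, b, c, u, v, w, rfl⟩, h⟩

section

variable [Fintype K]

theorem setOf_stepRel_one {g : GL (Fin 3) K⸨X⸩} (hg : IsUT g) :
    {y | StepRel (1, 0) (vertexOf g) y}
      = Set.range (fun p : K × K => vertexOf (g * ut 1 0 0 (𝐜 p.1) (𝐜 p.2) 0)) := by
  obtain ⟨a, b, c, u, v, w, rfl⟩ := hg
  ext y; exact stepRel_one_iff ..

theorem setOf_stepRel_two {g : GL (Fin 3) K⸨X⸩} (hg : IsUT g) :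
    {y | StepRel (-1, 1) (vertexOf g) y}
      = Set.range (fun s : K => vertexOf (g * ut 0 1 0 0 0 (𝐜 s))) := by
  obtain ⟨a, b, c, u, v, w, rfl⟩ := hg
  ext y; exact stepRel_two_iff ..

theorem setOf_stepRel_three {g : GL (Fin 3) K⸨X⸩} (hg : IsUT g) :
    {y | StepRel (0, -1) (vertexOf g) y} = {vertexOf (g * ut 0 0 1 0 0 0)} := by
  obtain ⟨a, b, c, u, v, w, rfl⟩ := hg
  ext y; exact (stepRel_three_iff ..).trans eq_comm

theorem setOf_stepRel_one' {g : GL (Fin 3) K⸨X⸩} (hg : IsUT g) :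
    {y | StepRel (1, 0) y (vertexOf g)} = {vertexOf (g * ut 0 1 1 0 0 0)} := by
  obtain ⟨a, b, c, u, v, w, rfl⟩ := hg
  ext y; exact (stepRel_one_iff' ..).trans eq_comm

theorem setOf_stepRel_two' {g : GL (Fin 3) K⸨X⸩} (hg : IsUT g) :
    {y | StepRel (-1, 1) y (vertexOf g)}
      = Set.range (fun s : K => vertexOf (g * ut 1 0 1 (𝐜 s) 0 0)) := by
  obtain ⟨a, b, c, u, v, w, rfl⟩ := hg
  ext y; exact stepRel_two_iff' ..

theorem setOf_stepRel_three' {g : GL (Fin 3) K⸨X⸩} (hg : IsUT g) :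
    {y | StepRel (0, -1) y (vertexOf g)}
      = Set.range (fun p : K × K => vertexOf (g * ut 1 1 0 0 (𝐜 p.1) (𝐜 p.2))) := by
  obtain ⟨a, b, c, u, v, w, rfl⟩ := hg
  ext y; exact stepRel_three_iff' ..

theorem finite_ncard_range_of_injective {α β : Type*} [Fintype α] {f : α → β}
    (hf : Function.Injective f) : (Set.range f).Finite ∧ (Set.range f).ncard = Nat.card α := by
  refine ⟨Set.finite_range f, ?_⟩
  rw [← Set.image_univ, Set.ncard_image_of_injective _ hf, Set.ncard_univ]

theorem bddRel_one : BddRel (StepRel (K := K) (1, 0)) (Nat.card K ^ 2) 1 := by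
  have h : ∀ x : Vertex K, {y | StepRel (1, 0) x y}.Finite ∧
      {y | StepRel (1, 0) x y}.ncard = Nat.card K ^ 2 := by
    intro x
    obtain ⟨g, hg, rfl⟩ := exists_isUT x
    rw [setOf_stepRel_one hg]
    have := finite_ncard_range_of_injective (injective_step_one g)
    rwa [Nat.card_prod, ← sq] at this
  have h' : ∀ y : Vertex K, {x | StepRel (1, 0) x y}.Finite ∧
      {x | StepRel (1, 0) x y}.ncard = 1 := by
    intro x
    obtain ⟨g, hg, rfl⟩ := exists_isUT x
    rw [setOf_stepRel_one' hg]
    simp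
  exact ⟨fun x => (h x).1, fun x => (h x).2.le, fun y => (h' y).1, fun y => (h' y).2.le⟩

theorem bddRel_two : BddRel (StepRel (K := K) (-1, 1)) (Nat.card K) (Nat.card K) := by
  have h : ∀ x : Vertex K, {y | StepRel (-1, 1) x y}.Finite ∧
      {y | StepRel (-1, 1) x y}.ncard = Nat.card K := by
    intro x
    obtain ⟨g, hg, rfl⟩ := exists_isUT x
    rw [setOf_stepRel_two hg]
    exact finite_ncard_range_of_injective (injective_step_two g)
  have h' : ∀ y : Vertex K, {x | StepRel (-1, 1) x y}.Finite ∧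
      {x | StepRel (-1, 1) x y}.ncard = Nat.card K := by
    intro x
    obtain ⟨g, hg, rfl⟩ := exists_isUT x
    rw [setOf_stepRel_two' hg]
    exact finite_ncard_range_of_injective (injective_costep_two g)
  exact ⟨fun x => (h x).1, fun x => (h x).2.le, fun y => (h' y).1, fun y => (h' y).2.le⟩

theorem bddRel_three : BddRel (StepRel (K := K) (0, -1)) 1 (Nat.card K ^ 2) := by
  have h : ∀ y : Vertex K, {x | StepRel (0, -1) x y}.Finite ∧
      {x | StepRel (0, -1) x y}.ncard = Nat.card K ^ 2 := by
    intro x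
    obtain ⟨g, hg, rfl⟩ := exists_isUT x
    rw [setOf_stepRel_three' hg]
    have := finite_ncard_range_of_injective (injective_costep_three g)
    rwa [Nat.card_prod, ← sq] at this
  have h' : ∀ x : Vertex K, {y | StepRel (0, -1) x y}.Finite ∧
      {y | StepRel (0, -1) x y}.ncard = 1 := by
    intro x
    obtain ⟨g, hg, rfl⟩ := exists_isUT x
    rw [setOf_stepRel_three hg]
    simp
  exact ⟨fun x => (h' x).1, fun x => (h' x).2.le, fun y => (h y).1, fun y => (h y).2.le⟩

theorem setOf_coloredAdj_one (x : Vertex K) : {y | ColoredAdj 1 x y} =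
    {y | StepRel (1, 0) x y} ∪ ({y | StepRel (-1, 1) x y} ∪ {y | StepRel (0, -1) x y}) := by
  ext y; exact coloredAdj_one_iff_stepRel x y

theorem setOf_coloredAdj_one' (x : Vertex K) : {y | ColoredAdj 1 y x} =
    {y | StepRel (1, 0) y x} ∪ ({y | StepRel (-1, 1) y x} ∪ {y | StepRel (0, -1) y x}) := by
  ext y; exact coloredAdj_one_iff_stepRel y x

theorem bddRel_coloredAdj_one : BddRel (ColoredAdj (K := K) 1)
    (Nat.card K ^ 2 + (Nat.card K + 1)) (1 + (Nat.card K + Nat.card K ^ 2)) := by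
  refine ⟨fun x => ?_, fun x => ?_, fun x => ?_, fun x => ?_⟩
  · rw [setOf_coloredAdj_one]
    exact (bddRel_one.out_fin x).union ((bddRel_two.out_fin x).union (bddRel_three.out_fin x))
  · rw [setOf_coloredAdj_one]
    refine (Set.ncard_union_le _ _).trans (Nat.add_le_add (bddRel_one.out_card x) ?_)
    exact (Set.ncard_union_le _ _).trans
      (Nat.add_le_add (bddRel_two.out_card x) (bddRel_three.out_card x))
  · rw [setOf_coloredAdj_one']
    exact (bddRel_one.in_fin x).union ((bddRel_two.in_fin x).union (bddRel_three.in_fin x))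
  · rw [setOf_coloredAdj_one']
    refine (Set.ncard_union_le _ _).trans (Nat.add_le_add (bddRel_one.in_card x) ?_)
    exact (Set.ncard_union_le _ _).trans
      (Nat.add_le_add (bddRel_two.in_card x) (bddRel_three.in_card x))

theorem coloredAdj_two_eq : ColoredAdj (K := K) 2 = fun x y => ColoredAdj 1 y x := by
  ext x y; exact coloredAdj_two_iff

theorem bddRel_coloredAdj_two : BddRel (ColoredAdj (K := K) 2)
    (1 + (Nat.card K + Nat.card K ^ 2)) (Nat.card K ^ 2 + (Nat.card K + 1)) := by
  rw [coloredAdj_two_eq]; exact bddRel_coloredAdj_one.flip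

variable (K)

/-- The part of `A₁` in the first horospherical direction. -/
def U1 : L2Building K →L[ℂ] L2Building K := relOp (StepRel (1, 0))
/-- The part of `A₁` in the second horospherical direction. -/
def U2 : L2Building K →L[ℂ] L2Building K := relOp (StepRel (-1, 1))
/-- The part of `A₁` in the third horospherical direction. -/
def U3 : L2Building K →L[ℂ] L2Building K := relOp (StepRel (0, -1))
/-- The adjoint of `U1`, a part of `A₂`. -/
def V1 : L2Building K →L[ℂ] L2Building K := relOp fun x y => StepRel (1, 0) y x
/-- The adjoint of `U2`, a part of `A₂`. -/
def V2 : L2Building K →L[ℂ] L2Building K := relOp fun x y => StepRel (-1, 1) y x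
/-- The adjoint of `U3`, a part of `A₂`. -/
def V3 : L2Building K →L[ℂ] L2Building K := relOp fun x y => StepRel (0, -1) y x
/-- The colored adjacency operator `A₁` on `ℓ²` of the building. -/
def A1 : L2Building K →L[ℂ] L2Building K := relOp (ColoredAdj 1)
/-- The colored adjacency operator `A₂` on `ℓ²` of the building. -/
def A2 : L2Building K →L[ℂ] L2Building K := relOp (ColoredAdj 2)

theorem A1_apply (f : L2Building K) (x : Vertex K) : A1 K f x = coloredAdjacency 1 f x :=
  relOp_apply bddRel_coloredAdj_one f x

theorem A2_apply (f : L2Building K) (x : Vertex K) : A2 K f x = coloredAdjacency 2 f x :=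
  relOp_apply bddRel_coloredAdj_two f x

theorem adjoint_A1 : ContinuousLinearMap.adjoint (A1 K) = A2 K := by
  rw [A1, adjoint_relOp bddRel_coloredAdj_one, A2, coloredAdj_two_eq]

variable {K}

theorem U1_apply {g : GL (Fin 3) K⸨X⸩} (hg : IsUT g) (f : L2Building K) :
    U1 K f (vertexOf g) = ∑ p : K, ∑ r : K, f (vertexOf (g * ut 1 0 0 (𝐜 p) (𝐜 r) 0)) := by
  rw [U1, relOp_apply bddRel_one, setOf_stepRel_one hg, finsum_mem_range (injective_step_one g),
    finsum_eq_sum_of_fintype, Fintype.sum_prod_type]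

theorem U2_apply {g : GL (Fin 3) K⸨X⸩} (hg : IsUT g) (f : L2Building K) :
    U2 K f (vertexOf g) = ∑ s : K, f (vertexOf (g * ut 0 1 0 0 0 (𝐜 s))) := by
  rw [U2, relOp_apply bddRel_two, setOf_stepRel_two hg, finsum_mem_range (injective_step_two g),
    finsum_eq_sum_of_fintype]

theorem U3_apply {g : GL (Fin 3) K⸨X⸩} (hg : IsUT g) (f : L2Building K) :
    U3 K f (vertexOf g) = f (vertexOf (g * ut 0 0 1 0 0 0)) := by
  rw [U3, relOp_apply bddRel_three, setOf_stepRel_three hg, finsum_mem_singleton]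

theorem V1_apply {g : GL (Fin 3) K⸨X⸩} (hg : IsUT g) (f : L2Building K) :
    V1 K f (vertexOf g) = f (vertexOf (g * ut 0 1 1 0 0 0)) := by
  rw [V1, relOp_apply bddRel_one.flip, setOf_stepRel_one' hg, finsum_mem_singleton]

theorem V2_apply {g : GL (Fin 3) K⸨X⸩} (hg : IsUT g) (f : L2Building K) :
    V2 K f (vertexOf g) = ∑ s : K, f (vertexOf (g * ut 1 0 1 (𝐜 s) 0 0)) := by
  rw [V2, relOp_apply bddRel_two.flip, setOf_stepRel_two' hg,
    finsum_mem_range (injective_costep_two g), finsum_eq_sum_of_fintype]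

theorem V3_apply {g : GL (Fin 3) K⸨X⸩} (hg : IsUT g) (f : L2Building K) :
    V3 K f (vertexOf g) = ∑ p : K, ∑ r : K, f (vertexOf (g * ut 1 1 0 0 (𝐜 p) (𝐜 r))) := by
  rw [V3, relOp_apply bddRel_three.flip, setOf_stepRel_three' hg,
    finsum_mem_range (injective_costep_three g), finsum_eq_sum_of_fintype, Fintype.sum_prod_type]

theorem A1_eq : A1 K = U1 K + U2 K + U3 K := by
  ext f x
  change A1 K f x = U1 K f x + U2 K f x + U3 K f x
  have h1 := bddRel_one.out_fin x
  have h2 := bddRel_two.out_fin x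
  have h3 := bddRel_three.out_fin x
  rw [A1, U1, U2, U3, relOp_apply bddRel_coloredAdj_one, relOp_apply bddRel_one,
    relOp_apply bddRel_two, relOp_apply bddRel_three, setOf_coloredAdj_one,
    finsum_mem_union ?_ h1 (h2.union h3), finsum_mem_union ?_ h2 h3, add_assoc]
  · refine Set.disjoint_left.2 fun y hy hy' => ?_
    have := hy.2.symm.trans hy'.2
    simp at this
  · refine Set.disjoint_left.2 fun y hy hy' => ?_
    rcases hy' with hy' | hy' <;>
    · have := hy.2.symm.trans hy'.2
      simp at this

theorem A2_eq : A2 K = V1 K + V2 K + V3 K := by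
  rw [← adjoint_A1, A1_eq, map_add, map_add, U1, U2, U3, adjoint_relOp bddRel_one,
    adjoint_relOp bddRel_two, adjoint_relOp bddRel_three]
  rfl

end

end

/-! ### Relations between the horospherical factors -/

section

variable {K : Type*} [Field K]

local notation "𝐜" => (HahnSeries.C : K →+* K⸨X⸩)

/-- Triangular matrices differing by an integral unipotent column operation give the same vertex. -/
theorem vertexOf_mul_ut_congr (g : GL (Fin 3) K⸨X⸩) {a b c : ℤ} {u v w u' v' w' x y z : K⸨X⸩}
    (hx : x ∈ intRing K) (hy : y ∈ intRing K) (hz : z ∈ intRing K)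
    (hu : u' = unif K a * x + u) (hv : v' = unif K a * y + u * z + v)
    (hw : w' = unif K b * z + w) :
    vertexOf (g * ut a b c u' v' w') = vertexOf (g * ut a b c u v w) := by
  refine vertexOf_mul_ut_eq g hx hy hz ?_
  rw [ut_mul, hu, hv, hw]
  simp

theorem vertexOf_mul_ut_one (g : GL (Fin 3) K⸨X⸩) {x y z : K⸨X⸩}
    (hx : x ∈ intRing K) (hy : y ∈ intRing K) (hz : z ∈ intRing K) :
    vertexOf (g * ut 1 1 1 (unif K 1 * x) (unif K 1 * y) (unif K 1 * z)) = vertexOf g := by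
  have h := vertexOf_ut_add 0 0 0 x y z 1
  simp only [zero_add] at h
  rw [(vertexOf_mul_left_eq_iff g).2 h, vertexOf_mul_intGL g (ut_mem_intGL hx hy hz)]

section Products

variable (g : GL (Fin 3) K⸨X⸩) (u v w s a b : K)

theorem vertexOf_step_12 : vertexOf (g * ut 1 0 0 (𝐜 u) (𝐜 v) 0 * ut 0 1 0 0 0 (𝐜 w))
    = vertexOf (g * ut 1 1 0 0 (𝐜 (u * w + v)) (𝐜 w)) := by
  rw [mul_assoc, ut_mul]
  refine vertexOf_mul_ut_congr g (x := 𝐜 u) (C_mem_intRing u) (zero_mem _) (zero_mem _) ?_ ?_ ?_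
  · ring_nf
  · rw [map_add, map_mul, unif_zero]; ring
  · rw [unif_zero]; ring

theorem vertexOf_step_13 : vertexOf (g * ut 1 0 0 (𝐜 u) (𝐜 v) 0 * ut 0 0 1 0 0 0)
    = vertexOf (g * ut 1 0 1 (𝐜 u) 0 0) := by
  rw [mul_assoc, ut_mul]
  refine vertexOf_mul_ut_congr g (y := 𝐜 v) (zero_mem _) (C_mem_intRing v) (zero_mem _) ?_ ?_ ?_
  · rw [unif_zero]; ring
  · simp only [add_zero]; ring
  · rw [unif_zero]; ring

theorem vertexOf_step_23 : vertexOf (g * ut 0 1 0 0 0 (𝐜 s) * ut 0 0 1 0 0 0)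
    = vertexOf (g * ut 0 1 1 0 0 0) := by
  rw [mul_assoc, ut_mul]
  refine vertexOf_mul_ut_congr g (z := 𝐜 s) (zero_mem _) (zero_mem _) (C_mem_intRing s) ?_ ?_ ?_
  · ring_nf
  · ring_nf
  · simp only [add_zero]; ring

theorem vertexOf_step_33' : vertexOf (g * ut 1 1 0 0 (𝐜 a) (𝐜 b) * ut 0 0 1 0 0 0)
    = vertexOf g := by
  rw [mul_assoc, ut_mul, ← vertexOf_mul_ut_one g (zero_mem _) (C_mem_intRing a) (C_mem_intRing b)]
  congr 3 <;> ring1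

theorem vertexOf_step_11' : vertexOf (g * ut 1 0 0 (𝐜 a) (𝐜 b) 0 * ut 0 1 1 0 0 0)
    = vertexOf g := by
  rw [mul_assoc, ut_mul, ← vertexOf_mul_ut_one g (C_mem_intRing a) (C_mem_intRing b) (zero_mem _)]
  congr 3 <;> ring1

theorem vertexOf_mixed_12 : vertexOf (g * ut 1 0 0 (𝐜 u) (𝐜 v) 0 * ut 1 0 1 (𝐜 s) 0 0)
    = vertexOf (g * ut 2 0 1 (unif K 1 * 𝐜 s + 𝐜 u) (unif K 1 * 𝐜 v) 0) := by
  rw [mul_assoc, ut_mul]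
  congr 3 <;> first | ring1 | (simp only [unif_zero]; ring1)

theorem vertexOf_mixed_21 : vertexOf (g * ut 1 0 1 (𝐜 s) 0 0 * ut 1 0 0 (𝐜 u) (𝐜 v) 0)
    = vertexOf (g * ut 2 0 1 (unif K 1 * 𝐜 u + 𝐜 s) (unif K 1 * 𝐜 v) 0) := by
  rw [mul_assoc, ut_mul]
  congr 3 <;> first | ring1 | (simp only [unif_zero]; ring1)

theorem vertexOf_mixed_13 : vertexOf (g * ut 1 0 0 (𝐜 u) (𝐜 v) 0 * ut 1 1 0 0 (𝐜 a) (𝐜 b))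
    = vertexOf (g * ut 2 1 0 (unif K 1 * 𝐜 u) (unif K 1 * 𝐜 a + 𝐜 (u * b + v)) (𝐜 b)) := by
  rw [mul_assoc, ut_mul, map_add, map_mul]
  congr 3 <;> first | ring1 | (simp only [unif_zero]; ring1)

theorem vertexOf_mixed_31 : vertexOf (g * ut 1 1 0 0 (𝐜 a) (𝐜 b) * ut 1 0 0 (𝐜 u) (𝐜 v) 0)
    = vertexOf (g * ut 2 1 0 (unif K 1 * 𝐜 u) (unif K 1 * 𝐜 v + 𝐜 a) (𝐜 b)) := by
  rw [mul_assoc, ut_mul]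
  congr 3 <;> first | ring1 | (simp only [unif_zero]; ring1)

theorem vertexOf_mixed_23 : vertexOf (g * ut 0 1 0 0 0 (𝐜 s) * ut 1 1 0 0 (𝐜 a) (𝐜 b))
    = vertexOf (g * ut 1 2 0 0 (𝐜 a) (unif K 1 * 𝐜 b + 𝐜 s)) := by
  rw [mul_assoc, ut_mul]
  congr 3 <;> first | ring1 | (simp only [unif_zero]; ring1)

theorem vertexOf_mixed_32 : vertexOf (g * ut 1 1 0 0 (𝐜 a) (𝐜 b) * ut 0 1 0 0 0 (𝐜 s))
    = vertexOf (g * ut 1 2 0 0 (𝐜 a) (unif K 1 * 𝐜 s + 𝐜 b)) := by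
  rw [mul_assoc, ut_mul]
  congr 3 <;> first | ring1 | (simp only [unif_zero]; ring1)

theorem vertexOf_mixed_2 : vertexOf (g * ut 0 1 0 0 0 (𝐜 s) * ut 0 1 1 0 0 0)
    = vertexOf (g * ut 0 1 1 0 0 0 * ut 0 1 0 0 0 (𝐜 s)) := by
  rw [mul_assoc, ut_mul, mul_assoc, ut_mul]
  congr 3 <;> ring1

theorem vertexOf_mixed_3 : vertexOf (g * ut 0 0 1 0 0 0 * ut 1 0 1 (𝐜 s) 0 0)
    = vertexOf (g * ut 1 0 1 (𝐜 s) 0 0 * ut 0 0 1 0 0 0) := by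
  rw [mul_assoc, ut_mul, mul_assoc, ut_mul]
  congr 3 <;> ring1

theorem vertexOf_mixed_0 : vertexOf (g * ut 0 0 1 0 0 0 * ut 0 1 1 0 0 0)
    = vertexOf (g * ut 0 1 1 0 0 0 * ut 0 0 1 0 0 0) := by
  rw [mul_assoc, ut_mul, mul_assoc, ut_mul]
  congr 3 <;> simp

theorem vertexOf_level_1' : vertexOf (g * ut 0 1 1 0 0 0 * ut 1 0 0 (𝐜 u) (𝐜 v) 0)
    = vertexOf (g * ut 1 1 1 (𝐜 u) (𝐜 v) (𝐜 0)) := by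
  rw [mul_assoc, ut_mul]
  congr 3 <;> simp only [unif_zero, map_zero] <;> ring

theorem vertexOf_level_2 : vertexOf (g * ut 0 1 0 0 0 (𝐜 s) * ut 1 0 1 (𝐜 u) 0 0)
    = vertexOf (g * ut 1 1 1 (𝐜 u) (𝐜 (-(u * s))) (𝐜 0)) := by
  rw [mul_assoc, ut_mul]
  refine vertexOf_mul_ut_congr g (z := 𝐜 s) (zero_mem _) (zero_mem _) (C_mem_intRing s) ?_ ?_ ?_
  · rw [unif_zero]; ring
  · rw [map_neg, map_mul]; ring
  · rw [map_zero]; simp only [add_zero]; ring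

theorem vertexOf_level_2' : vertexOf (g * ut 1 0 1 (𝐜 u) 0 0 * ut 0 1 0 0 0 (𝐜 s))
    = vertexOf (g * ut 1 1 1 (𝐜 0) (𝐜 (u * s)) (𝐜 s)) := by
  rw [mul_assoc, ut_mul]
  refine vertexOf_mul_ut_congr g (x := 𝐜 u) (C_mem_intRing u) (zero_mem _) (zero_mem _) ?_ ?_ ?_
  · rw [map_zero]; simp only [add_zero]; ring
  · rw [map_mul, unif_zero]; ring
  · rw [unif_zero]; ring

theorem vertexOf_level_3 : vertexOf (g * ut 0 0 1 0 0 0 * ut 1 1 0 0 (𝐜 a) (𝐜 b))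
    = vertexOf (g * ut 1 1 1 (𝐜 0) (𝐜 a) (𝐜 b)) := by
  rw [mul_assoc, ut_mul]
  congr 3 <;> simp only [unif_zero, map_zero] <;> ring

end Products

section Sums

variable [Fintype K]

theorem sum_shear (F : K → K → ℂ) :
    ∑ u, ∑ v, ∑ w, F (u * w + v) w = Nat.card K * ∑ v, ∑ w, F v w := by
  have h : ∀ u : K, ∑ v, ∑ w, F (u * w + v) w = ∑ v, ∑ w, F v w := by
    intro u
    calc _ = ∑ w, ∑ v, F (u * w + v) w := Finset.sum_comm
      _ = ∑ w, ∑ v, F v w := Finset.sum_congr rfl fun w _ =>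
          Fintype.sum_equiv (Equiv.addLeft (u * w)) _ _ fun v => rfl
      _ = _ := Finset.sum_comm
  simp only [h, Finset.sum_const, nsmul_eq_mul, Finset.card_univ, Nat.card_eq_fintype_card]

theorem sum_shear_four (F : K → K → K → K → ℂ) :
    ∑ u, ∑ v, ∑ a, ∑ b, F u a (u * b + v) b = ∑ p, ∑ r, ∑ u, ∑ v, F u v p r := by
  calc _ = ∑ u, ∑ a, ∑ b, ∑ v, F u a (u * b + v) b := by
        refine Finset.sum_congr rfl fun u _ => ?_
        rw [Finset.sum_comm]
        exact Finset.sum_congr rfl fun a _ => Finset.sum_comm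
    _ = ∑ u, ∑ a, ∑ b, ∑ v, F u a v b := by
        refine Finset.sum_congr rfl fun u _ => Finset.sum_congr rfl fun a _ =>
          Finset.sum_congr rfl fun b _ => ?_
        exact Fintype.sum_equiv (Equiv.addLeft (u * b)) _ _ fun v => rfl
    _ = ∑ u, ∑ v, ∑ p, ∑ r, F u v p r :=
        Finset.sum_congr rfl fun u _ => Finset.sum_congr rfl fun a _ => Finset.sum_comm
    _ = ∑ u, ∑ p, ∑ v, ∑ r, F u v p r := Finset.sum_congr rfl fun u _ => Finset.sum_comm
    _ = ∑ p, ∑ u, ∑ v, ∑ r, F u v p r := Finset.sum_comm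
    _ = ∑ p, ∑ u, ∑ r, ∑ v, F u v p r := Finset.sum_congr rfl fun p _ =>
        Finset.sum_congr rfl fun u _ => Finset.sum_comm
    _ = _ := Finset.sum_congr rfl fun p _ => Finset.sum_comm

theorem sum_mul_right_eq {c : K} (hc : c ≠ 0) (F : K → ℂ) : ∑ s, F (c * s) = ∑ v, F v :=
  Fintype.sum_equiv (Equiv.mulLeft₀ c hc) _ _ fun _ => rfl

/-- The combinatorial identity behind the commutation of `A₁` and `A₂`. For `u ≠ 0`, the product
`-(u s)` runs over `K` as `s` does; the terms with `u = 0` on one side and `s = 0` on the other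
contribute the same excess. -/
theorem sum_level (H : K → K → K → ℂ) :
    ∑ s, ∑ u, H u (-(u * s)) 0 + ∑ a, ∑ b, H 0 a b = ∑ u, ∑ v, H u v 0 + ∑ u, ∑ s, H 0 (u * s) s := by
  classical
  have h1 : ∑ s, ∑ u, H u (-(u * s)) 0
      = ∑ u, ∑ v, H u v 0 + (Nat.card K * H 0 0 0 - ∑ v, H 0 v 0) := by
    rw [Finset.sum_comm, ← Finset.add_sum_erase _ (fun u => ∑ s, H u (-(u * s)) 0) (Finset.mem_univ (0 : K)),
      ← Finset.add_sum_erase _ (fun u => ∑ v, H u v 0) (Finset.mem_univ (0 : K))]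
    have : ∀ u ∈ Finset.univ.erase (0 : K), ∑ s, H u (-(u * s)) 0 = ∑ v, H u v 0 := by
      intro u hu
      have hu0 : -u ≠ 0 := neg_ne_zero.2 (Finset.ne_of_mem_erase hu)
      simpa using sum_mul_right_eq hu0 (fun v => H u v 0)
    rw [Finset.sum_congr rfl this]
    simp only [zero_mul, neg_zero, Finset.sum_const, nsmul_eq_mul, Finset.card_univ,
      Nat.card_eq_fintype_card]
    ring
  have h2 : ∑ u, ∑ s, H 0 (u * s) s
      = ∑ a, ∑ b, H 0 a b + (Nat.card K * H 0 0 0 - ∑ v, H 0 v 0) := by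
    rw [Finset.sum_comm, Finset.sum_comm (f := fun a b => H 0 a b),
      ← Finset.add_sum_erase _ (fun s => ∑ u, H 0 (u * s) s) (Finset.mem_univ (0 : K)),
      ← Finset.add_sum_erase _ (fun s => ∑ a, H 0 a s) (Finset.mem_univ (0 : K))]
    have : ∀ s ∈ Finset.univ.erase (0 : K), ∑ u, H 0 (u * s) s = ∑ v, H 0 v s := by
      intro s hs
      simpa [mul_comm] using sum_mul_right_eq (Finset.ne_of_mem_erase hs) (fun v => H 0 v s)
    rw [Finset.sum_congr rfl this]
    simp only [mul_zero, Finset.sum_const, nsmul_eq_mul, Finset.card_univ,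
      Nat.card_eq_fintype_card]
    ring
  rw [h1, h2]; ring

theorem sum_const_K (z : ℂ) : ∑ _u : K, z = Nat.card K * z := by
  simp [Nat.card_eq_fintype_card]

theorem U1_mul_U2 : U1 K * U2 K = (Nat.card K : ℂ) • V3 K := by
  ext f x
  obtain ⟨g, hg, rfl⟩ := exists_isUT x
  change U1 K (U2 K f) _ = (Nat.card K : ℂ) * V3 K f _
  simp only [U1_apply hg, V3_apply hg, U2_apply (hg.mul ..), vertexOf_step_12]
  exact sum_shear fun v w => f (vertexOf (g * ut 1 1 0 0 (𝐜 v) (𝐜 w)))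

theorem U1_mul_U3 : U1 K * U3 K = (Nat.card K : ℂ) • V2 K := by
  ext f x
  obtain ⟨g, hg, rfl⟩ := exists_isUT x
  change U1 K (U3 K f) _ = (Nat.card K : ℂ) * V2 K f _
  simp only [U1_apply hg, V2_apply hg, U3_apply (hg.mul ..), vertexOf_step_13, sum_const_K,
    Finset.mul_sum]

theorem U2_mul_U3 : U2 K * U3 K = (Nat.card K : ℂ) • V1 K := by
  ext f x
  obtain ⟨g, hg, rfl⟩ := exists_isUT x
  change U2 K (U3 K f) _ = (Nat.card K : ℂ) * V1 K f _
  simp only [U2_apply hg, V1_apply hg, U3_apply (hg.mul ..), vertexOf_step_23, sum_const_K]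

theorem V3_mul_U3 :
    V3 K * U3 K = ((Nat.card K : ℂ) ^ 2) • (1 : L2Building K →L[ℂ] L2Building K) := by
  ext f x
  obtain ⟨g, hg, rfl⟩ := exists_isUT x
  change V3 K (U3 K f) _ = (Nat.card K : ℂ) ^ 2 * f _
  simp only [V3_apply hg, U3_apply (hg.mul ..), vertexOf_step_33', sum_const_K]
  ring

theorem U1_mul_V1 :
    U1 K * V1 K = ((Nat.card K : ℂ) ^ 2) • (1 : L2Building K →L[ℂ] L2Building K) := by
  ext f x
  obtain ⟨g, hg, rfl⟩ := exists_isUT x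
  change U1 K (V1 K f) _ = (Nat.card K : ℂ) ^ 2 * f _
  simp only [U1_apply hg, V1_apply (hg.mul ..), vertexOf_step_11', sum_const_K]
  ring

theorem U1_mul_V2 : U1 K * V2 K = V2 K * U1 K := by
  ext f x
  obtain ⟨g, hg, rfl⟩ := exists_isUT x
  change U1 K (V2 K f) _ = V2 K (U1 K f) _
  simp only [U1_apply hg, V2_apply hg, U1_apply (hg.mul ..), V2_apply (hg.mul ..),
    vertexOf_mixed_12, vertexOf_mixed_21]
  exact Finset.sum_congr rfl fun p _ => Finset.sum_comm

theorem U1_mul_V3 : U1 K * V3 K = V3 K * U1 K := by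
  ext f x
  obtain ⟨g, hg, rfl⟩ := exists_isUT x
  change U1 K (V3 K f) _ = V3 K (U1 K f) _
  simp only [U1_apply hg, V3_apply hg, U1_apply (hg.mul ..), V3_apply (hg.mul ..),
    vertexOf_mixed_13, vertexOf_mixed_31]
  exact sum_shear_four fun u a y b =>
    f (vertexOf (g * ut 2 1 0 (unif K 1 * 𝐜 u) (unif K 1 * 𝐜 a + 𝐜 y) (𝐜 b)))

theorem U2_mul_V3 : U2 K * V3 K = V3 K * U2 K := by
  ext f x
  obtain ⟨g, hg, rfl⟩ := exists_isUT x
  change U2 K (V3 K f) _ = V3 K (U2 K f) _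
  simp only [U2_apply hg, V3_apply hg, U2_apply (hg.mul ..), V3_apply (hg.mul ..),
    vertexOf_mixed_23, vertexOf_mixed_32]
  exact Finset.sum_comm

theorem U2_mul_V1 : U2 K * V1 K = V1 K * U2 K := by
  ext f x
  obtain ⟨g, hg, rfl⟩ := exists_isUT x
  change U2 K (V1 K f) _ = V1 K (U2 K f) _
  simp only [U2_apply hg, V1_apply hg, U2_apply (hg.mul ..), V1_apply (hg.mul ..),
    vertexOf_mixed_2]

theorem U3_mul_V2 : U3 K * V2 K = V2 K * U3 K := by
  ext f x
  obtain ⟨g, hg, rfl⟩ := exists_isUT x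
  change U3 K (V2 K f) _ = V2 K (U3 K f) _
  simp only [U3_apply hg, V2_apply hg, U3_apply (hg.mul ..), V2_apply (hg.mul ..),
    vertexOf_mixed_3]

theorem U3_mul_V1 : U3 K * V1 K = V1 K * U3 K := by
  ext f x
  obtain ⟨g, hg, rfl⟩ := exists_isUT x
  change U3 K (V1 K f) _ = V1 K (U3 K f) _
  simp only [U3_apply hg, V1_apply hg, U3_apply (hg.mul ..), V1_apply (hg.mul ..),
    vertexOf_mixed_0]

/-- The only mixed products that do not commute one by one: those returning to the type of the
initial vertex. -/
theorem U_mul_V_level : U2 K * V2 K + U3 K * V3 K = V1 K * U1 K + V2 K * U2 K := by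
  ext f x
  obtain ⟨g, hg, rfl⟩ := exists_isUT x
  change U2 K (V2 K f) _ + U3 K (V3 K f) _ = V1 K (U1 K f) _ + V2 K (U2 K f) _
  simp only [V1_apply hg, U2_apply hg, V2_apply hg, U3_apply hg, U1_apply (hg.mul ..),
    U2_apply (hg.mul ..), V2_apply (hg.mul ..), V3_apply (hg.mul ..), vertexOf_level_1',
    vertexOf_level_2, vertexOf_level_2', vertexOf_level_3]
  exact sum_level fun u v w => f (vertexOf (g * ut 1 1 1 (𝐜 u) (𝐜 v) (𝐜 w)))

/-- `A₁` is normal, with adjoint `A₂`. -/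
theorem A1_mul_A2 : A1 K * A2 K = A2 K * A1 K := by
  have h := U_mul_V_level (K := K)
  have h' : U1 K * V1 K = V3 K * U3 K := U1_mul_V1.trans V3_mul_U3.symm
  rw [A1_eq, A2_eq]
  simp only [add_mul, mul_add, U1_mul_V2, U1_mul_V3, U2_mul_V3, U2_mul_V1, U3_mul_V2, U3_mul_V1, h']
  rw [← sub_eq_zero] at h ⊢
  rw [← h]
  abel

theorem isStarNormal_A1 : IsStarNormal (A1 K) := by
  refine ⟨?_⟩
  rw [ContinuousLinearMap.star_eq_adjoint, adjoint_A1]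
  exact A1_mul_A2.symm

/-- The generating polynomial of the Hecke operators splits into horospherical factors. -/
theorem hecke_factorization (Y : ℂ) :
    (1 - Y • U1 K) * (1 - Y • U2 K) * (1 - Y • U3 K)
      = 1 - Y • A1 K + (Nat.card K * Y ^ 2) • A2 K
        - ((Nat.card K : ℂ) ^ 3 * Y ^ 3) • (1 : L2Building K →L[ℂ] L2Building K) := by
  have h123 : U1 K * U2 K * U3 K
      = ((Nat.card K : ℂ) ^ 3) • (1 : L2Building K →L[ℂ] L2Building K) := by
    rw [U1_mul_U2, smul_mul_assoc, V3_mul_U3, smul_smul]; congr 1; ring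
  have e : (1 - Y • U1 K) * (1 - Y • U2 K) * (1 - Y • U3 K)
      = 1 - Y • (U1 K + U2 K + U3 K) + Y ^ 2 • (U1 K * U2 K + U1 K * U3 K + U2 K * U3 K)
        - Y ^ 3 • (U1 K * U2 K * U3 K) := by
    simp only [sub_mul, mul_sub, one_mul, mul_one, smul_mul_assoc, mul_smul_comm, smul_smul,
      smul_add, smul_sub]
    module
  rw [e, h123, U1_mul_U2, U1_mul_U3, U2_mul_U3, A1_eq, A2_eq]
  module

end Sums

end

/-! ### The spectrum of `A₁` is contained in the deltoid -/

section

variable {K : Type*} [Field K]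

/-- If the self-reciprocal cubic `X³ - μ X² + μ̄ X - 1` has no root outside the closed unit disc,
its roots have modulus one, since their product is one. -/
theorem exists_unitTriple_of_roots {μ : ℂ}
    (h : ∀ x : ℂ, x ^ 3 - μ * x ^ 2 + (starRingEnd ℂ) μ * x - 1 = 0 → ‖x‖ ≤ 1) :
    ∃ s ∈ unitTriples, μ = s.1 + s.2.1 + s.2.2 := by
  let P : Cubic ℂ := ⟨1, -μ, (starRingEnd ℂ) μ, -1⟩
  have ha : P.a ≠ 0 := one_ne_zero
  obtain ⟨x, y, z, hr⟩ := (Cubic.splits_iff_roots_eq_three (φ := RingHom.id ℂ) ha).1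
    (IsAlgClosed.splits _)
  have hb : -μ = 1 * -(x + y + z) := Cubic.b_eq_three_roots (φ := RingHom.id ℂ) ha hr
  have hd : (-1 : ℂ) = 1 * -(x * y * z) := Cubic.d_eq_three_roots (φ := RingHom.id ℂ) ha hr
  have hroot : ∀ w ∈ ({x, y, z} : Multiset ℂ), ‖w‖ ≤ 1 := by
    intro w hw
    rw [← hr] at hw
    have := (Cubic.mem_roots_iff (P := Cubic.map (RingHom.id ℂ) P)
      (Cubic.ne_zero_of_a_ne_zero one_ne_zero) w).1 hw
    refine h w ?_
    have e : (1 : ℂ) * w ^ 3 + (-μ) * w ^ 2 + (starRingEnd ℂ) μ * w + (-1) = 0 := this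
    linear_combination e
  have hx : ‖x‖ ≤ 1 := hroot x (by simp)
  have hy : ‖y‖ ≤ 1 := hroot y (by simp)
  have hz : ‖z‖ ≤ 1 := hroot z (by simp)
  have hxyz : x * y * z = 1 := by linear_combination hd
  have hn : ‖x‖ * ‖y‖ * ‖z‖ = 1 := by rw [← norm_mul, ← norm_mul, hxyz, norm_one]
  have hxy : ‖x‖ * ‖y‖ ≤ 1 := mul_le_one₀ hx (norm_nonneg y) hy
  have hz1 : ‖z‖ = 1 := by nlinarith [norm_nonneg z]
  have hxy1 : ‖x‖ * ‖y‖ = 1 := by rw [hz1, mul_one] at hn; exact hn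
  have hx1 : ‖x‖ = 1 := by nlinarith [norm_nonneg x]
  have hy1 : ‖y‖ = 1 := by rw [hx1, one_mul] at hxy1; exact hxy1
  exact ⟨(x, y, z), ⟨hx1, hy1, hz1, hxyz⟩, by linear_combination -hb⟩

/-- A point of `ℂ²` is of the form `q (σ₁(s), σ₂(s))` iff it is `(z, z̄)` with `z = q σ₁(s)`,
because `s₁ s₂ = s̄₃`. -/
theorem mem_Sigma2Pairs_iff {q : ℝ} {l : ℂ × ℂ} :
    l ∈ Sigma2Pairs q ↔ l.1 ∈ Sigma2 q ∧ l.2 = (starRingEnd ℂ) l.1 := by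
  have key : ∀ s ∈ unitTriples, (q : ℂ) * (s.1 * s.2.1 + s.1 * s.2.2 + s.2.1 * s.2.2)
      = (starRingEnd ℂ) ((q : ℂ) * (s.1 + s.2.1 + s.2.2)) := by
    rintro ⟨x, y, z⟩ ⟨hx, hy, hz, h⟩
    dsimp only at hx hy hz h ⊢
    have hx' : (starRingEnd ℂ) x * x = 1 := by rw [Complex.conj_mul', hx]; simp
    have hy' : (starRingEnd ℂ) y * y = 1 := by rw [Complex.conj_mul', hy]; simp
    have hz' : (starRingEnd ℂ) z * z = 1 := by rw [Complex.conj_mul', hz]; simp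
    simp only [map_mul, map_add, Complex.conj_ofReal]
    linear_combination (q : ℂ) * ((starRingEnd ℂ) x + (starRingEnd ℂ) y + (starRingEnd ℂ) z) * h
      - (q : ℂ) * (y * z * hx' + x * z * hy' + x * y * hz')
  constructor
  · rintro ⟨s, hs, rfl⟩
    exact ⟨⟨s, hs, rfl⟩, key s hs⟩
  · rintro ⟨⟨s, hs, h1⟩, h2⟩
    refine ⟨s, hs, Prod.ext h1 ?_⟩
    rw [h2, ← h1]
    exact key s hs

section Upper

variable [Fintype K]

theorem norm_U_le : ‖U1 K‖ ≤ Nat.card K ∧ ‖U2 K‖ ≤ Nat.card K ∧ ‖U3 K‖ ≤ Nat.card K := by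
  have h0 : (0 : ℝ) ≤ Nat.card K := Nat.cast_nonneg _
  refine ⟨(norm_relOp_le bddRel_one).trans_eq ?_, (norm_relOp_le bddRel_two).trans_eq ?_,
    (norm_relOp_le bddRel_three).trans_eq ?_⟩ <;>
  · push_cast
    rw [Real.sqrt_eq_iff_mul_self_eq (by positivity) h0]
    all_goals ring

theorem isUnit_one_sub_smul {E : Type*} [NormedAddCommGroup E] [NormedSpace ℂ E] [CompleteSpace E]
    {a : E →L[ℂ] E} {r : ℝ} (ha : ‖a‖ ≤ r) {Y : ℂ} (hY : ‖Y‖ * r < 1) : IsUnit (1 - Y • a) := by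
  refine isUnit_one_sub_of_norm_lt_one (lt_of_le_of_lt ?_ hY)
  have h : ‖Y • a‖ ≤ ‖Y‖ * ‖a‖ := (norm_smul Y a).le
  exact h.trans (mul_le_mul_of_nonneg_left ha (norm_nonneg _))

theorem isUnit_hecke {Y : ℂ} (hY : ‖Y‖ * Nat.card K < 1) :
    IsUnit (1 - Y • A1 K + (Nat.card K * Y ^ 2) • A2 K
        - ((Nat.card K : ℂ) ^ 3 * Y ^ 3) • (1 : L2Building K →L[ℂ] L2Building K)) := by
  rw [← hecke_factorization]
  exact ((isUnit_one_sub_smul norm_U_le.1 hY).mul (isUnit_one_sub_smul norm_U_le.2.1 hY)).mul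
    (isUnit_one_sub_smul norm_U_le.2.2 hY)

theorem star_A1 : star (A1 K) = A2 K := by
  rw [ContinuousLinearMap.star_eq_adjoint, adjoint_A1]

/-- The functional calculus turns invertibility of a polynomial in `A₁` and `A₁*` into
nonvanishing of the polynomial on the spectrum. -/
theorem hecke_ne_zero {lam : ℂ} (hl : lam ∈ spectrum ℂ (A1 K)) {Y : ℂ}
    (hY : ‖Y‖ * Nat.card K < 1) :
    1 - Y * lam + Nat.card K * Y ^ 2 * (starRingEnd ℂ) lam - (Nat.card K : ℂ) ^ 3 * Y ^ 3 ≠ 0 := by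
  have hn : IsStarNormal (A1 K) := isStarNormal_A1
  set f : ℂ → ℂ := fun z => 1 - Y * z + Nat.card K * Y ^ 2 * star z
    - (Nat.card K : ℂ) ^ 3 * Y ^ 3 with hf
  have hcf : cfc f (A1 K) = 1 - Y • A1 K + (Nat.card K * Y ^ 2) • A2 K
        - ((Nat.card K : ℂ) ^ 3 * Y ^ 3) • (1 : L2Building K →L[ℂ] L2Building K) := by
    rw [hf, cfc_sub .., cfc_add .., cfc_sub .., cfc_const_one .., cfc_const_mul .., cfc_id' ..,
      cfc_const_mul .., cfc_star_id .., cfc_const .., star_A1, Algebra.algebraMap_eq_smul_one]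
  have hmem : f lam ∈ spectrum ℂ (cfc f (A1 K)) := by
    rw [cfc_map_spectrum f (A1 K)]
    exact ⟨lam, hl, rfl⟩
  intro h0
  have hfl : f lam = 0 := h0
  rw [hfl, hcf] at hmem
  exact spectrum.zero_notMem ℂ (isUnit_hecke hY) hmem

/-- A root `x` of the cubic outside of the unit disc would contradict `hecke_ne_zero` at
`Y = (q x)⁻¹`. -/
theorem spectrum_A1_subset : spectrum ℂ (A1 K) ⊆ Sigma2 (Nat.card K) := by
  intro lam hl
  have hq : (Nat.card K : ℂ) ≠ 0 := by simp [Nat.card_eq_fintype_card]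
  have hq0 : (0 : ℝ) < Nat.card K := by
    rw [Nat.card_eq_fintype_card]; exact_mod_cast Fintype.card_pos
  obtain ⟨s, hs, h⟩ := exists_unitTriple_of_roots (μ := lam / Nat.card K) (fun x hx => by
    by_contra! hx1
    have hx0 : x ≠ 0 := by
      rintro rfl
      norm_num at hx1
    refine hecke_ne_zero hl (Y := (Nat.card K * x)⁻¹) ?_ ?_
    · rw [norm_inv, norm_mul, Complex.norm_natCast, _root_.mul_inv_rev, mul_assoc,
        inv_mul_cancel₀ hq0.ne', mul_one]
      exact inv_lt_one_of_one_lt₀ hx1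
    · rw [map_div₀, map_natCast] at hx
      field_simp at hx ⊢
      linear_combination hx)
  exact ⟨s, hs, by dsimp only; rw [← h]; push_cast; field_simp⟩

end Upper

/-! ### Approximate eigenvectors -/

/-- Approximate eigenvalues lie in the spectrum. -/
theorem mem_spectrum_of_approx {E : Type*} [NormedAddCommGroup E] [NormedSpace ℂ E]
    {A : E →L[ℂ] E} {l : ℂ} (h : ∀ ε > 0, ∃ f : E, f ≠ 0 ∧ ‖A f - l • f‖ ≤ ε * ‖f‖) :
    l ∈ spectrum ℂ A := by
  rw [spectrum.mem_iff]
  rintro ⟨u, hu⟩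
  set B : E →L[ℂ] E := ↑u⁻¹ with hB
  obtain ⟨f, hf0, hf⟩ := h (1 / (‖B‖ + 1)) (by positivity)
  have h1 : B (l • f - A f) = f := by
    have : B * (algebraMap ℂ (E →L[ℂ] E) l - A) = 1 := by rw [← hu, hB, Units.inv_mul]
    simpa [Algebra.algebraMap_eq_smul_one] using DFunLike.congr_fun this f
  have h2 : ‖f‖ ≤ ‖B‖ * (1 / (‖B‖ + 1) * ‖f‖) := by
    calc ‖f‖ = ‖B (l • f - A f)‖ := by rw [h1]
      _ ≤ ‖B‖ * ‖l • f - A f‖ := B.le_opNorm _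
      _ ≤ _ := by rw [norm_sub_rev]; gcongr
  have h3 : 0 < ‖f‖ := norm_pos_iff.2 hf0
  have h4 : ‖B‖ * (1 / (‖B‖ + 1) * ‖f‖) = ‖B‖ / (‖B‖ + 1) * ‖f‖ := by ring
  rw [h4] at h2
  have h5 : ‖B‖ / (‖B‖ + 1) < 1 := by
    rw [div_lt_one (by positivity)]; linarith
  nlinarith

/-- The simultaneous spectrum of a normal operator and its adjoint. -/
theorem simultaneousSpectrum_adjoint {E : Type*} [NormedAddCommGroup E] [InnerProductSpace ℂ E]
    [CompleteSpace E] {A : E →L[ℂ] E} (hA : IsStarNormal A) {S : Set ℂ}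
    (h1 : spectrum ℂ A ⊆ S)
    (h2 : ∀ l ∈ S, ∀ ε > 0, ∃ f : E, f ≠ 0 ∧ ‖A f - l • f‖ ≤ ε * ‖f‖) :
    simultaneousSpectrum A (ContinuousLinearMap.adjoint A)
      = {l | l.1 ∈ S ∧ l.2 = (starRingEnd ℂ) l.1} := by
  have hnorm : ∀ (l : ℂ) (f : E), ‖ContinuousLinearMap.adjoint A f - (starRingEnd ℂ) l • f‖
      = ‖A f - l • f‖ := by
    intro l f
    have hN : IsStarNormal (A - algebraMap ℂ (E →L[ℂ] E) l) := by
      refine ⟨?_⟩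
      have hc : Commute (star A) A := hA.star_comm_self
      rw [star_sub, ← algebraMap_star_comm]
      exact (hc.sub_left (Algebra.commutes _ _)).sub_right
        ((Algebra.commutes _ _ : Commute _ _).symm)
    have := (ContinuousLinearMap.isStarNormal_iff_norm_eq_adjoint.1 hN) f
    rw [map_sub] at this
    have h' : ContinuousLinearMap.adjoint (algebraMap ℂ (E →L[ℂ] E) l)
        = algebraMap ℂ (E →L[ℂ] E) ((starRingEnd ℂ) l) := by
      rw [← ContinuousLinearMap.star_eq_adjoint, ← algebraMap_star_comm]; rfl
    rw [h'] at this
    simpa [Algebra.algebraMap_eq_smul_one] using this.symm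
  ext ⟨l, m⟩
  constructor
  · rintro ⟨f, hf1, hf, hf'⟩
    dsimp only at hf hf'
    have hl : l ∈ spectrum ℂ A := by
      refine mem_spectrum_of_approx fun ε hε => ?_
      obtain ⟨n, hn⟩ := (hf.eventually (gt_mem_nhds hε)).exists
      refine ⟨f n, ?_, by rw [hf1, mul_one]; exact hn.le⟩
      rw [← norm_pos_iff, hf1]; exact one_pos
    refine ⟨h1 hl, ?_⟩
    have h0 : Tendsto (fun n => ‖ContinuousLinearMap.adjoint A (f n)
        - (starRingEnd ℂ) l • f n‖) atTop (𝓝 0) := by simpa only [hnorm] using hf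
    have hsum := h0.add hf'
    rw [add_zero] at hsum
    have hle : ‖m - (starRingEnd ℂ) l‖ ≤ 0 := by
      refine ge_of_tendsto' hsum fun n => ?_
      calc ‖m - (starRingEnd ℂ) l‖ = ‖(m - (starRingEnd ℂ) l) • f n‖ := by
            rw [norm_smul, hf1, mul_one]
        _ = ‖(ContinuousLinearMap.adjoint A (f n) - (starRingEnd ℂ) l • f n)
            - (ContinuousLinearMap.adjoint A (f n) - m • f n)‖ := by
            congr 1; rw [sub_smul]; abel
        _ ≤ _ := norm_sub_le _ _
    exact sub_eq_zero.1 (norm_le_zero_iff.1 hle)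
  · rintro ⟨hl, hm⟩
    dsimp only at hl hm
    subst hm
    choose f hf0 hf using fun n : ℕ => h2 l hl (1 / (n + 1)) (by positivity)
    have hpos : ∀ n, 0 < ‖f n‖ := fun n => norm_pos_iff.2 (hf0 n)
    set e : ℕ → E := fun n => ((‖f n‖⁻¹ : ℝ) : ℂ) • f n with he
    have hcoef : ∀ n, ‖((‖f n‖⁻¹ : ℝ) : ℂ)‖ = ‖f n‖⁻¹ := fun n => by
      rw [Complex.norm_real, norm_inv, norm_norm]
    have hlim : Tendsto (fun n => ‖A (e n) - l • e n‖) atTop (𝓝 0) := by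
      refine squeeze_zero (fun _ => norm_nonneg _) (fun n => ?_)
        tendsto_one_div_add_atTop_nhds_zero_nat
      have : A (e n) - l • e n = ((‖f n‖⁻¹ : ℝ) : ℂ) • (A (f n) - l • f n) := by
        simp only [he, map_smul, smul_sub, smul_comm l]
      rw [this, norm_smul, hcoef]
      calc ‖f n‖⁻¹ * ‖A (f n) - l • f n‖ ≤ ‖f n‖⁻¹ * (1 / (n + 1) * ‖f n‖) := by
            gcongr; exact hf n
        _ = 1 / (n + 1) := by
            have := (hpos n).ne'
            field_simp
    refine ⟨e, fun n => ?_, hlim, by simpa only [hnorm] using hlim⟩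
    rw [he, norm_smul, hcoef, inv_mul_cancel₀ (hpos n).ne']

end

/-! ### Approximate eigenvectors on the lattice `ℤ²` -/

section

/-- The operator `c ↦ q² c(p + δ e₁) + q c(p + δ e₂) + c(p + δ e₃)` on functions on `ℤ²`, where
`e₁ = (1, 0)`, `e₂ = (-1, 1)`, `e₃ = (0, -1)`. -/
def latticeOp (q : ℝ) (δ : ℤ) (c : ℤ × ℤ → ℂ) (p : ℤ × ℤ) : ℂ :=
  (q : ℂ) ^ 2 * c (p.1 + δ, p.2) + q * c (p.1 - δ, p.2 + δ) + c (p.1, p.2 - δ)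

/-- The joint eigenfunction `q^{-δ(i+j)} s₁^{δi} (s₁ s₂)^{δj}` of the shifts. -/
def latticeChar (q : ℝ) (s : ℂ × ℂ × ℂ) (δ : ℤ) (p : ℤ × ℤ) : ℂ :=
  (q : ℂ) ^ (-(δ * (p.1 + p.2))) * s.1 ^ (δ * p.1) * (s.1 * s.2.1) ^ (δ * p.2)

theorem latticeChar_shift {q : ℝ} (hq : 0 < q) {s : ℂ × ℂ × ℂ} (hs : s ∈ unitTriples)
    {δ : ℤ} (hδ : δ * δ = 1) (p : ℤ × ℤ) :
    (q : ℂ) ^ 2 * latticeChar q s δ (p.1 + δ, p.2) = q * s.1 * latticeChar q s δ p ∧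
    q * latticeChar q s δ (p.1 - δ, p.2 + δ) = q * s.2.1 * latticeChar q s δ p ∧
    latticeChar q s δ (p.1, p.2 - δ) = q * s.2.2 * latticeChar q s δ p := by
  obtain ⟨h1, h2, h3, h⟩ := hs
  have hq0 : (q : ℂ) ≠ 0 := by exact_mod_cast hq.ne'
  have n1 : s.1 ≠ 0 := by rw [← norm_pos_iff, h1]; exact one_pos
  have n2 : s.2.1 ≠ 0 := by rw [← norm_pos_iff, h2]; exact one_pos
  have n3 : s.2.2 ≠ 0 := by rw [← norm_pos_iff, h3]; exact one_pos
  have n12 : s.1 * s.2.1 ≠ 0 := mul_ne_zero n1 n2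
  have hinv : (s.1 * s.2.1)⁻¹ = s.2.2 := inv_eq_of_mul_eq_one_right h
  simp only [latticeChar]
  refine ⟨?_, ?_, ?_⟩
  · rw [show -(δ * (p.1 + δ + p.2)) = -(δ * (p.1 + p.2)) + -1 by linear_combination -hδ,
      show δ * (p.1 + δ) = δ * p.1 + 1 by linear_combination hδ, zpow_add₀ hq0, zpow_add₀ n1,
      _root_.zpow_neg_one, zpow_one]
    field_simp
  · rw [show -(δ * (p.1 - δ + (p.2 + δ))) = -(δ * (p.1 + p.2)) by ring,
      show δ * (p.1 - δ) = δ * p.1 + -1 by linear_combination -hδ,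
      show δ * (p.2 + δ) = δ * p.2 + 1 by linear_combination hδ, zpow_add₀ n1, zpow_add₀ n12,
      _root_.zpow_neg_one, zpow_one]
    field_simp
  · rw [show -(δ * (p.1 + (p.2 - δ))) = -(δ * (p.1 + p.2)) + 1 by linear_combination hδ,
      show δ * (p.2 - δ) = δ * p.2 + -1 by linear_combination -hδ, zpow_add₀ hq0, zpow_add₀ n12,
      _root_.zpow_neg_one, zpow_one, hinv]
    ring

theorem norm_latticeChar_sq {q : ℝ} (hq : 0 < q) {s : ℂ × ℂ × ℂ} (hs : s ∈ unitTriples)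
    (δ : ℤ) (p : ℤ × ℤ) :
    ‖latticeChar q s δ p‖ ^ 2 * q ^ (2 * δ * (p.1 + p.2)) = 1 := by
  obtain ⟨h1, h2, -, -⟩ := hs
  rw [latticeChar, norm_mul, norm_mul, norm_zpow, norm_zpow, norm_zpow, norm_mul, h1, h2,
    Complex.norm_real, Real.norm_of_nonneg hq.le, mul_one, _root_.one_zpow, _root_.one_zpow, mul_one, mul_one,
    ← zpow_natCast, ← _root_.zpow_mul, ← zpow_add₀ hq.ne']
  rw [show -(δ * (p.1 + p.2)) * ((2 : ℕ) : ℤ) + 2 * δ * (p.1 + p.2) = 0 by push_cast; ring,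
    zpow_zero]

/-- Cutting off the eigenfunction to a square of side `n` gives an error of order `n`, on the
boundary of the square, against a squared norm `n²`. The square is placed inside the cone of
dominant weights. -/
theorem exists_lattice_approx {q : ℝ} (hq : 0 < q) {s : ℂ × ℂ × ℂ} (hs : s ∈ unitTriples)
    {δ : ℤ} (hδ : δ = 1 ∨ δ = -1) {ε : ℝ} (hε : 0 < ε) :
    ∃ (c : ℤ × ℤ → ℂ) (F : Finset (ℤ × ℤ)), (∀ p ∈ F, 1 ≤ p.1 ∧ 1 ≤ p.2) ∧
      (∀ p, c p ≠ 0 → 2 ≤ p.1 ∧ 2 ≤ p.2) ∧ (∀ p ∉ F, c p = 0 ∧ latticeOp q δ c p = 0) ∧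
      0 < ∑ p ∈ F, ‖c p‖ ^ 2 * q ^ (2 * δ * (p.1 + p.2)) ∧
      ∑ p ∈ F, ‖latticeOp q δ c p - q * (s.1 + s.2.1 + s.2.2) * c p‖ ^ 2
          * q ^ (2 * δ * (p.1 + p.2))
        ≤ ε * ∑ p ∈ F, ‖c p‖ ^ 2 * q ^ (2 * δ * (p.1 + p.2)) := by
  classical
  -- The error lives on `8 n` points and is at most `9 q²` on each.
  obtain ⟨n, hn⟩ := exists_nat_ge (72 * q ^ 2 / ε + 3)
  have hδ2 : δ * δ = 1 := by rcases hδ with rfl | rfl <;> norm_num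
  have hpos : 0 ≤ 72 * q ^ 2 / ε := by positivity
  have hn3 : 3 ≤ n := by exact_mod_cast (by linarith : (3 : ℝ) ≤ n)
  -- The square `B`, its neighborhood `F` and its interior `I`.
  set B : Finset (ℤ × ℤ) := Finset.Icc 2 (n + 1 : ℤ) ×ˢ Finset.Icc 2 (n + 1 : ℤ) with hB
  set F : Finset (ℤ × ℤ) := Finset.Icc 1 (n + 2 : ℤ) ×ˢ Finset.Icc 1 (n + 2 : ℤ) with hF
  set I : Finset (ℤ × ℤ) := Finset.Icc 3 (n : ℤ) ×ˢ Finset.Icc 3 (n : ℤ) with hI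
  have mB : ∀ p, p ∈ B ↔ (2 ≤ p.1 ∧ p.1 ≤ n + 1) ∧ (2 ≤ p.2 ∧ p.2 ≤ n + 1) := fun p => by
    simp [hB]
  have mF : ∀ p, p ∈ F ↔ (1 ≤ p.1 ∧ p.1 ≤ n + 2) ∧ (1 ≤ p.2 ∧ p.2 ≤ n + 2) := fun p => by
    simp [hF]
  have mI : ∀ p, p ∈ I ↔ (3 ≤ p.1 ∧ p.1 ≤ n) ∧ (3 ≤ p.2 ∧ p.2 ≤ n) := fun p => by
    simp [hI]
  have hBF : B ⊆ F := fun p hp => by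
    rw [mB] at hp; rw [mF]; omega
  have hIF : I ⊆ F := fun p hp => by
    rw [mI] at hp; rw [mF]; omega
  set g : ℤ × ℤ → ℂ := fun p => if p ∈ B then 1 else 0 with hg
  set ρ := latticeChar q s δ with hρ
  set c : ℤ × ℤ → ℂ := fun p => g p * ρ p with hc
  have hgdiff : ∀ p p', ‖g p - g p'‖ ≤ 1 := fun p p' => by
    simp only [hg]; split_ifs <;> simp
  have hD : ∀ p, latticeOp q δ c p - q * (s.1 + s.2.1 + s.2.2) * c p
      = q * ρ p * (s.1 * (g (p.1 + δ, p.2) - g p) + s.2.1 * (g (p.1 - δ, p.2 + δ) - g p)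
        + s.2.2 * (g (p.1, p.2 - δ) - g p)) := by
    intro p
    obtain ⟨e1, e2, e3⟩ := latticeChar_shift hq hs hδ2 p
    simp only [latticeOp, hc]
    linear_combination g (p.1 + δ, p.2) * e1 + g (p.1 - δ, p.2 + δ) * e2 + g (p.1, p.2 - δ) * e3
  have hcB : ∀ p ∉ B, c p = 0 := fun p hp => by simp [hc, hg, hp]
  have hsum : ∑ p ∈ F, ‖c p‖ ^ 2 * q ^ (2 * δ * (p.1 + p.2)) = (n : ℝ) ^ 2 := by
    rw [← Finset.sum_subset hBF fun p _ hp => by rw [hcB p hp]; simp]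
    have h1 : ∀ p ∈ B, ‖c p‖ ^ 2 * q ^ (2 * δ * (p.1 + p.2)) = 1 := fun p hp => by
      simp only [hc, hg, if_pos hp, one_mul]
      exact norm_latticeChar_sq hq hs δ p
    rw [Finset.sum_congr rfl h1, Finset.sum_const, hB, Finset.card_product, Int.card_Icc,
      show ((n + 1 : ℤ) + 1 - 2).toNat = n by omega, nsmul_eq_mul]
    push_cast; ring
  refine ⟨c, F, fun p hp => ?_, fun p hp => ?_, fun p hp => ⟨hcB p fun h => hp (hBF h), ?_⟩, ?_, ?_⟩
  · rw [mF] at hp; omega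
  · have : p ∈ B := by by_contra h; exact hp (hcB p h)
    rw [mB] at this; omega
  · have h1 : ∀ p' : ℤ × ℤ, |p'.1 - p.1| ≤ 1 → |p'.2 - p.2| ≤ 1 → c p' = 0 := by
      intro p' h1 h2
      refine hcB _ fun h => hp ?_
      rw [mB] at h; rw [mF]; rw [abs_le] at h1 h2; omega
    rw [latticeOp, h1, h1, h1]
    · ring
    all_goals rcases hδ with rfl | rfl <;> simp
  · rw [hsum]; positivity
  · rw [hsum]
    have h2 : ∀ p ∈ F, ‖latticeOp q δ c p - q * (s.1 + s.2.1 + s.2.2) * c p‖ ^ 2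
        * q ^ (2 * δ * (p.1 + p.2)) ≤ if p ∈ I then 0 else 9 * q ^ 2 := by
      intro p _
      rw [hD]
      split_ifs with hpI
      · have h1 : ∀ p' : ℤ × ℤ, |p'.1 - p.1| ≤ 1 → |p'.2 - p.2| ≤ 1 → g p' = 1 := by
          intro p' h1 h2
          refine if_pos ?_
          rw [mI] at hpI; rw [mB]; rw [abs_le] at h1 h2; omega
        rw [h1 p (by simp) (by simp), h1, h1, h1]
        · simp
        all_goals rcases hδ with rfl | rfl <;> simp
      · have hb : ‖s.1 * (g (p.1 + δ, p.2) - g p) + s.2.1 * (g (p.1 - δ, p.2 + δ) - g p)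
            + s.2.2 * (g (p.1, p.2 - δ) - g p)‖ ≤ 3 := by
          refine (norm_add₃_le).trans ?_
          rw [norm_mul, norm_mul, norm_mul, hs.1, hs.2.1, hs.2.2.1]
          linarith [hgdiff (p.1 + δ, p.2) p, hgdiff (p.1 - δ, p.2 + δ) p,
            hgdiff (p.1, p.2 - δ) p]
        have hr := norm_latticeChar_sq hq hs δ p
        rw [norm_mul, norm_mul, Complex.norm_real, Real.norm_of_nonneg hq.le]
        calc _ = q ^ 2 * ‖s.1 * (g (p.1 + δ, p.2) - g p) + s.2.1 * (g (p.1 - δ, p.2 + δ) - g p)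
            + s.2.2 * (g (p.1, p.2 - δ) - g p)‖ ^ 2
              * (‖ρ p‖ ^ 2 * q ^ (2 * δ * (p.1 + p.2))) := by ring
          _ ≤ q ^ 2 * 3 ^ 2 * 1 := by rw [hr]; gcongr
          _ = _ := by ring
    refine (Finset.sum_le_sum h2).trans ?_
    have hcard : (F.filter fun p => p ∉ I).card = 8 * n := by
      have e1 : (F.filter fun p => p ∉ I) = F \ I := by ext; simp
      rw [e1, Finset.card_sdiff_of_subset hIF, hF, hI, Finset.card_product, Finset.card_product,
        Int.card_Icc, Int.card_Icc, show ((n + 2 : ℤ) + 1 - 1).toNat = n + 2 by omega,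
        show ((n : ℤ) + 1 - 3).toNat = n - 2 by omega]
      obtain ⟨m, rfl⟩ := Nat.exists_eq_add_of_le hn3
      rw [show 3 + m - 2 = m + 1 by omega]
      refine Nat.sub_eq_of_eq_add ?_
      ring
    rw [Finset.sum_ite, Finset.sum_const_zero, zero_add, Finset.sum_const, hcard, nsmul_eq_mul]
    have hn' : 72 * q ^ 2 / ε ≤ n := by linarith
    rw [div_le_iff₀ hε] at hn'
    have hn0 : (0 : ℝ) ≤ n := Nat.cast_nonneg n
    push_cast
    nlinarith

end

/-! ### The deltoid is contained in the spectrum of `A₁` -/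

section

variable {K : Type*} [Field K]

local notation "𝐜" => (HahnSeries.C : K →+* K⸨X⸩)

variable (K) in
/-- The orbit of the standard apartment under the integral unipotent upper triangular matrices. -/
def horoSet : Set (Vertex K) :=
  {x | ∃ a b c : ℤ, ∃ u ∈ intRing K, ∃ v ∈ intRing K, ∃ w ∈ intRing K,
    x = vertexOf (ut 0 0 0 u v w * ut a b c 0 0 0)}

theorem ut_dominant_mul {a b c : ℤ} (hab : b ≤ a) (hbc : c ≤ b) (a' b' c' : ℤ) {u v w : K⸨X⸩}
    (hu : u ∈ intRing K) (hv : v ∈ intRing K) (hw : w ∈ intRing K) :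
    ∃ u' ∈ intRing K, ∃ v' ∈ intRing K, ∃ w' ∈ intRing K,
      ut a b c 0 0 0 * ut a' b' c' (u * unif K b') (v * unif K c') (w * unif K c')
        = ut 0 0 0 u' v' w' * ut (a + a') (b + b') (c + c') 0 0 0 := by
  refine ⟨unif K (a - b) * u, mul_mem (unif_mem_intRing.2 (by omega)) hu,
    unif K (a - c) * v, mul_mem (unif_mem_intRing.2 (by omega)) hv,
    unif K (b - c) * w, mul_mem (unif_mem_intRing.2 (by omega)) hw, ?_⟩
  rw [ut_mul, ut_mul]
  have e1 : unif K (a - b) * unif K b = unif K a := by rw [← unif_add]; congr 1; ring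
  have e2 : unif K (a - c) * unif K c = unif K a := by rw [← unif_add]; congr 1; ring
  have e3 : unif K (b - c) * unif K c = unif K b := by rw [← unif_add]; congr 1; ring
  congr 1
  any_goals ring1
  · rw [unif_add, ← e1]; ring
  · rw [unif_add, ← e2]; ring
  · rw [unif_add, ← e3]; ring

theorem mem_horoSet_mul {a b c : ℤ} (hab : b ≤ a) (hbc : c ≤ b) (a' b' c' : ℤ)
    {u₀ v₀ w₀ u v w u' v' w' : K⸨X⸩}
    (hu₀ : u₀ ∈ intRing K) (hv₀ : v₀ ∈ intRing K) (hw₀ : w₀ ∈ intRing K)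
    (hu : u ∈ intRing K) (hv : v ∈ intRing K) (hw : w ∈ intRing K)
    (hu' : u' = u * unif K b') (hv' : v' = v * unif K c') (hw' : w' = w * unif K c') :
    vertexOf (ut 0 0 0 u₀ v₀ w₀ * ut a b c 0 0 0 * ut a' b' c' u' v' w') ∈ horoSet K := by
  obtain ⟨x, hx, y, hy, z, hz, e⟩ := ut_dominant_mul hab hbc a' b' c' hu hv hw
  rw [hu', hv', hw', mul_assoc, e, ← mul_assoc, ut_mul]
  refine ⟨a + a', b + b', c + c', _, ?_, _, ?_, _, ?_, by rw [zero_add]⟩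
  · simpa using add_mem hx hu₀
  · simpa using add_mem (add_mem hy (mul_mem hu₀ hz)) hv₀
  · simpa using add_mem hz hw₀

theorem exists_of_mem_horoSet {x : Vertex K} (hx : x ∈ horoSet K) :
    ∃ a b c : ℤ, ∃ u ∈ intRing K, ∃ v ∈ intRing K, ∃ w ∈ intRing K,
      x = vertexOf (ut 0 0 0 u v w * ut a b c 0 0 0) ∧
      IsUT (ut 0 0 0 u v w * ut a b c 0 0 0) ∧ typ x = (a - b, b - c) := by
  obtain ⟨a, b, c, u, hu, v, hv, w, hw, rfl⟩ := hx
  refine ⟨a, b, c, u, hu, v, hv, w, hw, rfl, ?_, ?_⟩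
  · rw [ut_mul]; exact ⟨_, _, _, _, _, _, rfl⟩
  · rw [ut_mul, typ_vertexOf_ut]; simp

section

variable [Fintype K]

/-- All neighbors, in both directions, of a vertex of dominant type in `horoSet` are in
`horoSet`. -/
theorem mem_horoSet_of_coloredAdj {x y : Vertex K} (hx : x ∈ horoSet K)
    (h : 0 ≤ (typ x).1 ∧ 0 ≤ (typ x).2) (hxy : ColoredAdj 1 x y ∨ ColoredAdj 2 x y) :
    y ∈ horoSet K := by
  obtain ⟨a, b, c, u, hu, v, hv, w, hw, rfl, -, ht⟩ := exists_of_mem_horoSet hx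
  rw [ht] at h
  have hab : b ≤ a := by have := h.1; dsimp only at this; omega
  have hbc : c ≤ b := by have := h.2; dsimp only at this; omega
  have z := zero_mem (intRing K)
  rcases hxy with hxy | hxy
  · rcases coloredAdj_one_iff.1 hxy with ⟨p, rfl⟩ | ⟨s, rfl⟩ | rfl
    · exact mem_horoSet_mul hab hbc _ _ _ hu hv hw (C_mem_intRing p.1) (C_mem_intRing p.2) z
        (by simp) (by simp) (by simp)
    · exact mem_horoSet_mul hab hbc _ _ _ hu hv hw z z (C_mem_intRing s)
        (by simp) (by simp) (by simp)
    · exact mem_horoSet_mul hab hbc _ _ _ hu hv hw z z z (by simp) (by simp) (by simp)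
  · rcases coloredAdj_two_iff_ut.1 hxy with ⟨p, rfl⟩ | ⟨s, rfl⟩ | rfl
    · exact mem_horoSet_mul hab hbc _ _ _ hu hv hw z (C_mem_intRing p.1) (C_mem_intRing p.2)
        (by simp) (by simp) (by simp)
    · exact mem_horoSet_mul hab hbc _ _ _ hu hv hw (C_mem_intRing s) z z
        (by simp) (by simp) (by simp)
    · exact mem_horoSet_mul hab hbc _ _ _ hu hv hw z z z (by simp) (by simp) (by simp)

theorem stepRel_ncard (x : Vertex K) :
    ({y | StepRel (1, 0) x y}.Finite ∧ {y | StepRel (1, 0) x y}.ncard = Nat.card K ^ 2 ∧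
      {y | StepRel (1, 0) y x}.ncard = 1) ∧
    ({y | StepRel (-1, 1) x y}.Finite ∧ {y | StepRel (-1, 1) x y}.ncard = Nat.card K ∧
      {y | StepRel (-1, 1) y x}.ncard = Nat.card K) := by
  obtain ⟨g, hg, rfl⟩ := exists_isUT x
  rw [setOf_stepRel_one hg, setOf_stepRel_one' hg, setOf_stepRel_two hg, setOf_stepRel_two' hg]
  have h1 := finite_ncard_range_of_injective (injective_step_one g)
  have h2 := finite_ncard_range_of_injective (injective_step_two g)
  have h3 := finite_ncard_range_of_injective (injective_costep_two g)
  refine ⟨⟨h1.1, ?_, Set.ncard_singleton _⟩, h2.1, h2.2, h3.2⟩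
  rw [h1.2, Nat.card_prod, sq]

/-- Double counting for a relation with constant in- and out-degrees. -/
theorem finite_and_card_of_rel {V : Type*} {R : V → V → Prop} {S T : Set V} {m n : ℕ}
    (hS : S.Finite) (hout : ∀ x ∈ S, {y | R x y} ⊆ T ∧ {y | R x y}.Finite ∧ {y | R x y}.ncard = m)
    (hn : n ≠ 0) (hin : ∀ y ∈ T, {x | R x y} ⊆ S ∧ {x | R x y}.ncard = n) :
    T.Finite ∧ T.ncard * n = S.ncard * m := by
  classical
  have hT : T.Finite := by
    refine (hS.biUnion fun x hx => (hout x hx).2.1).subset fun y hy => ?_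
    obtain ⟨h1, h2⟩ := hin y hy
    obtain ⟨x, hx⟩ := Set.nonempty_of_ncard_ne_zero (h2 ▸ hn)
    exact Set.mem_biUnion (h1 hx) hx
  refine ⟨hT, ?_⟩
  rw [Set.ncard_eq_toFinset_card _ hT, Set.ncard_eq_toFinset_card _ hS]
  refine (Finset.card_mul_eq_card_mul R (fun x hx => ?_) fun y hy => ?_).symm
  · obtain ⟨h1, -, h3⟩ := hout x (hS.mem_toFinset.1 hx)
    rw [← h3, ← Set.ncard_coe_finset]
    congr 1; ext y
    simpa [Finset.bipartiteAbove] using fun h => h1 h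
  · obtain ⟨h1, h3⟩ := hin y (hT.mem_toFinset.1 hy)
    rw [← h3, ← Set.ncard_coe_finset]
    congr 1; ext x
    simpa [Finset.bipartiteBelow] using fun h => h1 h

variable (K) in
/-- The vertices of `horoSet` of a given type. -/
def horoFiber (p : ℤ × ℤ) : Set (Vertex K) := {x | x ∈ horoSet K ∧ typ x = p}

theorem horoFiber_zero : horoFiber K (0, 0) = {vertexOf 1} := by
  ext x
  constructor
  · rintro ⟨hx, ht⟩
    obtain ⟨a, b, c, u, hu, v, hv, w, hw, rfl, -, ht'⟩ := exists_of_mem_horoSet hx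
    rw [ht', Prod.mk.injEq] at ht
    obtain rfl : a = b := by omega
    obtain rfl : a = c := by omega
    rw [Set.mem_singleton_iff, ut_mul]
    have := vertexOf_ut_add 0 0 0 u v w a
    simp only [zero_add, mul_zero, mul_comm (unif K a)] at this ⊢
    rw [this, ← one_mul (ut ..), vertexOf_mul_intGL _ (ut_mem_intGL hu hv hw)]
  · rintro rfl
    have z := zero_mem (intRing K)
    have e : (1 : GL (Fin 3) K⸨X⸩) = ut 0 0 0 0 0 0 * ut 0 0 0 0 0 0 := by rw [ut_one, one_mul]
    refine ⟨⟨0, 0, 0, 0, z, 0, z, 0, z, by rw [← e]⟩, ?_⟩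
    rw [← ut_one, typ_vertexOf_ut]; simp

theorem horoFiber_step {d p : ℤ × ℤ} {m n : ℕ} (hp : 0 ≤ p.1 ∧ 0 ≤ p.2)
    (hpd : 0 ≤ (p + d).1 ∧ 0 ≤ (p + d).2) (hn : n ≠ 0)
    (hd : ∀ x : Vertex K, {y | StepRel d x y}.Finite ∧ {y | StepRel d x y}.ncard = m ∧
      {y | StepRel d y x}.ncard = n) (hfin : (horoFiber K p).Finite) :
    (horoFiber K (p + d)).Finite ∧ (horoFiber K (p + d)).ncard * n = (horoFiber K p).ncard * m := by
  refine finite_and_card_of_rel (R := StepRel d) hfin (fun x hx => ⟨?_, (hd x).1, (hd x).2.1⟩) hn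
    fun y hy => ⟨?_, (hd y).2.2⟩
  · intro y hy
    exact ⟨mem_horoSet_of_coloredAdj hx.1 (by rw [hx.2]; exact hp) (Or.inl hy.1),
      by rw [hy.2, hx.2]⟩
  · intro x hx
    refine ⟨mem_horoSet_of_coloredAdj hy.1 (by rw [hy.2]; exact hpd)
      (Or.inr (coloredAdj_two_iff.2 hx.1)), ?_⟩
    have := hx.2
    rw [hy.2] at this
    exact (add_right_cancel this).symm

/-- The fiber over `(i, j)` is reached from the origin by `i + j` steps in direction `(1, 0)`, each
multiplying the cardinality by `q²`, and `j` steps in direction `(-1, 1)`, which preserve it. -/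
theorem horoFiber_card (i j : ℕ) :
    (horoFiber K (i, j)).Finite ∧ (horoFiber K (i, j)).ncard = Nat.card K ^ (2 * (i + j)) := by
  have hq : Nat.card K ≠ 0 := Nat.card_pos.ne'
  induction j generalizing i with
  | zero =>
    induction i with
    | zero => simp [horoFiber_zero]
    | succ i ih =>
      obtain ⟨h1, h2⟩ := horoFiber_step (d := (1, 0)) (p := ((i : ℤ), ((0 : ℕ) : ℤ)))
        (by simp) (by simp; positivity) one_ne_zero (fun x => (stepRel_ncard x).1) ih.1
      have e : ((i : ℤ), ((0 : ℕ) : ℤ)) + ((1, 0) : ℤ × ℤ) = (((i + 1 : ℕ) : ℤ), ((0 : ℕ) : ℤ)) := by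
        ext <;> simp
      rw [e] at h1 h2
      refine ⟨h1, ?_⟩
      rw [← mul_one (Set.ncard _), h2, ih.2]; ring
  | succ j ih =>
    obtain ⟨h0, h0'⟩ := ih (i + 1)
    obtain ⟨h1, h2⟩ := horoFiber_step (d := (-1, 1)) (p := (((i + 1 : ℕ) : ℤ), (j : ℤ)))
      (by simp; positivity) (by simp; omega) hq (fun x => (stepRel_ncard x).2) h0
    have e : (((i + 1 : ℕ) : ℤ), (j : ℤ)) + ((-1, 1) : ℤ × ℤ) = ((i : ℤ), ((j + 1 : ℕ) : ℤ)) := by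
      ext <;> simp
    rw [e] at h1 h2
    refine ⟨h1, ?_⟩
    rw [Nat.eq_of_mul_eq_mul_right (Nat.pos_of_ne_zero hq) h2, h0']
    congr 1; ring

open Classical in
/-- The function on the building, supported on `horoSet`, that depends only on the type. -/
def horoFun (φ : ℤ × ℤ → ℂ) (x : Vertex K) : ℂ := if x ∈ horoSet K then φ (typ x) else 0

/-- Its squared `ℓ²` norm is a weighted sum over the types, with the sizes of the fibers. -/
theorem exists_horoLp {F : Finset (ℤ × ℤ)} (hF : ∀ p ∈ F, 1 ≤ p.1 ∧ 1 ≤ p.2) {φ : ℤ × ℤ → ℂ}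
    (hφ : ∀ p ∉ F, φ p = 0) : ∃ f : L2Building K, (∀ x, f x = horoFun φ x) ∧
      ‖f‖ ^ 2 = ∑ p ∈ F, ‖φ p‖ ^ 2 * (Nat.card K : ℝ) ^ (2 * 1 * (p.1 + p.2)) := by
  classical
  have hfib : ∀ p ∈ F, (horoFiber K p).Finite ∧
      ((horoFiber K p).ncard : ℝ) = (Nat.card K : ℝ) ^ (2 * 1 * (p.1 + p.2)) := by
    intro p hp
    obtain ⟨h1, h2⟩ := hF p hp
    obtain ⟨i, hi⟩ := Int.eq_ofNat_of_zero_le (by omega : 0 ≤ p.1)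
    obtain ⟨j, hj⟩ := Int.eq_ofNat_of_zero_le (by omega : 0 ≤ p.2)
    have e : p = ((i : ℤ), (j : ℤ)) := Prod.ext hi hj
    have h := horoFiber_card (K := K) i j
    rw [e]
    refine ⟨h.1, ?_⟩
    rw [h.2]
    push_cast
    rw [← zpow_natCast]; congr 1
  have hfin : {x : Vertex K | x ∈ horoSet K ∧ typ x ∈ F}.Finite := by
    refine (F.finite_toSet.biUnion fun p hp => (hfib p hp).1).subset fun x hx => ?_
    exact Set.mem_biUnion hx.2 ⟨hx.1, rfl⟩
  have hsupp : ∀ x ∉ hfin.toFinset, horoFun φ x = 0 := by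
    intro x hx
    rw [Set.Finite.mem_toFinset] at hx
    rw [horoFun]
    split_ifs with h
    · exact hφ _ fun h' => hx ⟨h, h'⟩
    · rfl
  have hmem : Memℓp (horoFun (K := K) φ) 2 := by
    rw [memℓp_gen_iff (by norm_num)]
    refine summable_of_ne_finset_zero (s := hfin.toFinset) fun x hx => ?_
    rw [hsupp x hx]; simp
  refine ⟨⟨_, hmem⟩, fun x => rfl, ?_⟩
  have h := lp.norm_rpow_eq_tsum (p := 2) (by norm_num) (⟨_, hmem⟩ : L2Building K)
  simp only [ENNReal.toReal_ofNat, Real.rpow_ofNat] at h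
  rw [h, tsum_eq_sum (s := hfin.toFinset) (fun x hx => by
    rw [hsupp x hx]; simp),
    ← Finset.sum_fiberwise_of_maps_to (t := F) (g := typ) fun x hx => by
      rw [Set.Finite.mem_toFinset] at hx; exact hx.2]
  refine Finset.sum_congr rfl fun p hp => ?_
  have hfil : (hfin.toFinset.filter fun x => typ x = p) = (hfib p hp).1.toFinset := by
    ext x
    simp only [Finset.mem_filter, Set.Finite.mem_toFinset, Set.mem_ofPred_eq, horoFiber]
    constructor
    · rintro ⟨⟨h1, -⟩, h2⟩; exact ⟨h1, h2⟩
    · rintro ⟨h1, h2⟩; exact ⟨⟨h1, h2 ▸ hp⟩, h2⟩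
  rw [hfil, Finset.sum_congr rfl (g := fun _ => ‖φ p‖ ^ 2), Finset.sum_const,
    ← Set.ncard_eq_toFinset_card _ (hfib p hp).1, nsmul_eq_mul, (hfib p hp).2, mul_comm]
  intro x hx
  rw [Set.Finite.mem_toFinset] at hx
  rw [horoFun, if_pos hx.1, hx.2]

theorem coloredAdjacency_one_eq {g : GL (Fin 3) K⸨X⸩} (hg : IsUT g) (f : L2Building K) :
    A1 K f (vertexOf g) = ∑ u, ∑ v, f (vertexOf (g * ut 1 0 0 (𝐜 u) (𝐜 v) 0))
      + ∑ s, f (vertexOf (g * ut 0 1 0 0 0 (𝐜 s))) + f (vertexOf (g * ut 0 0 1 0 0 0)) := by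
  rw [A1_eq]
  change U1 K f _ + U2 K f _ + U3 K f _ = _
  rw [U1_apply hg, U2_apply hg, U3_apply hg]

/-- On functions of the type supported in the interior of the cone, `A₁` acts by translations. -/
theorem A1_horoFun {c : ℤ × ℤ → ℂ} (hc : ∀ p, c p ≠ 0 → 2 ≤ p.1 ∧ 2 ≤ p.2) {f : L2Building K}
    (hf : ∀ x, f x = horoFun c x) (x : Vertex K) :
    A1 K f x = horoFun (latticeOp (Nat.card K) 1 c) x := by
  classical
  obtain ⟨g, hg, hx⟩ := exists_isUT x
  have hq : ((Nat.card K : ℝ) : ℂ) = (Fintype.card K : ℂ) := by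
    rw [Nat.card_eq_fintype_card]; simp
  have ht1 : ∀ u v, typ (vertexOf (g * ut 1 0 0 (𝐜 u) (𝐜 v) 0)) = typ x + (1, 0) := by
    intro u v
    obtain ⟨a, b, c, u, v, w, rfl⟩ := hg
    rw [hx, typ_ut_mul_ut]; simp
  have ht2 : ∀ s, typ (vertexOf (g * ut 0 1 0 0 0 (𝐜 s))) = typ x + (-1, 1) := by
    intro s
    obtain ⟨a, b, c, u, v, w, rfl⟩ := hg
    rw [hx, typ_ut_mul_ut]; simp
  have ht3 : typ (vertexOf (g * ut 0 0 1 0 0 0)) = typ x + (0, -1) := by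
    obtain ⟨a, b, c, u, v, w, rfl⟩ := hg
    rw [hx, typ_ut_mul_ut]; simp
  have hval : ∀ y, ColoredAdj 1 x y → f y = if x ∈ horoSet K then c (typ y) else 0 := by
    intro y hy
    rw [hf, horoFun]
    by_cases h0 : c (typ y) = 0
    · simp [h0]
    have h2 := hc _ h0
    have htx : -1 ≤ (typ y).1 - (typ x).1 ∧ (typ y).1 - (typ x).1 ≤ 1 ∧
        -1 ≤ (typ y).2 - (typ x).2 ∧ (typ y).2 - (typ x).2 ≤ 1 := by
      rcases (coloredAdj_one_iff_stepRel x y).1 hy with h | h | h <;>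
        rw [h.2] <;> simp
    refine if_congr ⟨fun h => ?_, fun h => ?_⟩ rfl rfl
    · exact mem_horoSet_of_coloredAdj h (by omega) (Or.inr (coloredAdj_two_iff.2 hy))
    · exact mem_horoSet_of_coloredAdj h (by omega) (Or.inl hy)
  have hA : ∀ y, (∃ u v, y = vertexOf (g * ut 1 0 0 (𝐜 u) (𝐜 v) 0)) ∨
      (∃ s, y = vertexOf (g * ut 0 1 0 0 0 (𝐜 s))) ∨ y = vertexOf (g * ut 0 0 1 0 0 0) →
      ColoredAdj 1 x y := by
    intro y hy
    rw [hx, coloredAdj_one_iff]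
    rcases hy with ⟨u, v, rfl⟩ | ⟨s, rfl⟩ | rfl
    · exact Or.inl ⟨(u, v), rfl⟩
    · exact Or.inr (Or.inl ⟨s, rfl⟩)
    · exact Or.inr (Or.inr rfl)
  have h1 : ∀ u v, f (vertexOf (g * ut 1 0 0 (𝐜 u) (𝐜 v) 0))
      = if x ∈ horoSet K then c (typ x + (1, 0)) else 0 := fun u v => by
    rw [hval _ (hA _ (Or.inl ⟨u, v, rfl⟩)), ht1]
  have h2 : ∀ s, f (vertexOf (g * ut 0 1 0 0 0 (𝐜 s)))
      = if x ∈ horoSet K then c (typ x + (-1, 1)) else 0 := fun s => by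
    rw [hval _ (hA _ (Or.inr (Or.inl ⟨s, rfl⟩))), ht2]
  have h3 : f (vertexOf (g * ut 0 0 1 0 0 0))
      = if x ∈ horoSet K then c (typ x + (0, -1)) else 0 := by
    rw [hval _ (hA _ (Or.inr (Or.inr rfl))), ht3]
  rw [hx, coloredAdjacency_one_eq hg]
  simp only [h1, h2, h3]
  rw [← hx, horoFun, latticeOp]
  have e1 : typ x + (1, 0) = ((typ x).1 + 1, (typ x).2) := by ext <;> simp
  have e2 : typ x + (-1, 1) = ((typ x).1 - 1, (typ x).2 + 1) := by ext <;> simp [sub_eq_add_neg]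
  have e3 : typ x + (0, -1) = ((typ x).1, (typ x).2 - 1) := by ext <;> simp [sub_eq_add_neg]
  rw [e1, e2, e3, hq]
  split_ifs
  · simp only [Finset.sum_const, nsmul_eq_mul, Finset.card_univ]; ring
  · simp

theorem exists_approx_A1 {l : ℂ} (hl : l ∈ Sigma2 (Nat.card K)) {ε : ℝ} (hε : 0 < ε) :
    ∃ f : L2Building K, f ≠ 0 ∧ ‖A1 K f - l • f‖ ≤ ε * ‖f‖ := by
  obtain ⟨s, hs, rfl⟩ := hl
  dsimp only
  have hq0 : (0 : ℝ) < Nat.card K := by exact_mod_cast Nat.card_pos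
  obtain ⟨c, F, hF, hc, hcF, hpos, hle⟩ := exists_lattice_approx hq0 hs (Or.inl rfl)
    (pow_pos hε 2)
  obtain ⟨f, hf, hfn⟩ := exists_horoLp (K := K) hF fun p hp => (hcF p hp).1
  obtain ⟨h, hh, hhn⟩ := exists_horoLp (K := K) hF
    (φ := fun p => latticeOp (Nat.card K) 1 c p
      - ((Nat.card K : ℝ) : ℂ) * (s.1 + s.2.1 + s.2.2) * c p)
    fun p hp => by rw [(hcF p hp).1, (hcF p hp).2]; simp
  have e : A1 K f - (((Nat.card K : ℝ) : ℂ) * (s.1 + s.2.1 + s.2.2)) • f = h := by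
    ext x
    change A1 K f x - _ * f x = h x
    rw [A1_horoFun hc hf, hf, hh]
    simp only [horoFun]
    split_ifs <;> ring
  refine ⟨f, ?_, ?_⟩
  · rintro rfl
    rw [← hfn] at hpos
    simp at hpos
  · rw [e]
    rw [← hfn, ← hhn, ← mul_pow] at hle
    exact (pow_le_pow_iff_left₀ (norm_nonneg _) (by positivity) two_ne_zero).1 hle

theorem spectrum_A1 : spectrum ℂ (A1 K) = Sigma2 (Nat.card K) :=
  spectrum_A1_subset.antisymm fun _ hl =>
    mem_spectrum_of_approx fun _ hε => exists_approx_A1 hl hε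

theorem simultaneousSpectrum_A1_A2 :
    simultaneousSpectrum (A1 K) (A2 K) = Sigma2Pairs (Nat.card K) := by
  rw [← adjoint_A1, simultaneousSpectrum_adjoint isStarNormal_A1 spectrum_A1_subset
    fun l hl ε hε => exists_approx_A1 hl hε]
  ext l
  exact mem_Sigma2Pairs_iff.symm

end

end

/-! ### Polynomial matrices and the orbits of diagonal matrices -/

section

variable {K : Type*} [Field K]

local notation "𝐜" => (HahnSeries.C : K →+* K⸨X⸩)

theorem polyToLaurent_monomial (n : ℕ) (c : K) :
    polyToLaurent K (Polynomial.monomial n c) = unif K (-n) * 𝐜 c := by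
  simp [polyToLaurent, unif, Polynomial.eval₂_monomial, HahnSeries.single_pow]

theorem polyToLaurent_coeff (p : K[X]) (n : ℕ) :
    (polyToLaurent K p).coeff (-(n : ℤ)) = p.coeff n := by
  induction p using Polynomial.induction_on' with
  | add p r hp hr => rw [map_add, HahnSeries.coeff_add, hp, hr, Polynomial.coeff_add]
  | monomial m c =>
    rw [polyToLaurent_monomial, unif, HahnSeries.C_apply, HahnSeries.single_mul_single,
      HahnSeries.coeff_single, Polynomial.coeff_monomial]
    simp [eq_comm]

theorem polyToLaurent_coeff_pos (p : K[X]) {m : ℤ} (hm : 0 < m) :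
    (polyToLaurent K p).coeff m = 0 := by
  induction p using Polynomial.induction_on' with
  | add p r hp hr => rw [map_add, HahnSeries.coeff_add, hp, hr, add_zero]
  | monomial n c =>
    rw [polyToLaurent_monomial, unif, HahnSeries.C_apply, HahnSeries.single_mul_single,
      HahnSeries.coeff_single, if_neg (by omega)]

/-- The degree of a polynomial in `t` is read off from its order in `X = t⁻¹`. -/
theorem unif_mul_polyToLaurent_mem {m : ℤ} {p : K[X]} :
    unif K m * polyToLaurent K p ∈ intRing K ↔ ∀ n : ℕ, m < n → p.coeff n = 0 := by
  have hc : ∀ k : ℤ, (unif K m * polyToLaurent K p).coeff k = (polyToLaurent K p).coeff (k - m) := by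
    intro k
    rw [unif, show k = k - m + m by ring, HahnSeries.coeff_single_mul_add]; simp
  rw [mem_intRing_iff]
  constructor
  · intro h n hn
    have := h (m - n) (by omega)
    rwa [hc, show m - n - m = -(n : ℤ) by ring, polyToLaurent_coeff] at this
  · intro h k hk
    rw [hc]
    by_cases hkm : 0 < k - m
    · exact polyToLaurent_coeff_pos p hkm
    · obtain ⟨n, hn⟩ := Int.eq_ofNat_of_zero_le (by omega : 0 ≤ m - k)
      rw [show k - m = -(n : ℤ) by omega, polyToLaurent_coeff]
      exact h n (by omega)

theorem polyToLaurent_injective : Function.Injective (polyToLaurent K) :=  by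
  intro p r h
  ext n
  rw [← polyToLaurent_coeff, h, polyToLaurent_coeff]

/-- The upper triangular unipotent matrices. -/
def upperUnip {R : Type*} [CommRing R] (u v w : R) : GL (Fin 3) R where
  val := !![1, u, v; 0, 1, w; 0, 0, 1]
  inv := !![1, -u, u * w - v; 0, 1, -w; 0, 0, 1]
  val_inv := by
    ext i j; fin_cases i <;> fin_cases j <;> simp [Matrix.mul_apply, Fin.sum_univ_three] <;> ring
  inv_val := by
    ext i j; fin_cases i <;> fin_cases j <;> simp [Matrix.mul_apply, Fin.sum_univ_three] <;> ring

/-- The permutation matrix exchanging the first two coordinates. -/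
def swapFirst (R : Type*) [CommRing R] : GL (Fin 3) R where
  val := !![0, 1, 0; 1, 0, 0; 0, 0, 1]
  inv := !![0, 1, 0; 1, 0, 0; 0, 0, 1]
  val_inv := by
    ext i j; fin_cases i <;> fin_cases j <;> simp [Matrix.mul_apply, Fin.sum_univ_three]
  inv_val := by
    ext i j; fin_cases i <;> fin_cases j <;> simp [Matrix.mul_apply, Fin.sum_univ_three]

/-- The permutation matrix exchanging the last two coordinates. -/
def swapLast (R : Type*) [CommRing R] : GL (Fin 3) R where
  val := !![1, 0, 0; 0, 0, 1; 0, 1, 0]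
  inv := !![1, 0, 0; 0, 0, 1; 0, 1, 0]
  val_inv := by
    ext i j; fin_cases i <;> fin_cases j <;> simp [Matrix.mul_apply, Fin.sum_univ_three]
  inv_val := by
    ext i j; fin_cases i <;> fin_cases j <;> simp [Matrix.mul_apply, Fin.sum_univ_three]

variable (K) in
/-- The embedding `GL(3, K[t]) → GL(3, K((t⁻¹)))`. -/
abbrev polyGL : GL (Fin 3) K[X] →* GL (Fin 3) K⸨X⸩ :=
  GeneralLinearGroup.map (n := Fin 3) (polyToLaurent K)

theorem polyGL_upperUnip (u v w : K[X]) : polyGL K (upperUnip u v w)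
    = ut 0 0 0 (polyToLaurent K u) (polyToLaurent K v) (polyToLaurent K w) := by
  ext i j
  rw [GeneralLinearGroup.map_apply]
  fin_cases i <;> fin_cases j <;> simp [upperUnip, ut_val]

theorem polyGL_swapFirst : polyGL K (swapFirst K[X]) = swapFirst K⸨X⸩ := by
  ext i j
  rw [GeneralLinearGroup.map_apply]
  fin_cases i <;> fin_cases j <;> simp [swapFirst]

theorem polyGL_swapLast : polyGL K (swapLast K[X]) = swapLast K⸨X⸩ := by
  ext i j
  rw [GeneralLinearGroup.map_apply]
  fin_cases i <;> fin_cases j <;> simp [swapLast]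

theorem swapFirst_mem_intGL : swapFirst K⸨X⸩ ∈ intGL K := by
  have : IntMat (swapFirst K⸨X⸩).1 := fun i j => by
    fin_cases i <;> fin_cases j <;> simp [swapFirst]
  exact mem_intGL_iff.2 ⟨this, this⟩

theorem swapLast_mem_intGL : swapLast K⸨X⸩ ∈ intGL K := by
  have : IntMat (swapLast K⸨X⸩).1 := fun i j => by
    fin_cases i <;> fin_cases j <;> simp [swapLast]
  exact mem_intGL_iff.2 ⟨this, this⟩

theorem QVertex_mk_eq_iff {x y : Vertex K} :
    QVertex.mk x = QVertex.mk y ↔ ∃ γ ∈ Gam K, γ • y = x := by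
  refine (Quotient.eq'' (s₁ := MulAction.orbitRel (Gam K) (Vertex K))).trans ?_
  constructor
  · rintro ⟨γ, h⟩; exact ⟨γ.1, γ.2, h⟩
  · rintro ⟨γ, h, e⟩; exact ⟨⟨γ, h⟩, e⟩

theorem mk_polyGL_mem (γ : GL (Fin 3) K[X]) : ProjGenLinGroup.mk (polyGL K γ) ∈ Gam K := ⟨γ, rfl⟩

theorem QVertex_mk_polyGL (γ : GL (Fin 3) K[X]) (g : GL (Fin 3) K⸨X⸩) :
    QVertex.mk (vertexOf (polyGL K γ * g)) = QVertex.mk (vertexOf g) :=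
  QVertex_mk_eq_iff.2 ⟨_, mk_polyGL_mem γ, mk_smul_vertexOf _ _⟩

/-- The orbit of the vertex given by the diagonal matrix with entries `X ^ a, X ^ b, X ^ c`. -/
def diagOrbit (K : Type*) [Field K] (a b c : ℤ) : QVertex K := QVertex.mk (vertexOf (ut a b c 0 0 0))

theorem diagOrbit_add (a b c n : ℤ) :
    diagOrbit K (a + n) (b + n) (c + n) = diagOrbit K a b c := by
  have := vertexOf_ut_add (K := K) a b c 0 0 0 n
  simp only [mul_zero] at this
  rw [diagOrbit, this, diagOrbit]

theorem diagOrbit_swapFirst (a b c : ℤ) : diagOrbit K b a c = diagOrbit K a b c := by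
  have e : polyGL K (swapFirst K[X]) * ut a b c 0 0 0 = ut b a c 0 0 0 * swapFirst K⸨X⸩ := by
    rw [polyGL_swapFirst]
    apply Units.ext
    rw [Units.val_mul, Units.val_mul, ut_val, ut_val]
    ext1 i j
    fin_cases i <;> fin_cases j <;> simp [Matrix.mul_apply, Fin.sum_univ_three, swapFirst]
  rw [diagOrbit, diagOrbit, ← QVertex_mk_polyGL (swapFirst K[X]) (ut a b c 0 0 0), e,
    vertexOf_mul_intGL _ swapFirst_mem_intGL]

theorem diagOrbit_swapLast (a b c : ℤ) : diagOrbit K a c b = diagOrbit K a b c := by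
  have e : polyGL K (swapLast K[X]) * ut a b c 0 0 0 = ut a c b 0 0 0 * swapLast K⸨X⸩ := by
    rw [polyGL_swapLast]
    apply Units.ext
    rw [Units.val_mul, Units.val_mul, ut_val, ut_val]
    ext1 i j
    fin_cases i <;> fin_cases j <;> simp [Matrix.mul_apply, Fin.sum_univ_three, swapLast]
  rw [diagOrbit, diagOrbit, ← QVertex_mk_polyGL (swapLast K[X]) (ut a b c 0 0 0), e,
    vertexOf_mul_intGL _ swapLast_mem_intGL]

theorem exists_sorted_diagOrbit (a b c : ℤ) :
    ∃ i j : ℕ, diagOrbit K a b c = diagOrbit K 0 i (i + j) := by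
  have H : ∀ a b c : ℤ, a ≤ b → b ≤ c →
      ∃ i j : ℕ, diagOrbit K a b c = diagOrbit K 0 i (i + j) := by
    intro a b c hab hbc
    refine ⟨(b - a).toNat, (c - b).toNat, ?_⟩
    rw [← diagOrbit_add a b c (-a)]
    congr 1 <;> omega
  rcases le_total a b with h1 | h1 <;> rcases le_total b c with h2 | h2 <;>
    rcases le_total a c with h3 | h3
  · exact H _ _ _ h1 h2
  · exact H _ _ _ h1 h2
  · rw [← diagOrbit_swapLast]; exact H _ _ _ h3 h2
  · rw [← diagOrbit_swapLast, ← diagOrbit_swapFirst]; exact H _ _ _ h3 h1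
  · rw [← diagOrbit_swapFirst]; exact H _ _ _ h1 h3
  · rw [← diagOrbit_swapFirst, ← diagOrbit_swapLast]; exact H _ _ _ h2 h3
  · rw [← diagOrbit_swapFirst, ← diagOrbit_swapLast, ← diagOrbit_swapFirst]; exact H _ _ _ h2 h1
  · rw [← diagOrbit_swapFirst, ← diagOrbit_swapLast, ← diagOrbit_swapFirst]; exact H _ _ _ h2 h1

section Neighbors

variable {a b c : ℤ}

theorem unif_sub_mul_C {m n : ℤ} (h : m ≤ n) (x : K) :
    unif K (m - n) * 𝐜 x = polyToLaurent K (Polynomial.monomial (n - m).toNat x) := by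
  rw [polyToLaurent_monomial]
  congr 2; omega

/-- Unipotent representatives of neighbors of a sorted diagonal vertex can be absorbed into `Γ`. -/
theorem QVertex_mk_ut_mul (hab : a ≤ b) (hbc : b ≤ c) (a' b' c' : ℤ) {x y z : K}
    {u v w : K⸨X⸩} (hu : u = 𝐜 x * unif K b') (hv : v = 𝐜 y * unif K c')
    (hw : w = 𝐜 z * unif K c') :
    QVertex.mk (vertexOf (ut a b c 0 0 0 * ut a' b' c' u v w))
      = diagOrbit K (a + a') (b + b') (c + c') := by
  have e : ut a b c 0 0 0 * ut a' b' c' u v w = polyGL K (upperUnip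
      (Polynomial.monomial (b - a).toNat x) (Polynomial.monomial (c - a).toNat y)
      (Polynomial.monomial (c - b).toNat z)) * ut (a + a') (b + b') (c + c') 0 0 0 := by
    rw [polyGL_upperUnip, ← unif_sub_mul_C hab, ← unif_sub_mul_C (hab.trans hbc),
      ← unif_sub_mul_C hbc, ut_mul, ut_mul, hu, hv, hw]
    have e1 : unif K (a - b) * unif K b = unif K a := by rw [← unif_add]; congr 1; ring
    have e2 : unif K (a - c) * unif K c = unif K a := by rw [← unif_add]; congr 1; ring
    have e3 : unif K (b - c) * unif K c = unif K b := by rw [← unif_add]; congr 1; ring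
    congr 1
    any_goals ring1
    · rw [unif_add, ← e1]; ring
    · rw [unif_add, ← e2]; ring
    · rw [unif_add, ← e3]; ring
  rw [e, QVertex_mk_polyGL, diagOrbit]

end Neighbors

/-- The building is connected: the Hermite normal form of an integral matrix gives a path of
`1`-colored edges to the standard vertex. -/
theorem vertex_induction [Finite K] {P : Vertex K → Prop} (h1 : P (vertexOf 1))
    (hstep : ∀ x y, P x → ColoredAdj 1 x y → P y) (x : Vertex K) : P x := by
  have key : ∀ n : ℕ, ∀ (g : GL (Fin 3) K⸨X⸩) (a b c : ℤ) (u v w : K⸨X⸩), P (vertexOf g) →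
      0 ≤ a → 0 ≤ b → 0 ≤ c → u ∈ intRing K → v ∈ intRing K → w ∈ intRing K →
      a + b + c = n → P (vertexOf (g * ut a b c u v w)) := by
    intro n
    induction n with
    | zero =>
      intro g a b c u v w hg ha hb hc hu hv hw hn
      obtain rfl : a = 0 := by push_cast at hn; omega
      obtain rfl : b = 0 := by push_cast at hn; omega
      obtain rfl : c = 0 := by push_cast at hn; omega
      rwa [vertexOf_mul_intGL _ (ut_mem_intGL hu hv hw)]
    | succ n ih =>
      intro g a b c u v w hg ha hb hc hu hv hw hn
      push_cast at hn
      by_cases hc1 : 1 ≤ c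
      · have hstep' := hstep _ _ hg (coloredAdj_one_iff.2 (Or.inr (Or.inr rfl)))
        have := ih _ a b (c - 1) u v w hstep' ha hb (by omega) hu hv hw (by omega)
        rw [mul_assoc, ut_mul] at this
        simpa using this
      obtain rfl : c = 0 := by omega
      obtain ⟨w0, w', hw', ew⟩ := exists_const_add hw
      by_cases hb1 : 1 ≤ b
      · have hstep' := hstep _ _ hg (coloredAdj_one_iff.2 (Or.inr (Or.inl ⟨w0, rfl⟩)))
        have := ih _ a (b - 1) 0 u v w' hstep' ha (by omega) le_rfl hu hv hw' (by omega)
        rw [mul_assoc, ut_mul] at this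
        convert this using 3
        congr 1 <;> first | (simp; done) | skip
        rw [ew]; simp [add_comm]
      obtain rfl : b = 0 := by omega
      obtain ⟨u0, u', hu', eu⟩ := exists_const_add hu
      obtain ⟨v0, v', hv', ev⟩ := exists_const_add (sub_mem hv (mul_mem (C_mem_intRing u0) hw))
      have hstep' := hstep _ _ hg (coloredAdj_one_iff.2 (Or.inl ⟨(u0, v0), rfl⟩))
      have := ih _ (a - 1) 0 0 u' v' w hstep' (by omega) le_rfl le_rfl hu' hv' hw (by omega)
      rw [mul_assoc, ut_mul] at this
      convert this using 3
      congr 1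
      any_goals ring1
      · rw [eu, unif_zero]; ring
      · rw [unif_zero]; linear_combination ev
      · rw [unif_zero]; ring
  obtain ⟨a, b, c, u, v, w, rfl⟩ := exists_vertexOf_ut x
  have hbig : ∀ y : K⸨X⸩, ∀ n : ℤ, -y.order ≤ n → unif K n * y ∈ intRing K := by
    intro y n hn
    by_cases hy : y = 0
    · simp [hy]
    · rw [mem_intRing_iff_order (mul_ne_zero (unif_ne_zero n) hy),
        HahnSeries.order_mul (unif_ne_zero n) hy, order_unif]
      omega
  -- A large homothety makes the representative integral.
  set n : ℤ := |a| + |b| + |c| + |u.order| + |v.order| + |w.order| with hn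
  have := abs_nonneg a
  have := abs_nonneg b
  have := abs_nonneg c
  have := abs_nonneg u.order
  have := abs_nonneg v.order
  have := abs_nonneg w.order
  have := neg_abs_le a
  have := neg_abs_le b
  have := neg_abs_le c
  have := neg_abs_le u.order
  have := neg_abs_le v.order
  have := neg_abs_le w.order
  have h := key (a + n + (b + n) + (c + n)).toNat 1 (a + n) (b + n) (c + n) _ _ _ h1 (by omega)
    (by omega) (by omega) (hbig u n (by omega)) (hbig v n (by omega)) (hbig w n (by omega))
    (by omega)
  rwa [one_mul, vertexOf_ut_add] at h

/-- Reduction theory for `Γ`: every orbit contains a diagonal vertex. As the building is connected,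
it suffices that every neighbor of a sorted diagonal vertex is equivalent to a diagonal vertex. -/
theorem exists_eq_diagOrbit [Finite K] (U : QVertex K) :
    ∃ i j : ℕ, U = diagOrbit K 0 i (i + j) := by
  obtain ⟨x, rfl⟩ : ∃ x, QVertex.mk x = U := Quotient.exists_rep U
  refine vertex_induction (P := fun x => ∃ i j : ℕ, QVertex.mk x = diagOrbit K 0 i (i + j))
    ⟨0, 0, ?_⟩ ?_ x
  · rw [← ut_one]; simp [diagOrbit]
  · rintro x y ⟨i, j, hx⟩ hxy
    obtain ⟨γ, hγ, rfl⟩ := QVertex_mk_eq_iff.1 hx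
    have hy : QVertex.mk y = QVertex.mk (γ⁻¹ • y) :=
      QVertex_mk_eq_iff.2 ⟨γ, hγ, by simp⟩
    have hxy' : ColoredAdj 1 (vertexOf (ut 0 i (i + j) 0 0 0)) (γ⁻¹ • y) := by
      rw [← coloredAdj_smul_iff γ⁻¹] at hxy
      simpa using hxy
    rw [hy]
    have h1 : (0 : ℤ) ≤ i := by positivity
    have h2 : (i : ℤ) ≤ i + j := by omega
    rcases coloredAdj_one_iff.1 hxy' with ⟨p, h⟩ | ⟨s, h⟩ | h
    · rw [← h, QVertex_mk_ut_mul (x := p.1) (y := p.2) (z := 0) h1 h2 _ _ _ (by simp) (by simp)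
        (by simp)]
      exact exists_sorted_diagOrbit _ _ _
    · rw [← h, QVertex_mk_ut_mul (x := 0) (y := 0) (z := s) h1 h2 _ _ _ (by simp) (by simp)
        (by simp)]
      exact exists_sorted_diagOrbit _ _ _
    · rw [← h, QVertex_mk_ut_mul (x := 0) (y := 0) (z := 0) h1 h2 _ _ _ (by simp) (by simp)
        (by simp)]
      exact exists_sorted_diagOrbit _ _ _

end

/-! ### Uniqueness of the diagonal representatives, and their stabilizers -/

section

variable {K : Type*} [Field K]

theorem ut_diag_apply (d : Fin 3 → ℤ) (i j : Fin 3) :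
    (ut (d 0) (d 1) (d 2) 0 0 0 : GL (Fin 3) K⸨X⸩).1 i j = if i = j then unif K (d i) else 0 := by
  rw [ut_val]
  fin_cases i <;> fin_cases j <;> simp

theorem mul_ut_diag_apply (m : Matrix (Fin 3) (Fin 3) K⸨X⸩) (d : Fin 3 → ℤ) (i j : Fin 3) :
    (m * (ut (d 0) (d 1) (d 2) 0 0 0 : GL (Fin 3) K⸨X⸩).1) i j = m i j * unif K (d j) := by
  simp [Matrix.mul_apply, ut_diag_apply]

theorem ut_diag_mul_apply (m : Matrix (Fin 3) (Fin 3) K⸨X⸩) (d : Fin 3 → ℤ) (i j : Fin 3) :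
    ((ut (d 0) (d 1) (d 2) 0 0 0 : GL (Fin 3) K⸨X⸩).1 * m) i j = unif K (d i) * m i j := by
  simp [Matrix.mul_apply, ut_diag_apply]

theorem ordDet_polyGL_le (γ : GL (Fin 3) K[X]) : ordDet K (polyGL K γ) ≤ 0 := by
  have h : (polyGL K γ).1.det = polyToLaurent K γ.1.det := (RingHom.map_det _ _).symm
  by_contra! hlt
  have h0 := HahnSeries.coeff_order_eq_zero.not.2 (det_ne_zero' (polyGL K γ))
  refine h0 ?_
  have := polyToLaurent_coeff_pos γ.1.det hlt
  rwa [← h] at this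

theorem ordDet_polyGL (γ : GL (Fin 3) K[X]) : ordDet K (polyGL K γ) = 0 := by
  have h1 := ordDet_polyGL_le γ
  have h2 := ordDet_polyGL_le γ⁻¹
  rw [map_inv, ordDet_inv] at h2
  omega

/-- A polynomial matrix carrying one diagonal vertex to another has entries of bounded degree. -/
theorem coeff_eq_zero_of_vertexOf_eq {γ : GL (Fin 3) K[X]} {d d' : Fin 3 → ℤ}
    (h : vertexOf (polyGL K γ * ut (d 0) (d 1) (d 2) 0 0 0)
      = vertexOf (ut (d' 0) (d' 1) (d' 2) 0 0 0)) :
    ∃ n : ℤ, d 0 + d 1 + d 2 = d' 0 + d' 1 + d' 2 + 3 * n ∧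
      ∀ i j, ∀ m : ℕ, d j - d' i - n < m → (γ.1 i j).coeff m = 0 := by
  obtain ⟨k, hk, z, e⟩ := vertexOf_eq_iff.1 h.symm
  refine ⟨z.1.order, ?_, fun i j => ?_⟩
  · have := congrArg (ordDet K) e
    rw [ordDet_mul, ordDet_mul, ordDet_mul, ordDet_polyGL, ordDet_ut, ordDet_ut,
      ordDet_of_mem_intGL hk, ordDet_scalar] at this
    omega
  · rw [← unif_mul_polyToLaurent_mem]
    have e1 : polyToLaurent K (γ.1 i j) * unif K (d j) = unif K (d' i) * k.1 i j * z.1 := by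
      have := congrArg (fun g : GL (Fin 3) K⸨X⸩ => g.1 i j) e
      simp only [mul_scalar_apply] at this
      rw [Units.val_mul, Units.val_mul, mul_ut_diag_apply, ut_diag_mul_apply] at this
      exact this
    obtain ⟨y, hy, -, -, hz⟩ := exists_unif_mul_unit z.ne_zero
    have e2 : unif K (d j - d' i - z.1.order) * polyToLaurent K (γ.1 i j) = k.1 i j * y := by
      have hu := unif_ne_zero (K := K) (d' i)
      have hu' := unif_ne_zero (K := K) z.1.order
      have e3 : unif K (d j) = unif K (d j - d' i - z.1.order) * unif K (d' i)
          * unif K z.1.order := by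
        rw [← unif_add, ← unif_add]; congr 1; ring
      have e4 : unif K (d' i) * unif K z.1.order
          * (unif K (d j - d' i - z.1.order) * polyToLaurent K (γ.1 i j))
          = unif K (d' i) * unif K z.1.order * (k.1 i j * y) := by
        calc _ = polyToLaurent K (γ.1 i j) * unif K (d j) := by rw [e3]; ring
          _ = unif K (d' i) * k.1 i j * z.1 := e1
          _ = unif K (d' i) * k.1 i j * (unif K z.1.order * y) := by rw [← hz]
          _ = _ := by ring
      exact mul_left_cancel₀ (mul_ne_zero hu hu') e4
    rw [e2]
    exact mul_mem ((mem_intGL_iff.1 hk).1 i j) hy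

/-- A determinant vanishes if each of its six products contains an entry that is forced to vanish
by a degree condition; hence sorted exponents are determined up to a common shift. -/
theorem exponents_unique {M : Matrix (Fin 3) (Fin 3) K[X]} (hdet : M.det ≠ 0)
    {i j i' j' n : ℤ} (hi : 0 ≤ i) (hj : 0 ≤ j)
    (hi' : 0 ≤ i') (hj' : 0 ≤ j') (hn : i + (i + j) = i' + (i' + j') + 3 * n)
    (hz : ∀ k l, ![(0 : ℤ), i, i + j] l - ![(0 : ℤ), i', i' + j'] k - n < 0 → M k l = 0) :
    i = i' ∧ j = j' := by
  by_contra hne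
  have o1 : 0 - 0 - n < 0 ∨ i - i' - n < 0 ∨ i + j - (i' + j') - n < 0 := by omega
  have o2 : 0 - 0 - n < 0 ∨ i + j - i' - n < 0 ∨ i - (i' + j') - n < 0 := by omega
  have o3 : i - 0 - n < 0 ∨ 0 - i' - n < 0 ∨ i + j - (i' + j') - n < 0 := by omega
  have o4 : i - 0 - n < 0 ∨ i + j - i' - n < 0 ∨ 0 - (i' + j') - n < 0 := by omega
  have o5 : i + j - 0 - n < 0 ∨ 0 - i' - n < 0 ∨ i - (i' + j') - n < 0 := by omega
  have o6 : i + j - 0 - n < 0 ∨ i - i' - n < 0 ∨ 0 - (i' + j') - n < 0 := by omega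
  have h00 : 0 - 0 - n < 0 → M 0 0 = 0 := hz 0 0
  have h01 : i - 0 - n < 0 → M 0 1 = 0 := hz 0 1
  have h02 : i + j - 0 - n < 0 → M 0 2 = 0 := hz 0 2
  have h10 : 0 - i' - n < 0 → M 1 0 = 0 := hz 1 0
  have h11 : i - i' - n < 0 → M 1 1 = 0 := hz 1 1
  have h12 : i + j - i' - n < 0 → M 1 2 = 0 := hz 1 2
  have h20 : 0 - (i' + j') - n < 0 → M 2 0 = 0 := hz 2 0
  have h21 : i - (i' + j') - n < 0 → M 2 1 = 0 := hz 2 1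
  have h22 : i + j - (i' + j') - n < 0 → M 2 2 = 0 := hz 2 2
  clear hz
  have t : ∀ {A B C : ℤ} {x y z : K[X]}, (A < 0 → x = 0) → (B < 0 → y = 0) → (C < 0 → z = 0) →
      (A < 0 ∨ B < 0 ∨ C < 0) → x * y * z = 0 := by
    rintro A B C x y z hx hy hz' (h | h | h)
    · rw [hx h, zero_mul, zero_mul]
    · rw [hy h, mul_zero, zero_mul]
    · rw [hz' h, mul_zero]
  have t1 : M 0 0 * M 1 1 * M 2 2 = 0 := t h00 h11 h22 o1
  have t2 : M 0 0 * M 1 2 * M 2 1 = 0 := t h00 h12 h21 o2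
  have t3 : M 0 1 * M 1 0 * M 2 2 = 0 := t h01 h10 h22 o3
  have t4 : M 0 1 * M 1 2 * M 2 0 = 0 := t h01 h12 h20 o4
  have t5 : M 0 2 * M 1 0 * M 2 1 = 0 := t h02 h10 h21 o5
  have t6 : M 0 2 * M 1 1 * M 2 0 = 0 := t h02 h11 h20 o6
  refine hdet ?_
  rw [Matrix.det_fin_three, t1, t2, t3, t4, t5, t6]
  simp

/-- Sorted diagonal vertices with first exponent `0` lie in distinct orbits. -/
theorem diagOrbit_injective {i j i' j' : ℕ}
    (h : diagOrbit K 0 i (i + j) = diagOrbit K 0 i' (i' + j')) : i = i' ∧ j = j' := by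
  obtain ⟨δ, ⟨γ, rfl⟩, e⟩ := QVertex_mk_eq_iff.1 h.symm
  have e' : vertexOf (polyGL K γ * ut 0 i (i + j) 0 0 0) = vertexOf (ut 0 i' (i' + j') 0 0 0) :=
    (mk_smul_vertexOf _ _).symm.trans e
  obtain ⟨n, hn, hc⟩ := coeff_eq_zero_of_vertexOf_eq (d := ![0, i, i + j])
    (d' := ![0, i', i' + j']) e'
  have hz : ∀ k l, ![(0 : ℤ), i, i + j] l - ![(0 : ℤ), i', i' + j'] k - n < 0 →
      γ.1 k l = 0 := by
    intro k l hkl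
    ext m
    rw [hc k l m (by omega), Polynomial.coeff_zero]
  have hn' : (0 : ℤ) + i + (i + j) = 0 + i' + (i' + j') + 3 * n := hn
  have hdet : γ.1.det ≠ 0 := by
    intro h0
    have := Matrix.isUnits_det_units γ
    rw [h0] at this
    exact not_isUnit_zero this
  have := exponents_unique hdet (by positivity) (by positivity) (by positivity) (by positivity)
    (by omega) hz
  omega

section Stabilizer

variable [Finite K]

theorem card_degreeLT (n : ℕ) : Nat.card (Polynomial.degreeLT K n) = Nat.card K ^ n := by
  rw [Nat.card_congr (Polynomial.degreeLTEquiv K n).toEquiv, Nat.card_fun, Nat.card_fin]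

instance (n : ℕ) : Finite (Polynomial.degreeLT K n) :=
  Finite.of_equiv _ (Polynomial.degreeLTEquiv K n).toEquiv.symm

/-- The stabilizer of a diagonal vertex injects into the polynomial matrices with entries of
bounded degree. -/
theorem card_stabilizer_le (i j : ℕ) :
    Finite (MulAction.stabilizer (Gam K) (vertexOf (ut 0 i (i + j) 0 0 0) : Vertex K)) ∧
    Nat.card (MulAction.stabilizer (Gam K) (vertexOf (ut 0 i (i + j) 0 0 0) : Vertex K))
      ≤ Nat.card K ^ (2 * (i + j) + 9) := by
  set S := MulAction.stabilizer (Gam K) (vertexOf (ut 0 i (i + j) 0 0 0) : Vertex K) with hS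
  set d : Fin 3 → ℤ := ![0, i, i + j] with hd
  have hlift : ∀ s : S, ∃ γ : GL (Fin 3) K[X], ProjGenLinGroup.mk (polyGL K γ) = s.1.1 ∧
      ∀ k l, ∀ m : ℕ, d l - d k < m → (γ.1 k l).coeff m = 0 := by
    rintro ⟨⟨_, ⟨γ, rfl⟩⟩, hs⟩
    refine ⟨γ, rfl, ?_⟩
    have hs' : vertexOf (polyGL K γ * ut (d 0) (d 1) (d 2) 0 0 0)
        = vertexOf (ut (d 0) (d 1) (d 2) 0 0 0) := hs
    obtain ⟨n, hn, hc⟩ := coeff_eq_zero_of_vertexOf_eq hs'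
    obtain rfl : n = 0 := by omega
    simpa using hc
  choose γ hγ hc using hlift
  let N : Fin 3 × Fin 3 → ℕ := fun p => (d p.2 - d p.1 + 1).toNat
  let f : S → ∀ p : Fin 3 × Fin 3, Polynomial.degreeLT K (N p) := fun s p =>
    ⟨(γ s).1 p.1 p.2, by
      rw [Polynomial.mem_degreeLT, Polynomial.degree_lt_iff_coeff_zero]
      intro m hm
      exact hc s p.1 p.2 m (by simp only [N] at hm; omega)⟩
  have hf : Function.Injective f := by
    intro s s' h
    have : γ s = γ s' := by
      apply Units.ext
      ext1 k l
      exact congrArg (fun F => (F (k, l)).1) h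
    apply Subtype.ext
    apply Subtype.ext
    rw [← hγ s, this, hγ s']
  refine ⟨Finite.of_injective f hf, (Nat.card_le_card_of_injective f hf).trans ?_⟩
  rw [Nat.card_pi]
  simp only [card_degreeLT]
  rw [Finset.prod_pow_eq_pow_sum]
  refine Nat.pow_le_pow_right Nat.card_pos ?_
  rw [Fintype.sum_prod_type]
  simp only [Fin.sum_univ_three, N, hd, Matrix.cons_val]
  omega

/-- The unipotent polynomial matrices of bounded degree stabilize a sorted diagonal vertex. -/
theorem le_card_stabilizer (i j : ℕ) : Nat.card K ^ (2 * (i + j)) ≤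
    Nat.card (MulAction.stabilizer (Gam K) (vertexOf (ut 0 i (i + j) 0 0 0) : Vertex K)) := by
  have := (card_stabilizer_le (K := K) i j).1
  set S := MulAction.stabilizer (Gam K) (vertexOf (ut 0 i (i + j) 0 0 0) : Vertex K) with hS
  let T := Polynomial.degreeLT K i × Polynomial.degreeLT K (i + j) × Polynomial.degreeLT K j
  have hmem : ∀ {n : ℕ} (p : Polynomial.degreeLT K n),
      unif K n * polyToLaurent K p.1 ∈ intRing K := by
    intro n p
    rw [unif_mul_polyToLaurent_mem]
    intro m hm
    have := p.2
    rw [Polynomial.mem_degreeLT, Polynomial.degree_lt_iff_coeff_zero] at this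
    exact this m (by omega)
  have hstab : ∀ p : T, vertexOf (polyGL K (upperUnip p.1.1 p.2.1.1 p.2.2.1)
      * ut 0 i (i + j) 0 0 0) = (vertexOf (ut 0 i (i + j) 0 0 0) : Vertex K) := by
    intro p
    have hv := hmem p.2.1
    push_cast at hv
    have e : polyGL K (upperUnip p.1.1 p.2.1.1 p.2.2.1) * ut 0 i (i + j) 0 0 0
        = ut 0 i (i + j) 0 0 0 * ut 0 0 0 (unif K i * polyToLaurent K p.1.1)
          (unif K (i + j) * polyToLaurent K p.2.1.1) (unif K j * polyToLaurent K p.2.2.1) := by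
      rw [polyGL_upperUnip, ut_mul, ut_mul]
      congr 1
      all_goals try simp only [unif_add, unif_zero]
      all_goals ring
    rw [e, vertexOf_mul_intGL _ (ut_mem_intGL (hmem p.1) hv (hmem p.2.2))]
  let f : T → S := fun p =>
    ⟨⟨ProjGenLinGroup.mk (polyGL K (upperUnip p.1.1 p.2.1.1 p.2.2.1)), mk_polyGL_mem _⟩, hstab p⟩
  have hf : Function.Injective f := by
    intro p p' h
    have h' : ProjGenLinGroup.mk (polyGL K (upperUnip p.1.1 p.2.1.1 p.2.2.1))
        = ProjGenLinGroup.mk (polyGL K (upperUnip p'.1.1 p'.2.1.1 p'.2.2.1)) :=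
      congrArg (fun s : S => s.1.1) h
    obtain ⟨z, hz⟩ := ProjGenLinGroup.mk_eq_mk_iff.1 h'
    rw [polyGL_upperUnip, polyGL_upperUnip] at hz
    have hent := fun k l => congrArg (fun g : GL (Fin 3) K⸨X⸩ => g.1 k l) hz
    simp only [mul_scalar_apply] at hent
    have h00 := hent 0 0
    have h01 := hent 0 1
    have h02 := hent 0 2
    have h12 := hent 1 2
    simp only [ut_val, Matrix.of_apply, Matrix.cons_val, unif_zero, one_mul] at h00 h01 h02 h12
    rw [h00, mul_one] at h01 h02 h12
    refine Prod.ext (Subtype.ext (polyToLaurent_injective h01))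
      (Prod.ext (Subtype.ext (polyToLaurent_injective h02))
        (Subtype.ext (polyToLaurent_injective h12)))
  refine le_trans (le_of_eq ?_) (Nat.card_le_card_of_injective f hf)
  simp only [T, Nat.card_prod, card_degreeLT]
  ring

end Stabilizer

end

/-! ### The weighted adjacency operator in coordinates -/

section

variable {K : Type*} [Field K]

local notation "𝐜" => (HahnSeries.C : K →+* K⸨X⸩)

/-- Orbit-stabilizer for the second entry of a pair, under the stabilizer of the first. -/
theorem ncard_pair_orbit {H V : Type*} [Group H] [MulAction H V] (x y : V)
    [Finite (MulAction.stabilizer H x)] :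
    {z | (x, z) ∈ MulAction.orbit H (x, y)}.ncard * Nat.card (MulAction.stabilizer H (x, y))
      = Nat.card (MulAction.stabilizer H x) := by
  set S := MulAction.stabilizer H x with hS
  have h1 : {z | (x, z) ∈ MulAction.orbit H (x, y)} = MulAction.orbit S y := by
    ext z
    constructor
    · rintro ⟨γ, h⟩
      obtain ⟨h1, h2⟩ := Prod.mk.inj h
      exact ⟨⟨γ, h1⟩, h2⟩
    · rintro ⟨⟨γ, hγ⟩, h⟩
      exact ⟨γ, Prod.ext hγ h⟩
  have h2 : Nat.card (MulAction.stabilizer H (x, y)) = Nat.card (MulAction.stabilizer S y) := by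
    refine Nat.card_congr ⟨fun γ => ⟨⟨γ.1, (Prod.mk.inj γ.2).1⟩, (Prod.mk.inj γ.2).2⟩,
      fun γ => ⟨γ.1.1, Prod.ext γ.1.2 γ.2⟩, fun _ => rfl, fun _ => rfl⟩
  rw [h1, h2, ← Nat.card_coe_set_eq, Nat.card_congr (MulAction.orbitEquivQuotientStabilizer S y)]
  exact (Subgroup.card_eq_card_quotient_mul_card_subgroup _).symm

theorem QPair_mk_eq_iff {p r : Vertex K × Vertex K} :
    QPair.mk p = QPair.mk r ↔ p ∈ MulAction.orbit (Gam K) r :=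
  Quotient.eq'' (s₁ := MulAction.orbitRel (Gam K) (Vertex K × Vertex K))

theorem QVertex_mk_out (u : QVertex K) : QVertex.mk (Quotient.out u : Vertex K) = u :=
  Quotient.out_eq u

theorem card_stabilizer_congr {H V : Type*} [Group H] [MulAction H V] {x y : V}
    (h : x ∈ MulAction.orbit H y) :
    Nat.card (MulAction.stabilizer H x) = Nat.card (MulAction.stabilizer H y) :=
  Nat.card_congr (MulAction.stabilizerEquivStabilizerOfOrbitRel h).toEquiv

theorem vertexWeight_mk (x : Vertex K) : vertexWeight (QVertex.mk x)
    = weightConst K / Nat.card (MulAction.stabilizer (Gam K) x) := by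
  have h : (Quotient.out (QVertex.mk x) : Vertex K) ∈ MulAction.orbit (Gam K) x :=
    (Quotient.eq'' (s₁ := MulAction.orbitRel (Gam K) (Vertex K))).1 (QVertex_mk_out _)
  rw [vertexWeight, card_stabilizer_congr h]

theorem edgeWeight_mk (p : Vertex K × Vertex K) : edgeWeight (QPair.mk p)
    = weightConst K / Nat.card (MulAction.stabilizer (Gam K) p) := by
  have h : (Quotient.out (QPair.mk p) : Vertex K × Vertex K) ∈ MulAction.orbit (Gam K) p :=
    QPair_mk_eq_iff.1 (Quotient.out_eq (QPair.mk p))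
  rw [edgeWeight, card_stabilizer_congr h]

section

variable [Finite K]

theorem one_lt_card : 1 < Nat.card K := Finite.one_lt_card

theorem weightConst_pos : 0 < weightConst K := by
  have h : (1 : ℝ) < Nat.card K := by exact_mod_cast one_lt_card
  rw [weightConst]
  have : 0 < (Nat.card K : ℝ) - 1 := by linarith
  positivity

theorem finite_stabilizer (x : Vertex K) : Finite (MulAction.stabilizer (Gam K) x) := by
  obtain ⟨i, j, h⟩ := exists_eq_diagOrbit (QVertex.mk x)
  have h' : x ∈ MulAction.orbit (Gam K) (vertexOf (ut 0 i (i + j) 0 0 0)) :=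
    (Quotient.eq'' (s₁ := MulAction.orbitRel (Gam K) (Vertex K))).1 h
  have := (card_stabilizer_le (K := K) i j).1
  exact Finite.of_equiv _ (MulAction.stabilizerEquivStabilizerOfOrbitRel h').symm.toEquiv

/-- The quotient of the weights counts the neighbors of `x` in the orbit of the edge. -/
theorem edgeWeight_div_vertexWeight (x y : Vertex K) :
    edgeWeight (QPair.mk (x, y)) / vertexWeight (QVertex.mk x)
      = {z | QPair.mk (x, z) = QPair.mk (x, y)}.ncard := by
  have := finite_stabilizer x
  have hS : Nat.card (MulAction.stabilizer (Gam K) x) ≠ 0 := Nat.card_pos.ne'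
  have h : {z | (x, z) ∈ MulAction.orbit (Gam K) (x, y)}.ncard
      * Nat.card (MulAction.stabilizer (Gam K) (x, y))
        = Nat.card (MulAction.stabilizer (Gam K) x) := ncard_pair_orbit x y
  have hP : Nat.card (MulAction.stabilizer (Gam K) (x, y)) ≠ 0 := by
    intro h0; rw [h0, mul_zero] at h; exact hS h.symm
  have hw := (weightConst_pos (K := K)).ne'
  have hset : {z | QPair.mk (x, z) = QPair.mk (x, y)}
      = {z | (x, z) ∈ MulAction.orbit (Gam K) (x, y)} := by
    ext z; exact QPair_mk_eq_iff
  rw [hset, edgeWeight_mk, vertexWeight_mk, ← h]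
  have hS' : ((Nat.card (MulAction.stabilizer (Gam K) x) : ℕ) : ℝ) ≠ 0 := by exact_mod_cast hS
  have hP' : ((Nat.card (MulAction.stabilizer (Gam K) (x, y)) : ℕ) : ℝ) ≠ 0 := by exact_mod_cast hP
  push_cast
  have hn : (({z | (x, z) ∈ MulAction.orbit (Gam K) (x, y)}.ncard : ℕ) : ℝ) ≠ 0 := by
    intro h0
    apply hS'
    rw [← h]; push_cast; rw [h0, zero_mul]
  field_simp

/-- The weighted adjacency operator is induced by the adjacency operator of the building. -/
theorem weightedAdjacency_mk (f : QVertex K → ℂ) (x : Vertex K) :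
    weightedAdjacency 1 f (QVertex.mk x) = coloredAdjacency 1 (fun y => f (QVertex.mk y)) x := by
  classical
  have := Fintype.ofFinite K
  have hN : {y | ColoredAdj 1 x y}.Finite := bddRel_coloredAdj_one.out_fin x
  have hE : {e : QPair K | e.IsEdge 1 ∧ e.origin = QVertex.mk x}
      = (hN.toFinset.image fun y => QPair.mk (x, y) : Finset (QPair K)) := by
    ext e
    simp only [Finset.coe_image, Set.Finite.coe_toFinset, Set.mem_image]
    constructor
    · rintro ⟨⟨x', y', rfl, hadj⟩, ho⟩
      obtain ⟨γ, hγ, rfl⟩ := QVertex_mk_eq_iff.1 (show QVertex.mk x' = QVertex.mk x from ho)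
      refine ⟨γ⁻¹ • y', ?_, QPair_mk_eq_iff.2 ⟨⟨γ, hγ⟩⁻¹, ?_⟩⟩
      · have := (coloredAdj_smul_iff γ⁻¹).2 hadj
        rwa [inv_smul_smul] at this
      · exact Prod.ext (inv_smul_smul γ x) rfl
    · rintro ⟨y, hy, rfl⟩
      exact ⟨⟨x, y, rfl, hy⟩, rfl⟩
  rw [weightedAdjacency, hE, finsum_mem_coe_finset, coloredAdjacency,
    finsum_mem_eq_finite_toFinset_sum _ hN, ← Finset.sum_fiberwise_of_maps_to
      (g := fun y => QPair.mk (x, y)) (t := hN.toFinset.image fun y => QPair.mk (x, y))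
      fun y hy => Finset.mem_image_of_mem _ hy]
  refine Finset.sum_congr rfl fun e he => ?_
  obtain ⟨y, hy, rfl⟩ := Finset.mem_image.1 he
  have hfib : ((hN.toFinset.filter fun z => QPair.mk (x, z) = QPair.mk (x, y) : Finset _) : Set _)
      = {z | QPair.mk (x, z) = QPair.mk (x, y)} := by
    ext z
    simp only [Finset.coe_filter, Set.Finite.mem_toFinset]
    refine ⟨fun h => h.2, fun h => ⟨?_, h⟩⟩
    obtain ⟨γ, hγ⟩ := QPair_mk_eq_iff.1 h
    obtain ⟨h1, h2⟩ := Prod.mk.inj hγ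
    have h3 : ColoredAdj 1 x y := hN.mem_toFinset.1 hy
    have h4 := (coloredAdj_smul_iff γ.1).2 h3
    have h1' : γ.1 • x = x := h1
    have h2' : γ.1 • y = z := h2
    rw [h1', h2'] at h4
    exact h4
  rw [Finset.sum_congr rfl (g := fun _ => f (QVertex.mk y)), Finset.sum_const, nsmul_eq_mul,
    edgeWeight_div_vertexWeight, ← hfib, Set.ncard_coe_finset]
  · simp only [Complex.ofReal_natCast]; rfl
  · intro z hz
    have := congrArg QPair.terminus (Finset.mem_filter.1 hz).2
    exact congrArg f this

theorem coloredAdjacency_one_isUT [Fintype K] {g : GL (Fin 3) K⸨X⸩} (hg : IsUT g)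
    (F : Vertex K → ℂ) : coloredAdjacency 1 F (vertexOf g)
      = ∑ p : K × K, F (vertexOf (g * ut 1 0 0 (𝐜 p.1) (𝐜 p.2) 0))
        + (∑ s : K, F (vertexOf (g * ut 0 1 0 0 0 (𝐜 s))) + F (vertexOf (g * ut 0 0 1 0 0 0))) := by
  have h1 := bddRel_one.out_fin (vertexOf g)
  have h2 := bddRel_two.out_fin (vertexOf g)
  have h3 := bddRel_three.out_fin (vertexOf g)
  rw [coloredAdjacency, setOf_coloredAdj_one, finsum_mem_union ?_ h1 (h2.union h3),
    finsum_mem_union ?_ h2 h3, setOf_stepRel_one hg, setOf_stepRel_two hg,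
    setOf_stepRel_three hg, finsum_mem_range (injective_step_one g),
    finsum_mem_range (injective_step_two g), finsum_mem_singleton, finsum_eq_sum_of_fintype,
    finsum_eq_sum_of_fintype]
  · refine Set.disjoint_left.2 fun y hy hy' => ?_
    have := hy.2.symm.trans hy'.2
    simp at this
  · refine Set.disjoint_left.2 fun y hy hy' => ?_
    rcases hy' with hy' | hy' <;>
    · have := hy.2.symm.trans hy'.2
      simp at this

/-- The neighbors of a sorted diagonal vertex fall into three orbits, with `q²`, `q` and `1`
neighbors. -/
theorem weightedAdjacency_diagOrbit (f : QVertex K → ℂ) {a b c : ℤ} (hab : a ≤ b) (hbc : b ≤ c) :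
    weightedAdjacency 1 f (diagOrbit K a b c) = (Nat.card K : ℂ) ^ 2 * f (diagOrbit K (a + 1) b c)
      + Nat.card K * f (diagOrbit K a (b + 1) c) + f (diagOrbit K a b (c + 1)) := by
  have := Fintype.ofFinite K
  have h1 : ∀ p : K × K, QVertex.mk (vertexOf (ut a b c 0 0 0 * ut 1 0 0 (𝐜 p.1) (𝐜 p.2) 0))
      = diagOrbit K (a + 1) b c := fun p => by
    rw [QVertex_mk_ut_mul (x := p.1) (y := p.2) (z := 0) hab hbc _ _ _ (by simp) (by simp)
      (by simp), add_zero, add_zero]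
  have h2 : ∀ s : K, QVertex.mk (vertexOf (ut a b c 0 0 0 * ut 0 1 0 0 0 (𝐜 s)))
      = diagOrbit K a (b + 1) c := fun s => by
    rw [QVertex_mk_ut_mul (x := 0) (y := 0) (z := s) hab hbc _ _ _ (by simp) (by simp)
      (by simp), add_zero, add_zero]
  have h3 : QVertex.mk (vertexOf (ut a b c 0 0 0 * ut 0 0 1 0 0 0) : Vertex K)
      = diagOrbit K a b (c + 1) := by
    rw [QVertex_mk_ut_mul (x := 0) (y := 0) (z := 0) hab hbc _ _ _ (by simp) (by simp)
      (by simp), add_zero, add_zero]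
  rw [diagOrbit, weightedAdjacency_mk, coloredAdjacency_one_isUT ⟨_, _, _, _, _, _, rfl⟩]
  simp only [h1, h2, h3, Finset.sum_const, Finset.card_univ, nsmul_eq_mul, Fintype.card_prod,
    Nat.card_eq_fintype_card]
  push_cast
  ring

/-! The fundamental domain of `Γ` is the cone `ℕ²`, and the three parts of the operator move a
point of the cone along `-e₁`, `-e₂`, `-e₃`, with reflection at the walls. -/

variable (K) in
/-- The orbit with coordinates `(i, j)`. -/
def coneOrbit (p : ℕ × ℕ) : QVertex K := diagOrbit K 0 p.1 (p.1 + p.2)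

variable (K) in
theorem coneOrbit_bijective : Function.Bijective (coneOrbit K) := by
  refine ⟨fun p p' h => ?_, fun u => ?_⟩
  · obtain ⟨h1, h2⟩ := diagOrbit_injective h
    exact Prod.ext h1 h2
  · obtain ⟨i, j, h⟩ := exists_eq_diagOrbit u
    exact ⟨(i, j), h.symm⟩

end

/-- The first transition on the cone. -/
def coneStepOne : ℕ × ℕ → ℕ × ℕ
  | (i + 1, j) => (i, j)
  | (0, j + 1) => (1, j)
  | (0, 0) => (0, 1)

/-- The second transition on the cone. -/
def coneStepTwo : ℕ × ℕ → ℕ × ℕ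
  | (i, j + 1) => (i + 1, j)
  | (i, 0) => (i, 1)

/-- The third transition on the cone. -/
def coneStepThree (p : ℕ × ℕ) : ℕ × ℕ := (p.1, p.2 + 1)

theorem weightedAdjacency_coneOrbit [Finite K] (f : QVertex K → ℂ) (p : ℕ × ℕ) :
    weightedAdjacency 1 f (coneOrbit K p) = (Nat.card K : ℂ) ^ 2 * f (coneOrbit K (coneStepOne p))
      + Nat.card K * f (coneOrbit K (coneStepTwo p)) + f (coneOrbit K (coneStepThree p)) := by
  obtain ⟨i, j⟩ := p
  rw [coneOrbit, weightedAdjacency_diagOrbit f (by positivity) (by simp)]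
  have h1 : diagOrbit K (0 + 1) i (i + j) = coneOrbit K (coneStepOne (i, j)) := by
    rcases i with _ | i
    · rcases j with _ | j
      · rw [coneStepOne, coneOrbit, ← diagOrbit_swapFirst, ← diagOrbit_swapLast]
        simp
      · rw [coneStepOne, coneOrbit, ← diagOrbit_swapFirst]
        congr 1; push_cast; ring
    · rw [coneStepOne, coneOrbit, ← diagOrbit_add 0 i (i + j) 1]
      congr 1; push_cast; ring
  have h2 : diagOrbit K 0 (i + 1) (i + j) = coneOrbit K (coneStepTwo (i, j)) := by
    rcases j with _ | j
    · rw [coneStepTwo, coneOrbit, ← diagOrbit_swapLast]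
      simp
    · rw [coneStepTwo, coneOrbit]
      congr 1; push_cast; ring
  have h3 : diagOrbit K 0 i (i + j + 1) = coneOrbit K (coneStepThree (i, j)) := by
    rw [coneStepThree, coneOrbit]
    congr 1
  rw [h1, h2, h3]

end

/-! ### The bounded operator on `L²` of the quotient -/

section

variable {K : Type*} [Field K]

open scoped ENNReal NNReal

section

variable [Finite K]

theorem vertexWeight_pos (u : QVertex K) : 0 < vertexWeight u := by
  have := finite_stabilizer (Quotient.out u : Vertex K)
  exact div_pos weightConst_pos (by exact_mod_cast Nat.card_pos)

/-- Every orbit has positive mass, so that almost everywhere means everywhere. -/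
theorem forall_of_ae_weightMeasure {P : QVertex K → Prop} (h : ∀ᵐ u ∂weightMeasure K, P u)
    (u : QVertex K) : P u := by
  by_contra hu
  have h0 : weightMeasure K {u} = 0 := measure_mono_null (by simpa using hu) h
  rw [weightMeasure, Measure.sum_apply _ (MeasurableSpace.measurableSet_top), ENNReal.tsum_eq_zero]
    at h0
  have := h0 u
  simp [(vertexWeight_pos u).not_ge] at this

theorem coe_add_L2 (f g : L2Quotient K) (u : QVertex K) : (f + g) u = f u + g u :=
  forall_of_ae_weightMeasure (Lp.coeFn_add f g) u

theorem coe_sub_L2 (f g : L2Quotient K) (u : QVertex K) : (f - g) u = f u - g u :=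
  forall_of_ae_weightMeasure (Lp.coeFn_sub f g) u

theorem coe_smul_L2 (c : ℂ) (f : L2Quotient K) (u : QVertex K) : (c • f) u = c * f u :=
  forall_of_ae_weightMeasure (Lp.coeFn_smul c f) u

theorem coe_toLp_L2 {f : QVertex K → ℂ} (hf : MemLp f 2 (weightMeasure K)) (u : QVertex K) :
    hf.toLp f u = f u :=
  forall_of_ae_weightMeasure hf.coeFn_toLp u

theorem ext_L2 {f g : L2Quotient K} (h : ∀ p, f (coneOrbit K p) = g (coneOrbit K p)) : f = g := by
  refine Lp.ext (Eventually.of_forall fun u => ?_)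
  obtain ⟨p, rfl⟩ := (coneOrbit_bijective K).2 u
  exact h p

variable (K) in
/-- The coordinates on the fundamental domain. -/
def coneEquiv : ℕ × ℕ ≃ QVertex K := Equiv.ofBijective _ (coneOrbit_bijective K)

variable (K) in
/-- The weight of the orbit with coordinates `p`. -/
def coneWeight (p : ℕ × ℕ) : ℝ := vertexWeight (coneOrbit K p)

theorem coneWeight_pos (p : ℕ × ℕ) : 0 < coneWeight K p := vertexWeight_pos _

theorem eLpNorm_sq (f : QVertex K → ℂ) : eLpNorm f 2 (weightMeasure K) ^ 2
    = ∑' p, ENNReal.ofReal (coneWeight K p) * ‖f (coneOrbit K p)‖ₑ ^ 2 := by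
  have h := eLpNorm_nnreal_pow_eq_lintegral (f := f) (μ := weightMeasure K) (p := 2) two_ne_zero
  simp only [NNReal.coe_ofNat, ENNReal.rpow_ofNat, ENNReal.coe_ofNat] at h
  rw [h, weightMeasure, lintegral_sum_measure]
  simp only [lintegral_smul_measure, lintegral_dirac, smul_eq_mul]
  exact ((coneEquiv K).tsum_eq fun u => ENNReal.ofReal (vertexWeight u) * ‖f u‖ₑ ^ 2).symm

theorem memLp_iff (f : QVertex K → ℂ) :
    MemLp f 2 (weightMeasure K) ↔ eLpNorm f 2 (weightMeasure K) < ∞ :=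
  ⟨fun h => h.2, fun h => ⟨(measurable_from_top (f := f)).aestronglyMeasurable, h⟩⟩

/-- Square-summable functions on the cone are elements of `L²` of the quotient. -/
theorem exists_coneLp {φ : ℕ × ℕ → ℂ} (h : Summable fun p => coneWeight K p * ‖φ p‖ ^ 2) :
    ∃ f : L2Quotient K, (∀ p, f (coneOrbit K p) = φ p) ∧
      ‖f‖ ^ 2 = ∑' p, coneWeight K p * ‖φ p‖ ^ 2 := by
  set F : QVertex K → ℂ := fun u => φ ((coneEquiv K).symm u) with hF
  have hFp : ∀ p, F (coneOrbit K p) = φ p := fun p =>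
    congrArg φ ((coneEquiv K).symm_apply_apply p)
  have hnn : ∀ p, 0 ≤ coneWeight K p * ‖φ p‖ ^ 2 := fun p =>
    mul_nonneg (coneWeight_pos p).le (by positivity)
  have he : eLpNorm F 2 (weightMeasure K) ^ 2
      = ENNReal.ofReal (∑' p, coneWeight K p * ‖φ p‖ ^ 2) := by
    rw [eLpNorm_sq, ENNReal.ofReal_tsum_of_nonneg hnn h]
    refine tsum_congr fun p => ?_
    rw [hFp, ENNReal.ofReal_mul (coneWeight_pos p).le, ENNReal.ofReal_pow (norm_nonneg _),
      ofReal_norm]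
  have hmem : MemLp F 2 (weightMeasure K) := by
    rw [memLp_iff, lt_top_iff_ne_top]
    intro htop
    rw [htop] at he
    simp at he
  refine ⟨hmem.toLp F, fun p => by rw [coe_toLp_L2, hFp], ?_⟩
  rw [Lp.norm_toLp, ← ENNReal.toReal_pow, he, ENNReal.toReal_ofReal (tsum_nonneg hnn)]

theorem coneWeight_le (p : ℕ × ℕ) :
    coneWeight K p ≤ weightConst K * ((Nat.card K : ℝ) ^ (2 * (p.1 + p.2)))⁻¹ := by
  have h : (Nat.card K : ℝ) ^ (2 * (p.1 + p.2)) ≤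
      Nat.card (MulAction.stabilizer (Gam K) (vertexOf (ut 0 p.1 ((p.1 : ℤ) + p.2) 0 0 0) : Vertex K)) := by
    exact_mod_cast le_card_stabilizer (K := K) p.1 p.2
  have hq : (0 : ℝ) < Nat.card K := by exact_mod_cast Nat.card_pos
  rw [coneWeight, coneOrbit, diagOrbit, vertexWeight_mk, div_eq_mul_inv]
  have := (weightConst_pos (K := K)).le
  gcongr

theorem le_coneWeight (p : ℕ × ℕ) :
    weightConst K * ((Nat.card K : ℝ) ^ (2 * (p.1 + p.2) + 9))⁻¹ ≤ coneWeight K p := by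
  have h : (Nat.card (MulAction.stabilizer (Gam K)
      (vertexOf (ut 0 p.1 ((p.1 : ℤ) + p.2) 0 0 0) : Vertex K)) : ℝ)
        ≤ (Nat.card K : ℝ) ^ (2 * (p.1 + p.2) + 9) := by
    exact_mod_cast (card_stabilizer_le (K := K) p.1 p.2).2
  have := (card_stabilizer_le (K := K) p.1 p.2).1
  have hpos : (0 : ℝ) < Nat.card (MulAction.stabilizer (Gam K)
      (vertexOf (ut 0 p.1 ((p.1 : ℤ) + p.2) 0 0 0) : Vertex K)) :=
    Nat.cast_pos.2 Nat.card_pos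
  rw [coneWeight, coneOrbit, diagOrbit, vertexWeight_mk, div_eq_mul_inv]
  have := (weightConst_pos (K := K)).le
  gcongr

theorem coneWeight_step {p p' : ℕ × ℕ} (h : p'.1 + p'.2 ≤ p.1 + p.2 + 1) :
    coneWeight K p ≤ (Nat.card K : ℝ) ^ 11 * coneWeight K p' := by
  have hq : (0 : ℝ) < Nat.card K := by exact_mod_cast Nat.card_pos
  have hq1 : (1 : ℝ) ≤ Nat.card K := by exact_mod_cast Nat.card_pos
  have hw := (weightConst_pos (K := K)).le
  calc coneWeight K p ≤ weightConst K * ((Nat.card K : ℝ) ^ (2 * (p.1 + p.2)))⁻¹ := coneWeight_le p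
    _ = (Nat.card K : ℝ) ^ 11 * (weightConst K * ((Nat.card K : ℝ) ^ (2 * (p.1 + p.2) + 11))⁻¹) := by
        rw [pow_add]; field_simp
    _ ≤ (Nat.card K : ℝ) ^ 11
        * (weightConst K * ((Nat.card K : ℝ) ^ (2 * (p'.1 + p'.2) + 9))⁻¹) := by
        exact mul_le_mul_of_nonneg_left (mul_le_mul_of_nonneg_left
          (inv_anti₀ (by positivity) (pow_le_pow_right₀ hq1 (by omega))) hw) (by positivity)
    _ ≤ _ := by gcongr; exact le_coneWeight p'

/-- Composition with a self-map `σ` of the cone is bounded, if the points have at most three preimages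
under `σ`, given by the functions `τ`, and `σ` increases `i + j` by at most one. -/
theorem tsum_comp_le {σ : ℕ × ℕ → ℕ × ℕ} (τ : Fin 3 → ℕ × ℕ → ℕ × ℕ)
    (hτ : ∀ p, ∃ k, p = τ k (σ p)) (hσ : ∀ p, (σ p).1 + (σ p).2 ≤ p.1 + p.2 + 1)
    (g : ℕ × ℕ → ℝ≥0∞) :
    ∑' p, ENNReal.ofReal (coneWeight K p) * g (σ p) ≤
      3 * ENNReal.ofReal ((Nat.card K : ℝ) ^ 11) * ∑' p, ENNReal.ofReal (coneWeight K p) * g p := by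
  classical
  set D := ENNReal.ofReal ((Nat.card K : ℝ) ^ 11) with hD
  have h1 : ∀ p, ENNReal.ofReal (coneWeight K p) * g (σ p)
      ≤ ∑ k : Fin 3, if p = τ k (σ p) then
          D * (ENNReal.ofReal (coneWeight K (σ p)) * g (σ p)) else 0 := by
    intro p
    obtain ⟨k, hk⟩ := hτ p
    refine le_trans ?_ (Finset.single_le_sum (fun _ _ => bot_le) (Finset.mem_univ k))
    rw [if_pos hk, ← mul_assoc, hD, ← ENNReal.ofReal_mul (by positivity)]
    gcongr
    exact coneWeight_step (hσ p)
  refine (ENNReal.tsum_le_tsum h1).trans ?_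
  rw [Summable.tsum_finsetSum fun _ _ => ENNReal.summable]
  have h2 : ∀ k : Fin 3, ∑' p, (if p = τ k (σ p) then
      D * (ENNReal.ofReal (coneWeight K (σ p)) * g (σ p)) else 0)
        ≤ D * ∑' p, ENNReal.ofReal (coneWeight K p) * g p := by
    intro k
    set S : Set (ℕ × ℕ) := {p | p = τ k (σ p)} with hS
    have e : ∑' p, (if p = τ k (σ p) then
        D * (ENNReal.ofReal (coneWeight K (σ p)) * g (σ p)) else 0)
          = ∑' p : S, D * (ENNReal.ofReal (coneWeight K (σ p)) * g (σ p)) := by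
      rw [tsum_subtype S fun p => D * (ENNReal.ofReal (coneWeight K (σ p)) * g (σ p))]
      simp only [Set.indicator_apply, hS, Set.mem_ofPred_eq]
    rw [e, ENNReal.tsum_mul_left]
    gcongr
    refine ENNReal.tsum_comp_le_tsum_of_injective (f := fun p : S => σ p) ?_
      fun p => ENNReal.ofReal (coneWeight K p) * g p
    rintro ⟨p, hp⟩ ⟨p', hp'⟩ h
    have h' : σ p = σ p' := h
    apply Subtype.ext
    have e1 : p = τ k (σ p) := hp
    have e2 : p' = τ k (σ p') := hp'
    change p = p'
    rw [e1, h', ← e2]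
  refine (Finset.sum_le_sum fun k _ => h2 k).trans ?_
  simp [mul_assoc]

/-- The self-map of the orbit space given by a self-map of the cone. -/
def coneMap (σ : ℕ × ℕ → ℕ × ℕ) (u : QVertex K) : QVertex K :=
  coneOrbit K (σ ((coneEquiv K).symm u))

theorem coneMap_coneOrbit (σ : ℕ × ℕ → ℕ × ℕ) (p : ℕ × ℕ) :
    coneMap σ (coneOrbit K p) = coneOrbit K (σ p) :=
  congrArg (fun r => coneOrbit K (σ r)) ((coneEquiv K).symm_apply_apply p)

theorem eLpNorm_comp_coneMap {σ : ℕ × ℕ → ℕ × ℕ} (τ : Fin 3 → ℕ × ℕ → ℕ × ℕ)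
    (hτ : ∀ p, ∃ k, p = τ k (σ p)) (hσ : ∀ p, (σ p).1 + (σ p).2 ≤ p.1 + p.2 + 1) :
    ∃ C : ℝ≥0, ∀ f : QVertex K → ℂ, eLpNorm (fun u => f (coneMap σ u)) 2 (weightMeasure K)
      ≤ C * eLpNorm f 2 (weightMeasure K) := by
  refine ⟨3 * ((Nat.card K : ℝ≥0) ^ 11), fun f => ?_⟩
  rw [← ENNReal.pow_le_pow_left_iff (n := 2) two_ne_zero, mul_pow, eLpNorm_sq, eLpNorm_sq]
  simp only [coneMap_coneOrbit]
  refine (tsum_comp_le τ hτ hσ fun p => ‖f (coneOrbit K p)‖ₑ ^ 2).trans ?_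
  gcongr
  have e : 3 * ENNReal.ofReal ((Nat.card K : ℝ) ^ 11)
      = ((3 * (Nat.card K : ℝ≥0) ^ 11 : ℝ≥0) : ℝ≥0∞) := by
    rw [ENNReal.ofReal_pow (Nat.cast_nonneg _), ENNReal.ofReal_natCast]
    push_cast
    rfl
  rw [e]
  refine le_self_pow₀ ?_ two_ne_zero
  have h1 : 1 ≤ 3 * Nat.card K ^ 11 := Nat.succ_le_of_lt (by have := Nat.card_pos (α := K); positivity)
  exact_mod_cast h1

theorem weightedAdjacency_eq (f : QVertex K → ℂ) : weightedAdjacency 1 f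
    = (Nat.card K : ℂ) ^ 2 • (fun u => f (coneMap coneStepOne u))
      + (Nat.card K : ℂ) • (fun u => f (coneMap coneStepTwo u))
      + fun u => f (coneMap coneStepThree u) := by
  ext u
  obtain ⟨p, rfl⟩ := (coneOrbit_bijective K).2 u
  rw [weightedAdjacency_coneOrbit]
  simp [coneMap_coneOrbit]

theorem exists_eLpNorm_weightedAdjacency_le : ∃ C : ℝ≥0, ∀ f : QVertex K → ℂ,
    eLpNorm (weightedAdjacency 1 f) 2 (weightMeasure K) ≤ C * eLpNorm f 2 (weightMeasure K) := by
  obtain ⟨C1, h1⟩ := eLpNorm_comp_coneMap (K := K) (σ := coneStepOne)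
    ![fun p => (p.1 + 1, p.2), fun p => (0, p.2 + 1), fun _ => (0, 0)]
    (by
      rintro ⟨_ | i, _ | j⟩
      exacts [⟨2, rfl⟩, ⟨1, rfl⟩, ⟨0, rfl⟩, ⟨0, rfl⟩])
    (by rintro ⟨_ | i, _ | j⟩ <;> simp [coneStepOne] <;> omega)
  obtain ⟨C2, h2⟩ := eLpNorm_comp_coneMap (K := K) (σ := coneStepTwo)
    ![fun p => (p.1 - 1, p.2 + 1), fun p => (p.1, 0), fun _ => (0, 0)]
    (by
      rintro ⟨i, _ | j⟩
      exacts [⟨1, rfl⟩, ⟨0, rfl⟩])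
    (by rintro ⟨i, _ | j⟩ <;> simp [coneStepTwo] <;> omega)
  obtain ⟨C3, h3⟩ := eLpNorm_comp_coneMap (K := K) (σ := coneStepThree)
    ![fun p => (p.1, p.2 - 1), fun _ => (0, 0), fun _ => (0, 0)]
    (fun p => ⟨0, rfl⟩) (by rintro ⟨i, j⟩; simp [coneStepThree]; omega)
  refine ⟨‖(Nat.card K : ℂ) ^ 2‖₊ * C1 + ‖(Nat.card K : ℂ)‖₊ * C2 + C3, fun f => ?_⟩
  rw [weightedAdjacency_eq]
  have hm : ∀ g : QVertex K → ℂ, AEStronglyMeasurable g (weightMeasure K) := fun g =>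
    (measurable_from_top (f := g)).aestronglyMeasurable
  refine (eLpNorm_add_le (hm _) (hm _) (by norm_num)).trans ?_
  refine (add_le_add_left (eLpNorm_add_le (hm _) (hm _) (by norm_num)) _).trans ?_
  rw [eLpNorm_const_smul, eLpNorm_const_smul]
  push_cast
  rw [add_mul, add_mul, mul_assoc, mul_assoc]
  gcongr
  · exact le_of_eq rfl
  · exact h1 f
  · exact le_of_eq rfl
  · exact h2 f
  · exact h3 f

/-- The operator on `L²_w` induced by the weighted adjacency operator. -/
theorem exists_weightedAdjacency_operator : ∃ Aw : L2Quotient K →L[ℂ] L2Quotient K,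
    ∀ (f : L2Quotient K) (u : QVertex K), Aw f u = weightedAdjacency 1 f u := by
  obtain ⟨C, hC⟩ := exists_eLpNorm_weightedAdjacency_le (K := K)
  have hmem : ∀ f : L2Quotient K, MemLp (weightedAdjacency 1 f) 2 (weightMeasure K) := fun f =>
    (memLp_iff _).2 ((hC f).trans_lt (ENNReal.mul_lt_top ENNReal.coe_lt_top (Lp.memLp f).2))
  let T : L2Quotient K →ₗ[ℂ] L2Quotient K :=
    { toFun := fun f => (hmem f).toLp _
      map_add' := fun f g => by
        refine ext_L2 fun p => ?_
        rw [coe_add_L2, coe_toLp_L2, coe_toLp_L2, coe_toLp_L2]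
        simp only [weightedAdjacency_coneOrbit, coe_add_L2]
        ring
      map_smul' := fun c f => by
        refine ext_L2 fun p => ?_
        rw [RingHom.id_apply, coe_smul_L2, coe_toLp_L2, coe_toLp_L2]
        simp only [weightedAdjacency_coneOrbit, coe_smul_L2]
        ring }
  refine ⟨T.mkContinuous C fun f => ?_, fun f u => coe_toLp_L2 (hmem f) u⟩
  change ‖(hmem f).toLp _‖ ≤ C * ‖f‖
  rw [Lp.norm_toLp, Lp.norm_def]
  have := ENNReal.toReal_mono (ENNReal.mul_ne_top ENNReal.coe_ne_top (Lp.memLp f).2.ne) (hC f)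
  rwa [ENNReal.toReal_mul, ENNReal.coe_toReal] at this

end

end

/-! ### Points of the spectrum on the quotient -/

section

variable {K : Type*} [Field K]

/-- The inclusion of the cone in the lattice. -/
def coneCast (p : ℕ × ℕ) : ℤ × ℤ := (p.1, p.2)

theorem coneCast_injective : Function.Injective coneCast := by
  rintro ⟨i, j⟩ ⟨i', j'⟩ h
  simpa [coneCast] using h

/-- Away from the walls of the cone, the operator is the translation-invariant one. -/
theorem latticeOp_coneCast (q : ℝ) {c : ℤ × ℤ → ℂ} (hc : ∀ p, c p ≠ 0 → 2 ≤ p.1 ∧ 2 ≤ p.2)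
    (p : ℕ × ℕ) : (q : ℂ) ^ 2 * c (coneCast (coneStepOne p)) + q * c (coneCast (coneStepTwo p))
      + c (coneCast (coneStepThree p)) = latticeOp q (-1) c (coneCast p) := by
  have h0 : ∀ a b : ℤ, a < 2 ∨ b < 2 → c (a, b) = 0 := by
    intro a b h
    by_contra h'
    have := hc _ h'
    dsimp only at this
    omega
  obtain ⟨_ | i, _ | j⟩ := p
  · simp [latticeOp, coneStepOne, coneStepTwo, coneStepThree, coneCast, h0]
  · simp [latticeOp, coneStepOne, coneStepTwo, coneStepThree, coneCast, h0]
  · simp [latticeOp, coneStepOne, coneStepTwo, coneStepThree, coneCast, h0]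
  · simp only [latticeOp, coneStepOne, coneStepTwo, coneStepThree, coneCast]
    congr 4
    · push_cast; ring_nf
    · push_cast; ring_nf

theorem tsum_coneCast {F : Finset (ℤ × ℤ)} (hF : ∀ p ∈ F, 1 ≤ p.1 ∧ 1 ≤ p.2) {h : ℤ × ℤ → ℝ}
    (h0 : ∀ p ∉ F, h p = 0) :
    Summable (fun p => h (coneCast p)) ∧ ∑' p, h (coneCast p) = ∑ p ∈ F, h p := by
  have hs : Summable h := summable_of_ne_finset_zero (s := F) h0
  have hsupp : Function.support h ⊆ Set.range coneCast := by
    intro p hp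
    have hpF : p ∈ F := by by_contra h'; exact hp (h0 p h')
    obtain ⟨h1, h2⟩ := hF p hpF
    exact ⟨(p.1.toNat, p.2.toNat), by ext <;> simp [coneCast] <;> omega⟩
  refine ⟨hs.comp_injective coneCast_injective, ?_⟩
  rw [coneCast_injective.tsum_eq hsupp, tsum_eq_sum h0]

section

variable [Finite K]

theorem weightedAdjacency_coneOrbit_of_eq {Aw : L2Quotient K →L[ℂ] L2Quotient K}
    (hAw : ∀ (f : L2Quotient K) (u : QVertex K), Aw f u = weightedAdjacency 1 f u)
    {f : L2Quotient K} {φ : ℕ × ℕ → ℂ} (hf : ∀ p, f (coneOrbit K p) = φ p) (p : ℕ × ℕ) :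
    Aw f (coneOrbit K p) = (Nat.card K : ℂ) ^ 2 * φ (coneStepOne p)
      + Nat.card K * φ (coneStepTwo p) + φ (coneStepThree p) := by
  rw [hAw, weightedAdjacency_coneOrbit, hf, hf, hf]

/-- The weights decay like the inverse square of the eigenfunctions, up to constants. -/
theorem coneWeight_bounds (p : ℕ × ℕ) :
    coneWeight K p ≤ weightConst K * (Nat.card K : ℝ) ^ (2 * (-1) * ((p.1 : ℤ) + p.2)) ∧
    weightConst K * ((Nat.card K : ℝ) ^ 9)⁻¹ * (Nat.card K : ℝ) ^ (2 * (-1) * ((p.1 : ℤ) + p.2))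
      ≤ coneWeight K p := by
  have e : (Nat.card K : ℝ) ^ (2 * (-1) * ((p.1 : ℤ) + p.2))
      = ((Nat.card K : ℝ) ^ (2 * (p.1 + p.2)))⁻¹ := by
    rw [← zpow_natCast, ← _root_.zpow_neg]; congr 1
  rw [e]
  refine ⟨coneWeight_le p, le_trans (le_of_eq ?_) (le_coneWeight p)⟩
  rw [pow_add, _root_.mul_inv_rev]; ring

/-- The approximate eigenfunctions of the lattice, transplanted to the interior of the cone. Here the
weights are `q^{-2(i+j)}` up to constants, whence the sign `δ = -1`. -/
theorem Sigma2_subset_spectrum {Aw : L2Quotient K →L[ℂ] L2Quotient K}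
    (hAw : ∀ (f : L2Quotient K) (u : QVertex K), Aw f u = weightedAdjacency 1 f u) :
    Sigma2 (Nat.card K) ⊆ spectrum ℂ Aw := by
  rintro _ ⟨s, hs, rfl⟩
  dsimp only
  refine mem_spectrum_of_approx fun ε hε => ?_
  have hq0 : (0 : ℝ) < Nat.card K := by exact_mod_cast Nat.card_pos
  have hw := weightConst_pos (K := K)
  set q : ℝ := (Nat.card K : ℝ) with hq
  have hqc : (Nat.card K : ℂ) = (q : ℂ) := by rw [hq]; simp
  obtain ⟨c, F, hF, hc, hcF, hpos, hle⟩ := exists_lattice_approx hq0 hs (Or.inr rfl)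
    (ε := ε ^ 2 * (q ^ 9)⁻¹) (by positivity)
  set W : ℤ × ℤ → ℝ := fun p => q ^ (2 * (-1) * (p.1 + p.2)) with hW
  have hW0 : ∀ p, 0 < W p := fun p => zpow_pos hq0 _
  have hwle : ∀ p, coneWeight K p ≤ weightConst K * W (coneCast p) := fun p =>
    (coneWeight_bounds p).1
  have hlew : ∀ p, weightConst K * (q ^ 9)⁻¹ * W (coneCast p) ≤ coneWeight K p := fun p =>
    (coneWeight_bounds p).2
  set E : ℤ × ℤ → ℂ := fun p => latticeOp q (-1) c p - q * (s.1 + s.2.1 + s.2.2) * c p with hE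
  -- Transfer from the lattice to the cone of a function supported in `F`.
  have hsum : ∀ φ : ℤ × ℤ → ℂ, (∀ p ∉ F, φ p = 0) →
      Summable (fun p => coneWeight K p * ‖φ (coneCast p)‖ ^ 2) ∧
      ∑' p, coneWeight K p * ‖φ (coneCast p)‖ ^ 2 ≤ weightConst K * ∑ p ∈ F, ‖φ p‖ ^ 2 * W p ∧
      weightConst K * (q ^ 9)⁻¹ * ∑ p ∈ F, ‖φ p‖ ^ 2 * W p
        ≤ ∑' p, coneWeight K p * ‖φ (coneCast p)‖ ^ 2 := by
    intro φ hφ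
    obtain ⟨h1, h2⟩ := tsum_coneCast hF (h := fun p => ‖φ p‖ ^ 2 * W p) fun p hp => by
      simp [hφ p hp]
    have b1 : ∀ p, coneWeight K p * ‖φ (coneCast p)‖ ^ 2
        ≤ weightConst K * (‖φ (coneCast p)‖ ^ 2 * W (coneCast p)) := fun p => by
      have := mul_le_mul_of_nonneg_right (hwle p) (sq_nonneg ‖φ (coneCast p)‖)
      linarith
    have b2 : ∀ p, weightConst K * (q ^ 9)⁻¹ * (‖φ (coneCast p)‖ ^ 2 * W (coneCast p))
        ≤ coneWeight K p * ‖φ (coneCast p)‖ ^ 2 := fun p => by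
      have := mul_le_mul_of_nonneg_right (hlew p) (sq_nonneg ‖φ (coneCast p)‖)
      linarith
    have hs := Summable.of_nonneg_of_le
      (fun p => mul_nonneg (coneWeight_pos (K := K) p).le (sq_nonneg _)) b1 (h1.mul_left _)
    refine ⟨hs, ?_, ?_⟩
    · rw [← h2, ← tsum_mul_left]
      exact hs.tsum_le_tsum b1 (h1.mul_left _)
    · rw [← h2, ← tsum_mul_left]
      exact (h1.mul_left _).tsum_le_tsum b2 hs
  obtain ⟨hsc, -, hc2⟩ := hsum c fun p hp => (hcF p hp).1
  obtain ⟨hse, he1, -⟩ := hsum E fun p hp => by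
    rw [hE]; dsimp only; rw [(hcF p hp).1, (hcF p hp).2]; simp
  obtain ⟨f, hf, hfn⟩ := exists_coneLp (φ := fun p => c (coneCast p)) hsc
  obtain ⟨g, hg, hgn⟩ := exists_coneLp (φ := fun p => E (coneCast p)) hse
  rw [← hfn] at hc2
  rw [← hgn] at he1
  have e : Aw f - ((q : ℂ) * (s.1 + s.2.1 + s.2.2)) • f = g := by
    refine ext_L2 fun p => ?_
    rw [coe_sub_L2, coe_smul_L2, weightedAdjacency_coneOrbit_of_eq hAw hf, hf, hg, hqc,
      latticeOp_coneCast q hc]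
  have hf0 : 0 < ‖f‖ ^ 2 := lt_of_lt_of_le (by positivity) hc2
  refine ⟨f, ?_, ?_⟩
  · rintro rfl
    simp at hf0
  · rw [e]
    refine (pow_le_pow_iff_left₀ (norm_nonneg _) (by positivity) two_ne_zero).1 ?_
    rw [mul_pow]
    calc ‖g‖ ^ 2 ≤ weightConst K * ∑ p ∈ F, ‖E p‖ ^ 2 * W p := he1
      _ ≤ weightConst K * (ε ^ 2 * (q ^ 9)⁻¹ * ∑ p ∈ F, ‖c p‖ ^ 2 * W p) := by
          gcongr
      _ = ε ^ 2 * (weightConst K * (q ^ 9)⁻¹ * ∑ p ∈ F, ‖c p‖ ^ 2 * W p) := by ring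
      _ ≤ _ := by gcongr

/-- The function `β^{2i+j}` on the cone. It satisfies the eigenfunction equation of the operator,
except on the wall `i = 0`. The bound for the error `g` on the wall is uniform in `β`, whereas the
lower bound for `f`, from the points `(i, 0)` with `i < N`, diverges as `‖β‖² → q`. -/
theorem exists_powerLp {β : ℂ} (hβ0 : β ≠ 0) (hβ : ‖β‖ ^ 2 < Nat.card K) :
    ∃ f g : L2Quotient K, (∀ p, f (coneOrbit K p) = β ^ (2 * p.1 + p.2)) ∧
      (∀ Aw : L2Quotient K →L[ℂ] L2Quotient K,
        (∀ (f : L2Quotient K) (u : QVertex K), Aw f u = weightedAdjacency 1 f u) →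
        Aw f = ((Nat.card K : ℂ) ^ 2 * (β ^ 2)⁻¹ + (Nat.card K + 1) * β) • f
          + ((Nat.card K : ℂ) ^ 2 * (β - (β ^ 2)⁻¹)) • g) ∧
      ‖g‖ ^ 2 ≤ weightConst K * 2 ∧
      ∀ N : ℕ, weightConst K * ((Nat.card K : ℝ) ^ 9)⁻¹ *
        (N * (‖β‖ ^ 4 / (Nat.card K : ℝ) ^ 2) ^ N) ≤ ‖f‖ ^ 2 := by
  classical
  have hw := weightConst_pos (K := K)
  have hq2 : (2 : ℝ) ≤ Nat.card K := by exact_mod_cast one_lt_card (K := K)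
  set q : ℝ := (Nat.card K : ℝ) with hq
  have hqc : (Nat.card K : ℂ) = (q : ℂ) := by rw [hq]; simp
  have hq0 : 0 < q := by linarith
  set x : ℝ := ‖β‖ ^ 4 / q ^ 2 with hx
  set y : ℝ := ‖β‖ ^ 2 / q ^ 2 with hy
  have hx0 : 0 ≤ x := by positivity
  have hy0 : 0 ≤ y := by positivity
  have hx1 : x < 1 := by
    rw [hx, div_lt_one (by positivity)]
    nlinarith [sq_nonneg ‖β‖]
  have hy1 : y ≤ 1 / 2 := by
    rw [hy, div_le_div_iff₀ (by positivity) (by norm_num)]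
    nlinarith
  set φ : ℕ × ℕ → ℂ := fun p => β ^ (2 * p.1 + p.2) with hφ
  set ψ : ℕ × ℕ → ℂ := fun p => if p.1 = 0 then β ^ p.2 else 0 with hψ
  have hpow : ∀ p : ℕ × ℕ, ‖φ p‖ ^ 2 * (q ^ (2 * (p.1 + p.2)))⁻¹ = x ^ p.1 * y ^ p.2 := by
    intro p
    rw [hφ, hx, hy, norm_pow, div_pow, div_pow]
    field_simp
    ring
  have hb : ∀ p : ℕ × ℕ, coneWeight K p * ‖φ p‖ ^ 2 ≤ weightConst K * (x ^ p.1 * y ^ p.2) := by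
    intro p
    rw [← hpow]
    have := mul_le_mul_of_nonneg_right (coneWeight_le (K := K) p) (sq_nonneg ‖φ p‖)
    linarith
  have hgx := summable_geometric_of_lt_one hx0 hx1
  have hgy := summable_geometric_of_lt_one hy0 (by linarith : y < 1)
  have hsφ : Summable fun p => coneWeight K p * ‖φ p‖ ^ 2 :=
    Summable.of_nonneg_of_le (fun p => mul_nonneg (coneWeight_pos (K := K) p).le (sq_nonneg _)) hb
      ((hgx.mul_of_nonneg hgy (fun _ => pow_nonneg hx0 _) fun _ => pow_nonneg hy0 _).mul_left _)
  have hψφ : ∀ p, ‖ψ p‖ ≤ ‖φ p‖ := by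
    rintro ⟨_ | i, j⟩ <;> simp [hψ, hφ]
  have hsψ : Summable fun p => coneWeight K p * ‖ψ p‖ ^ 2 := by
    refine Summable.of_nonneg_of_le (fun p => mul_nonneg (coneWeight_pos (K := K) p).le (sq_nonneg _))
      (fun p => ?_) hsφ
    have := (coneWeight_pos (K := K) p).le
    gcongr
    exact hψφ p
  obtain ⟨f, hf, hfn⟩ := exists_coneLp hsφ
  obtain ⟨g, hg, hgn⟩ := exists_coneLp hsψ
  refine ⟨f, g, hf, fun Aw hAw => ?_, ?_, fun N => ?_⟩
  · refine ext_L2 fun p => ?_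
    rw [coe_add_L2, coe_smul_L2, coe_smul_L2, weightedAdjacency_coneOrbit_of_eq hAw hf, hf, hg]
    obtain ⟨_ | i, _ | j⟩ := p
    · simp only [hφ, hψ, coneStepOne, coneStepTwo, coneStepThree]
      field_simp
      simp
      ring
    · simp only [hφ, hψ, coneStepOne, coneStepTwo, coneStepThree]
      field_simp
      simp
      ring
    · simp only [hφ, hψ, coneStepOne, coneStepTwo, coneStepThree]
      field_simp
      simp
      ring
    · simp only [hφ, hψ, coneStepOne, coneStepTwo, coneStepThree]
      field_simp
      simp
      ring
  · have hinj : Function.Injective fun j : ℕ => ((0 : ℕ), j) := fun a b h => (Prod.mk.inj h).2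
    have hsupp : Function.support (fun p => coneWeight K p * ‖ψ p‖ ^ 2)
        ⊆ Set.range fun j : ℕ => ((0 : ℕ), j) := by
      rintro ⟨_ | i, j⟩ hp
      · exact ⟨j, rfl⟩
      · simp [hψ] at hp
    have hb' : ∀ j : ℕ, coneWeight K (0, j) * ‖ψ (0, j)‖ ^ 2 ≤ weightConst K * y ^ j := fun j => by
      have h1 := hb (0, j)
      have h2 : ψ (0, j) = φ (0, j) := by simp [hψ, hφ]
      rw [h2]
      simpa using h1
    rw [hgn, ← hinj.tsum_eq hsupp]
    refine ((hsψ.comp_injective hinj).tsum_le_tsum hb' (hgy.mul_left _)).trans ?_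
    rw [tsum_mul_left, tsum_geometric_of_lt_one hy0 (by linarith)]
    gcongr
    rw [inv_le_comm₀ (by linarith) (by norm_num)]
    linarith
  · rw [hfn]
    have hinj : Function.Injective fun i : ℕ => (i, (0 : ℕ)) := fun a b h => (Prod.mk.inj h).1
    refine le_trans ?_ (hsφ.sum_le_tsum ((Finset.range N).map ⟨_, hinj⟩)
      fun p _ => mul_nonneg (coneWeight_pos (K := K) p).le (sq_nonneg _))
    rw [Finset.sum_map]
    have hlow : ∀ i ∈ Finset.range N, weightConst K * (q ^ 9)⁻¹ * x ^ N
        ≤ coneWeight K (i, 0) * ‖φ (i, 0)‖ ^ 2 := by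
      intro i hi
      have h1 := hpow (i, 0)
      have h2 := mul_le_mul_of_nonneg_right (le_coneWeight (K := K) (i, 0))
        (sq_nonneg ‖φ (i, 0)‖)
      refine le_trans ?_ h2
      rw [← hq, pow_add, _root_.mul_inv_rev]
      calc weightConst K * (q ^ 9)⁻¹ * x ^ N ≤ weightConst K * (q ^ 9)⁻¹ * (x ^ i * y ^ 0) := by
            rw [pow_zero, mul_one]
            gcongr weightConst K * (q ^ 9)⁻¹ * ?_
            exact pow_le_pow_of_le_one hx0 hx1.le (Finset.mem_range.1 hi).le
        _ = weightConst K * (q ^ 9)⁻¹ * (‖φ (i, 0)‖ ^ 2 * (q ^ (2 * (i + 0)))⁻¹) := by rw [h1]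
        _ = _ := by ring
    calc _ = ∑ _i ∈ Finset.range N, weightConst K * (q ^ 9)⁻¹ * x ^ N := by
          rw [Finset.sum_const, Finset.card_range, nsmul_eq_mul]; ring
      _ ≤ _ := Finset.sum_le_sum hlow

/-- For `β³ = 1` the eigenfunction equation holds on the wall as well, and the total mass is
finite. -/
theorem mul_cube_root_mem_spectrum {Aw : L2Quotient K →L[ℂ] L2Quotient K}
    (hAw : ∀ (f : L2Quotient K) (u : QVertex K), Aw f u = weightedAdjacency 1 f u) {β : ℂ}
    (hβ : β ^ 3 = 1) : ((Nat.card K : ℂ) ^ 2 + Nat.card K + 1) * β ∈ spectrum ℂ Aw := by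
  have hβ0 : β ≠ 0 := by rintro rfl; norm_num at hβ
  have hn : ‖β‖ = 1 := by
    have : ‖β‖ ^ 3 = 1 := by rw [← norm_pow, hβ, norm_one]
    exact (pow_eq_one_iff_of_nonneg (norm_nonneg _) (by norm_num)).1 this
  have hinv : (β ^ 2)⁻¹ = β := inv_eq_of_mul_eq_one_left (by rw [← hβ]; ring)
  obtain ⟨f, g, hf, h, -, -⟩ := exists_powerLp (K := K) hβ0 (by
    rw [hn]; norm_num; exact_mod_cast one_lt_card (K := K))
  refine mem_spectrum_of_approx fun ε hε => ⟨f, ?_, ?_⟩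
  · rintro rfl
    have h0 := hf (0, 0)
    have h1 := coe_smul_L2 (0 : ℂ) (0 : L2Quotient K) (coneOrbit K (0, 0))
    rw [smul_zero, zero_mul] at h1
    rw [h1] at h0
    simp at h0
  · rw [h Aw hAw, hinv, sub_self, mul_zero, zero_smul, add_zero, ← sub_smul]
    have : (Nat.card K : ℂ) ^ 2 * β + (Nat.card K + 1) * β
        - ((Nat.card K : ℂ) ^ 2 + Nat.card K + 1) * β = 0 := by ring
    rw [this, zero_smul, norm_zero]
    positivity

theorem Sigma0_subset_spectrum {Aw : L2Quotient K →L[ℂ] L2Quotient K}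
    (hAw : ∀ (f : L2Quotient K) (u : QVertex K), Aw f u = weightedAdjacency 1 f u) :
    Sigma0 (Nat.card K) ⊆ spectrum ℂ Aw := by
  rintro z (rfl | rfl | rfl)
  · have := mul_cube_root_mem_spectrum hAw (β := 1) (by norm_num)
    push_cast
    simpa using this
  · have := mul_cube_root_mem_spectrum hAw (β := Complex.exp (2 * Real.pi * Complex.I / 3)) (by
      rw [← Complex.exp_nat_mul, ← Complex.exp_two_pi_mul_I]; congr 1; push_cast; ring)
    push_cast
    simpa using this
  · have := mul_cube_root_mem_spectrum hAw (β := Complex.exp (4 * Real.pi * Complex.I / 3)) (by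
      rw [← Complex.exp_nat_mul]
      have : ((3 : ℕ) : ℂ) * (4 * Real.pi * Complex.I / 3) = 2 * Real.pi * Complex.I
          + 2 * Real.pi * Complex.I := by push_cast; ring
      rw [this, Complex.exp_add, Complex.exp_two_pi_mul_I, mul_one])
    push_cast
    simpa using this

/-- For `β = r e^{iθ}` with `r` close to `q^{1/2}`, the function `β^{2i+j}` is an approximate
eigenfunction: its norm is large compared with the error on the wall. -/
theorem Sigma1_subset_spectrum {Aw : L2Quotient K →L[ℂ] L2Quotient K}
    (hAw : ∀ (f : L2Quotient K) (u : QVertex K), Aw f u = weightedAdjacency 1 f u) :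
    Sigma1 (Nat.card K) ⊆ spectrum ℂ Aw := by
  rintro _ ⟨θ, rfl⟩
  dsimp only
  have hw := weightConst_pos (K := K)
  have hq2 : (2 : ℝ) ≤ Nat.card K := by exact_mod_cast one_lt_card (K := K)
  set q : ℝ := (Nat.card K : ℝ) with hq
  have hqc : (Nat.card K : ℂ) = (q : ℂ) := by rw [hq]; simp
  have hq0 : 0 < q := by linarith
  set r₀ : ℝ := √q with hr₀
  have hr₀0 : 0 < r₀ := Real.sqrt_pos.2 hq0
  have hr₀q : r₀ ^ 2 = q := Real.sq_sqrt hq0.le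
  set E : ℂ := Complex.exp (θ * Complex.I) with hE
  have hE0 : E ≠ 0 := Complex.exp_ne_zero _
  have hEn : ‖E‖ = 1 := Complex.norm_exp_ofReal_mul_I θ
  -- The value on the curve is the limit of the eigenvalues of the power functions.
  set lam : ℝ → ℂ := fun r => (q : ℂ) ^ 2 * (((r : ℂ) * E) ^ 2)⁻¹ + (q + 1) * ((r : ℂ) * E)
    with hlam
  have hval : ((q ^ (3 / 2 : ℝ) : ℝ) : ℂ) * E + q * Complex.exp (-2 * θ * Complex.I)
      + ((q ^ (1 / 2 : ℝ) : ℝ) : ℂ) * E = lam r₀ := by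
    have h1 : q ^ (1 / 2 : ℝ) = r₀ := (Real.sqrt_eq_rpow q).symm
    have h2 : q ^ (3 / 2 : ℝ) = q * r₀ := by
      rw [← h1, show (3 / 2 : ℝ) = 1 + 1 / 2 by norm_num, Real.rpow_add hq0, Real.rpow_one]
    have h3 : Complex.exp (-2 * θ * Complex.I) = (E ^ 2)⁻¹ := by
      rw [hE, ← Complex.exp_nat_mul, ← Complex.exp_neg]; congr 1; push_cast; ring
    have h4 : (r₀ : ℂ) ^ 2 = q := by exact_mod_cast hr₀q
    have hqc0 : (q : ℂ) ≠ 0 := by exact_mod_cast hq0.ne'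
    rw [h1, h2, h3, hlam]
    dsimp only
    rw [mul_pow, h4, Complex.ofReal_mul]
    field_simp
    ring
  rw [hval]
  refine mem_spectrum_of_approx fun ε hε => ?_
  set c₀ : ℝ := weightConst K * (q ^ 9)⁻¹ with hc₀
  have hc₀0 : 0 < c₀ := by positivity
  set B : ℝ := q ^ 2 * (q + 1) with hB
  have hB0 : 0 < B := by positivity
  obtain ⟨N, hN⟩ := exists_nat_gt (16 * B ^ 2 * (weightConst K) / (ε ^ 2 * c₀))
  have hr₀1 : 1 < r₀ := by rw [hr₀, Real.lt_sqrt (by norm_num)]; linarith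
  have hlam_cont : ContinuousAt lam r₀ := by
    have : ((r₀ : ℂ) * E) ^ 2 ≠ 0 := pow_ne_zero _ (mul_ne_zero (by exact_mod_cast hr₀0.ne') hE0)
    simp only [hlam]
    fun_prop (disch := assumption)
  have e1 : ∀ᶠ r in 𝓝[<] r₀, ‖lam r - lam r₀‖ < ε / 2 :=
    hlam_cont.continuousWithinAt.eventually (eventually_nhds_iff.2 ⟨Metric.ball (lam r₀) (ε / 2),
      fun z hz => by simpa [dist_eq_norm] using hz, Metric.isOpen_ball,
      Metric.mem_ball_self (by positivity)⟩)
  have e2 : ∀ᶠ r in 𝓝[<] r₀, 1 / 2 < (r ^ 4 / q ^ 2) ^ N := by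
    have hc : ContinuousAt (fun r : ℝ => (r ^ 4 / q ^ 2) ^ N) r₀ := by fun_prop
    refine hc.continuousWithinAt.eventually (lt_mem_nhds ?_)
    have : r₀ ^ 4 / q ^ 2 = 1 := by
      rw [← hr₀q]; field_simp
    dsimp only
    rw [this, one_pow]; norm_num
  have e3 : ∀ᶠ r in 𝓝[<] r₀, 1 < r := (lt_mem_nhds hr₀1).filter_mono nhdsWithin_le_nhds
  have e4 : ∀ᶠ r in 𝓝[<] r₀, r < r₀ := self_mem_nhdsWithin
  -- With `N` terms of the lower bound each at least `1 / 2`, the norm of `f` is as large as needed.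
  obtain ⟨r, h1, h2, h3, h4⟩ := (e1.and (e2.and (e3.and e4))).exists
  have hr0 : 0 < r := by linarith
  have hβn : ‖(r : ℂ) * E‖ = r := by
    rw [norm_mul, hEn, mul_one, Complex.norm_real, Real.norm_of_nonneg hr0.le]
  have hrq : r ^ 2 < q := by rw [← hr₀q]; gcongr
  obtain ⟨f, g, -, hA, hg, hf⟩ := exists_powerLp (K := K) (β := (r : ℂ) * E)
    (mul_ne_zero (by exact_mod_cast hr0.ne') hE0) (by rw [hβn]; exact hrq)
  have hfN := hf N
  rw [hβn, ← hq, ← hc₀] at hfN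
  have hA' := hA Aw hAw
  rw [hqc] at hA'
  set cg : ℂ := (q : ℂ) ^ 2 * ((r : ℂ) * E - (((r : ℂ) * E) ^ 2)⁻¹) with hcg
  have hcgB : ‖cg‖ ≤ B := by
    rw [hcg, hB, norm_mul, norm_pow, Complex.norm_real, Real.norm_of_nonneg hq0.le]
    gcongr
    refine (norm_sub_le _ _).trans (add_le_add ?_ ?_)
    · rw [hβn]
      nlinarith
    · rw [norm_inv, norm_pow, hβn]
      exact inv_le_one_of_one_le₀ (one_le_pow₀ h3.le)
  have hf2 : 8 * B ^ 2 * weightConst K / ε ^ 2 < ‖f‖ ^ 2 := by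
    refine lt_of_lt_of_le ?_ hfN
    rw [div_lt_iff₀ (by positivity)] at hN ⊢
    have hNpos : (0 : ℝ) < N := by
      by_contra hn
      have : (N : ℝ) * (ε ^ 2 * c₀) ≤ 0 := mul_nonpos_of_nonpos_of_nonneg (not_lt.1 hn)
        (by positivity)
      have : 0 < 16 * B ^ 2 * weightConst K := by positivity
      linarith
    calc 8 * B ^ 2 * weightConst K = 1 / 2 * (16 * B ^ 2 * weightConst K) := by ring
      _ < 1 / 2 * (N * (ε ^ 2 * c₀)) := by gcongr
      _ = c₀ * (N * (1 / 2)) * ε ^ 2 := by ring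
      _ ≤ _ := by gcongr
  have hcgg : ‖cg • g‖ ≤ ε / 2 * ‖f‖ := by
    refine (pow_le_pow_iff_left₀ (norm_nonneg _) (by positivity) two_ne_zero).1 ?_
    rw [norm_smul, mul_pow, mul_pow]
    rw [div_lt_iff₀ (by positivity)] at hf2
    calc ‖cg‖ ^ 2 * ‖g‖ ^ 2 ≤ B ^ 2 * (weightConst K * 2) := by gcongr
      _ ≤ (ε / 2) ^ 2 * ‖f‖ ^ 2 := by nlinarith
  refine ⟨f, ?_, ?_⟩
  · rintro rfl
    have : 0 < 8 * B ^ 2 * weightConst K / ε ^ 2 := by positivity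
    rw [norm_zero] at hf2
    norm_num at hf2
    linarith
  · have e : Aw f - lam r₀ • f = (lam r - lam r₀) • f + cg • g := by
      rw [hA', sub_smul]; abel
    rw [e]
    refine (norm_add_le _ _).trans ?_
    rw [norm_smul]
    have : ‖lam r - lam r₀‖ * ‖f‖ ≤ ε / 2 * ‖f‖ := by gcongr
    linarith

end

end

/-! ### Tips and cusps -/

section

theorem exp_third_mul_two (k : ℕ) :
    Complex.exp (2 * Real.pi * Complex.I / 3) ^ k
      = Complex.exp (((k * (2 * Real.pi / 3) : ℝ) : ℂ) * Complex.I) := by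
  rw [← Complex.exp_nat_mul]; congr 1; push_cast; ring

theorem exp_four_third : Complex.exp (4 * Real.pi * Complex.I / 3)
    = Complex.exp (2 * Real.pi * Complex.I / 3) ^ 2 := by
  rw [← Complex.exp_nat_mul]; congr 1; push_cast; ring

theorem isPrimitiveRoot_third : IsPrimitiveRoot (Complex.exp (2 * Real.pi * Complex.I / 3)) 3 := by
  exact_mod_cast Complex.isPrimitiveRoot_exp 3 (by norm_num)

theorem mem_rootTriple_iff_exists {r : ℝ} {z : ℂ} : z ∈ rootTriple r ↔
    ∃ θ : ℝ, Complex.exp (θ * Complex.I) ^ 3 = 1 ∧ z = r * Complex.exp (θ * Complex.I) := by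
  have h3 := isPrimitiveRoot_third.pow_eq_one
  constructor
  · have key : ∀ k : ℕ, ∃ θ : ℝ, Complex.exp (θ * Complex.I) ^ 3 = 1 ∧
        Complex.exp (2 * Real.pi * Complex.I / 3) ^ k = Complex.exp (θ * Complex.I) := fun k =>
      ⟨_, by rw [← exp_third_mul_two k, ← pow_mul, mul_comm k 3, pow_mul, h3, one_pow],
        exp_third_mul_two k⟩
    rintro (rfl | rfl | rfl)
    · obtain ⟨θ, h1, h2⟩ := key 0
      exact ⟨θ, h1, by rw [← h2]; simp⟩
    · obtain ⟨θ, h1, h2⟩ := key 1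
      exact ⟨θ, h1, by rw [← h2, pow_one]⟩
    · obtain ⟨θ, h1, h2⟩ := key 2
      exact ⟨θ, h1, by rw [exp_four_third, ← h2]⟩
  · rintro ⟨θ, h1, rfl⟩
    obtain ⟨k, hk, e⟩ := isPrimitiveRoot_third.eq_pow_of_pow_eq_one h1
    rw [← e]
    interval_cases k
    · left; simp
    · right; left; rw [pow_one]
    · right; right; rw [Set.mem_singleton_iff, exp_four_third]

theorem ncard_rootTriple {r : ℝ} (hr : 0 < r) : (rootTriple r).ncard = 3 := by
  have hr0 : (r : ℂ) ≠ 0 := by exact_mod_cast hr.ne'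
  have hω := isPrimitiveRoot_third
  set ω := Complex.exp (2 * Real.pi * Complex.I / 3) with hωdef
  have h0 : ω ≠ 0 := Complex.exp_ne_zero _
  have h1 : ω ≠ 1 := hω.ne_one (by norm_num)
  have h2 : ω ^ 2 ≠ 1 := hω.pow_ne_one_of_pos_of_lt (by norm_num) (by norm_num)
  rw [Set.ncard_eq_three]
  refine ⟨_, _, _, ?_, ?_, ?_, rfl⟩
  · intro h
    exact h1 (mul_left_cancel₀ hr0 (by rw [← hωdef] at h; rw [← h, mul_one]))
  · rw [exp_four_third, ← hωdef]
    intro h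
    exact h2 (mul_left_cancel₀ hr0 (by rw [← h, mul_one]))
  · rw [exp_four_third, ← hωdef]
    intro h
    have := mul_left_cancel₀ hr0 h
    rw [sq] at this
    exact h1 (mul_left_cancel₀ h0 (by rw [← this, mul_one]))

theorem exp_neg_two (θ : ℝ) :
    Complex.exp (-2 * θ * Complex.I) = (Complex.exp (θ * Complex.I) ^ 2)⁻¹ := by
  rw [← Complex.exp_nat_mul, ← Complex.exp_neg]; congr 1; push_cast; ring

/-- The modulus of `a e^{iθ} + b e^{-2iθ}` is maximal where the two terms are aligned. -/
theorem norm_sq_trochoid (a b θ : ℝ) :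
    ‖(a : ℂ) * Complex.exp (θ * Complex.I) + b * (Complex.exp (θ * Complex.I) ^ 2)⁻¹‖ ^ 2
      = a ^ 2 + b ^ 2 + 2 * a * b * (Complex.exp (θ * Complex.I) ^ 3).re := by
  set E := Complex.exp (θ * Complex.I) with hE
  have hE0 : E ≠ 0 := Complex.exp_ne_zero _
  have hn : ‖E‖ = 1 := Complex.norm_exp_ofReal_mul_I θ
  have h1 : ‖(a : ℂ) * E + b * (E ^ 2)⁻¹‖ = ‖(a : ℂ) * E ^ 3 + b‖ := by
    have : (a : ℂ) * E ^ 3 + b = E ^ 2 * ((a : ℂ) * E + b * (E ^ 2)⁻¹) := by field_simp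
    rw [this, norm_mul, norm_pow, hn, one_pow, one_mul]
  have hn3 : (E ^ 3).re ^ 2 + (E ^ 3).im ^ 2 = 1 := by
    have : Complex.normSq (E ^ 3) = 1 := by
      rw [Complex.normSq_eq_norm_sq, norm_pow, hn]; norm_num
    rw [Complex.normSq_apply] at this
    linarith
  rw [h1, ← Complex.normSq_eq_norm_sq, Complex.normSq_apply]
  simp only [Complex.add_re, Complex.add_im, Complex.re_ofReal_mul, Complex.im_ofReal_mul,
    Complex.ofReal_re, Complex.ofReal_im, add_zero]
  linear_combination a ^ 2 * hn3

theorem eq_one_of_re_eq_one {z : ℂ} (hz : ‖z‖ = 1) (h : 1 ≤ z.re) : z = 1 := by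
  have h1 : z.re ^ 2 + z.im ^ 2 = 1 := by
    have : Complex.normSq z = 1 := by rw [Complex.normSq_eq_norm_sq, hz]; norm_num
    rw [Complex.normSq_apply] at this
    linarith
  have h2 : z.re = 1 := le_antisymm (by nlinarith [sq_nonneg z.im]) h
  have h3 : z.im = 0 := by
    rw [h2] at h1
    nlinarith
  exact Complex.ext h2 h3

theorem inv_sq_of_cube {E : ℂ} (h : E ^ 3 = 1) : (E ^ 2)⁻¹ = E :=
  inv_eq_of_mul_eq_one_left (by rw [← h]; ring)

theorem max_norm_Sigma1 {q : ℝ} (hq : 0 < q) :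
    {z ∈ Sigma1 q | ∀ z' ∈ Sigma1 q, ‖z'‖ ≤ ‖z‖}
      = rootTriple (q ^ (3 / 2 : ℝ) + q + q ^ (1 / 2 : ℝ)) := by
  set a : ℝ := q ^ (3 / 2 : ℝ) + q ^ (1 / 2 : ℝ) with ha
  have ha0 : 0 < a := by positivity
  have hsum : q ^ (3 / 2 : ℝ) + q + q ^ (1 / 2 : ℝ) = a + q := by rw [ha]; ring
  have hS : ∀ z, z ∈ Sigma1 q ↔ ∃ θ : ℝ, (a : ℂ) * Complex.exp (θ * Complex.I)
      + q * (Complex.exp (θ * Complex.I) ^ 2)⁻¹ = z := by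
    intro z
    rw [Sigma1, Set.mem_range]
    refine exists_congr fun θ => ?_
    rw [exp_neg_two, ha]
    push_cast
    ring_nf
  have hle : ∀ θ : ℝ, (Complex.exp (θ * Complex.I) ^ 3).re ≤ 1 := fun θ => by
    refine (Complex.re_le_norm _).trans ?_
    rw [norm_pow, Complex.norm_exp_ofReal_mul_I, one_pow]
  have hmax : ∀ z ∈ Sigma1 q, ‖z‖ ≤ a + q := by
    intro z hz
    obtain ⟨θ, rfl⟩ := (hS z).1 hz
    refine (pow_le_pow_iff_left₀ (norm_nonneg _) (by positivity) two_ne_zero).1 ?_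
    rw [norm_sq_trochoid]
    have := mul_le_mul_of_nonneg_left (hle θ) (by positivity : 0 ≤ 2 * a * q)
    linarith
  have htip : ∀ θ : ℝ, Complex.exp (θ * Complex.I) ^ 3 = 1 →
      (a : ℂ) * Complex.exp (θ * Complex.I) + q * (Complex.exp (θ * Complex.I) ^ 2)⁻¹
        = ((a + q : ℝ) : ℂ) * Complex.exp (θ * Complex.I) := by
    intro θ h
    rw [inv_sq_of_cube h]; push_cast; ring
  have hnorm : ∀ θ : ℝ, ‖((a + q : ℝ) : ℂ) * Complex.exp (θ * Complex.I)‖ = a + q := fun θ => by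
    rw [norm_mul, Complex.norm_exp_ofReal_mul_I, mul_one, Complex.norm_real,
      Real.norm_of_nonneg (by positivity)]
  ext z
  rw [hsum, mem_rootTriple_iff_exists]
  constructor
  · rintro ⟨hz, hmx⟩
    obtain ⟨θ, rfl⟩ := (hS z).1 hz
    have h0 := hmx _ ((hS _).2 ⟨0, rfl⟩)
    rw [htip 0 (by simp), hnorm] at h0
    have h1 := pow_le_pow_left₀ (by positivity) h0 2
    rw [norm_sq_trochoid] at h1
    have h2 : 1 ≤ (Complex.exp (θ * Complex.I) ^ 3).re := by
      have h3 : 2 * a * q * 1 ≤ 2 * a * q * (Complex.exp (θ * Complex.I) ^ 3).re := by linarith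
      exact le_of_mul_le_mul_left h3 (by positivity)
    have h3 := eq_one_of_re_eq_one (by
      rw [norm_pow, Complex.norm_exp_ofReal_mul_I, one_pow]) h2
    exact ⟨θ, h3, htip θ h3⟩
  · rintro ⟨θ, h, rfl⟩
    refine ⟨(hS _).2 ⟨θ, htip θ h⟩, fun z' hz' => ?_⟩
    rw [hnorm]
    exact hmax z' hz'

theorem hypocycloid_eq {q : ℝ} (hq : q ≠ 0) (θ : ℝ) : hypocycloid q θ
    = 2 * q * Complex.exp (θ * Complex.I) + q * Complex.exp (-2 * θ * Complex.I) := by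
  rw [hypocycloid, show 3 * q - q = 2 * q by ring, mul_div_assoc, div_self hq, mul_one]
  push_cast
  rfl

theorem deriv_trochoid (a b : ℂ) :
    deriv (fun θ : ℝ => a * Complex.exp (θ * Complex.I) + b * Complex.exp (-2 * θ * Complex.I))
      = fun θ : ℝ => (a * Complex.I) * Complex.exp (θ * Complex.I)
        + (b * (-2 * Complex.I)) * Complex.exp (-2 * θ * Complex.I) := by
  ext θ
  have h0 : HasDerivAt (fun θ : ℝ => (θ : ℂ)) 1 θ := Complex.ofRealCLM.hasDerivAt
  have h1 := (((h0.mul_const Complex.I).cexp).const_mul a)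
  have h2 := ((((h0.const_mul (-2)).mul_const Complex.I).cexp).const_mul b)
  exact (show HasDerivAt (fun θ : ℝ => a * Complex.exp (θ * Complex.I)
    + b * Complex.exp (-2 * θ * Complex.I)) _ θ from h1.add h2).deriv.trans (by ring)

theorem cusps_hypocycloid {q : ℝ} (hq : 0 < q) :
    {z | IsCusp (hypocycloid q) z} = rootTriple (3 * q) := by
  have hqc : (q : ℂ) ≠ 0 := by exact_mod_cast hq.ne'
  have hγ : hypocycloid q = fun θ : ℝ => (2 * q : ℂ) * Complex.exp (θ * Complex.I)
      + q * Complex.exp (-2 * θ * Complex.I) := funext (hypocycloid_eq hq.ne')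
  have h1 := deriv_trochoid (2 * q) q
  have h2 : iteratedDeriv 2 (hypocycloid q) = fun θ : ℝ =>
      (2 * q * Complex.I * Complex.I) * Complex.exp (θ * Complex.I)
      + (q * (-2 * Complex.I) * (-2 * Complex.I)) * Complex.exp (-2 * θ * Complex.I) := by
    rw [iteratedDeriv_succ, iteratedDeriv_one, hγ, h1, deriv_trochoid]
  have h3 : iteratedDeriv 3 (hypocycloid q) = fun θ : ℝ =>
      (2 * q * Complex.I * Complex.I * Complex.I) * Complex.exp (θ * Complex.I)
      + (q * (-2 * Complex.I) * (-2 * Complex.I) * (-2 * Complex.I))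
        * Complex.exp (-2 * θ * Complex.I) := by
    rw [iteratedDeriv_succ, h2, deriv_trochoid]
  ext z
  rw [Set.mem_ofPred_eq, mem_rootTriple_iff_exists]
  refine exists_congr fun θ => ?_
  have hE0 : Complex.exp (θ * Complex.I) ≠ 0 := Complex.exp_ne_zero _
  rw [h2, h3, hγ, h1]
  dsimp only
  rw [exp_neg_two]
  set E := Complex.exp (θ * Complex.I) with hE
  constructor
  · rintro ⟨rfl, hd, -⟩
    have h : E ^ 3 = 1 := by
      field_simp at hd
      have h' : 2 * (q : ℂ) * Complex.I * (E ^ 3 - 1) = 0 := by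
        linear_combination hd
      rcases mul_eq_zero.1 h' with h' | h'
      · exact absurd h' (by simp [hqc])
      · exact sub_eq_zero.1 h'
    refine ⟨h, ?_⟩
    rw [inv_sq_of_cube h]; push_cast; ring
  · rintro ⟨h, rfl⟩
    rw [inv_sq_of_cube h]
    refine ⟨by push_cast; ring, by ring, ?_⟩
    rw [LinearIndependent.pair_iff]
    intro s t hst
    have hst' : (6 * q * E) * (-(s : ℂ) + t * Complex.I) = 0 := by
      rw [← hst]
      simp only [Complex.real_smul]
      linear_combination 6 * q * E * (t * Complex.I - s) * Complex.I_sq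
    rcases mul_eq_zero.1 hst' with h' | h'
    · exact absurd h' (by simp [hqc, hE0])
    · have hre := congrArg Complex.re h'
      have him := congrArg Complex.im h'
      simp at hre him
      exact ⟨hre, him⟩

/-! ### The deltoid -/

/-- The discriminant of the cubic `X³ - z X² + z̄ X - 1`. -/
def deltoidDisc (z : ℂ) : ℝ := ‖z‖ ^ 4 - 8 * (z ^ 3).re + 18 * ‖z‖ ^ 2 - 27

theorem ofReal_deltoidDisc (z : ℂ) : (deltoidDisc z : ℂ) = z ^ 2 * (starRingEnd ℂ) z ^ 2
    - 4 * z ^ 3 - 4 * (starRingEnd ℂ) z ^ 3 + 18 * (z * (starRingEnd ℂ) z) - 27 := by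
  have h1 : z * (starRingEnd ℂ) z = (‖z‖ : ℂ) ^ 2 := Complex.mul_conj' z
  have h2 : z ^ 3 + (starRingEnd ℂ) z ^ 3 = 2 * ((z ^ 3).re : ℂ) := by
    rw [← map_pow, Complex.add_conj]; push_cast; ring
  rw [deltoidDisc]
  push_cast
  linear_combination (-(z * (starRingEnd ℂ) z) - (‖z‖ : ℂ) ^ 2 - 18) * h1 + 4 * h2

/-- The discriminant is the squared product of the root differences, and
`(s₁ - s₂)² = - s₁ s₂ |s₁ - s₂|²` on the unit circle. -/
theorem deltoidDisc_of_unitTriple {s : ℂ × ℂ × ℂ} (hs : s ∈ unitTriples) :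
    deltoidDisc (s.1 + s.2.1 + s.2.2)
      = -(‖s.1 - s.2.1‖ ^ 2 * ‖s.1 - s.2.2‖ ^ 2 * ‖s.2.1 - s.2.2‖ ^ 2) := by
  obtain ⟨x, y, z⟩ := s
  have hconj : ∀ q : ℝ, (q : ℂ) * (x * y + x * z + y * z)
      = (starRingEnd ℂ) ((q : ℂ) * (x + y + z)) := fun q =>
    (mem_Sigma2Pairs_iff.1 ⟨(x, y, z), hs, rfl⟩ :
      (_ ∈ Sigma2 q ∧ (q : ℂ) * (x * y + x * z + y * z) = _)).2
  have h1 := hconj 1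
  obtain ⟨hx, hy, hz, h⟩ := hs
  dsimp only at hx hy hz h ⊢
  simp only [Complex.ofReal_one, one_mul] at h1
  have hd : ∀ {u v : ℂ}, ‖u‖ = 1 → ‖v‖ = 1 → (u - v) ^ 2 = -(u * v * (‖u - v‖ : ℂ) ^ 2) := by
    intro u v hu hv
    have hu' : (starRingEnd ℂ) u * u = 1 := by rw [Complex.conj_mul', hu]; simp
    have hv' : (starRingEnd ℂ) v * v = 1 := by rw [Complex.conj_mul', hv]; simp
    rw [← Complex.mul_conj', map_sub]
    linear_combination v * (u - v) * hu' - u * (u - v) * hv'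
  have key : (deltoidDisc (x + y + z) : ℂ)
      = ((-(‖x - y‖ ^ 2 * ‖x - z‖ ^ 2 * ‖y - z‖ ^ 2) : ℝ) : ℂ) := by
    rw [ofReal_deltoidDisc, ← h1]
    have e : (x + y + z) ^ 2 * (x * y + x * z + y * z) ^ 2 - 4 * (x + y + z) ^ 3
        - 4 * (x * y + x * z + y * z) ^ 3 + 18 * ((x + y + z) * (x * y + x * z + y * z)) - 27
        = (x - y) ^ 2 * (x - z) ^ 2 * (y - z) ^ 2 := by
      linear_combination (4 * (x + y + z) ^ 3 - 18 * (x + y + z) * (x * y + x * z + y * z)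
        + 27 * (x * y * z + 1)) * h
    rw [e, hd hx hy, hd hx hz, hd hy hz]
    push_cast
    linear_combination (-(x * y * z + 1) * (‖x - y‖ : ℂ) ^ 2 * (‖x - z‖ : ℂ) ^ 2
      * (‖y - z‖ : ℂ) ^ 2) * h
  exact_mod_cast key

/-- The discriminant on the family of parallel curves `T e^{iθ} + e^{-2iθ}`. -/
theorem deltoidDisc_trochoid (T : ℝ) {E : ℂ} (hE : ‖E‖ = 1) :
    deltoidDisc (T * E + (E ^ 2)⁻¹) = (T ^ 2 - 4) * (T - 2 * (E ^ 3).re) ^ 2 := by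
  have hE0 : E ≠ 0 := by rw [← norm_pos_iff, hE]; exact one_pos
  have hc : (starRingEnd ℂ) E = E⁻¹ := by
    refine eq_inv_of_mul_eq_one_left ?_
    rw [Complex.conj_mul', hE]; simp
  have h2 : 2 * ((E ^ 3).re : ℂ) = E ^ 3 + E⁻¹ ^ 3 := by
    rw [← hc, ← map_pow, Complex.add_conj]; push_cast; ring
  have key : (deltoidDisc (T * E + (E ^ 2)⁻¹) : ℂ)
      = (((T ^ 2 - 4) * (T - 2 * (E ^ 3).re) ^ 2 : ℝ) : ℂ) := by
    push_cast
    rw [ofReal_deltoidDisc, h2, map_add, map_mul, map_inv₀, map_pow, hc, Complex.conj_ofReal]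
    field_simp
    ring
  exact_mod_cast key

/-- Outside the deltoid, the cubic has a root `x` off the unit circle, hence also the root
`1 / x̄`, and the third root is determined by the product. -/
theorem exists_trochoid_of_not_mem {z : ℂ}
    (hz : ¬∃ s ∈ unitTriples, z = s.1 + s.2.1 + s.2.2) :
    ∃ T : ℝ, 2 < T ∧ ∃ E : ℂ, ‖E‖ = 1 ∧ z = T * E + (E ^ 2)⁻¹ := by
  have hroot : ∃ x : ℂ, x ^ 3 - z * x ^ 2 + (starRingEnd ℂ) z * x - 1 = 0 ∧ 1 < ‖x‖ := by
    by_contra! h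
    exact hz (exists_unitTriple_of_roots h)
  obtain ⟨x, hx, hx1⟩ := hroot
  set ρ := ‖x‖ with hρ
  have hρ0 : 0 < ρ := by linarith
  have hρc : (ρ : ℂ) ≠ 0 := by exact_mod_cast hρ0.ne'
  set E : ℂ := x / ρ with hE
  have hEn : ‖E‖ = 1 := by
    rw [hE, norm_div, Complex.norm_real, Real.norm_of_nonneg hρ0.le, ← hρ, div_self hρ0.ne']
  have hE0 : E ≠ 0 := by rw [← norm_pos_iff, hEn]; exact one_pos
  have hxE : x = ρ * E := by rw [hE]; field_simp
  have hc : (starRingEnd ℂ) E = E⁻¹ := by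
    refine eq_inv_of_mul_eq_one_left ?_
    rw [Complex.conj_mul', hEn]; simp
  refine ⟨ρ + ρ⁻¹, ?_, E, hEn, ?_⟩
  · have : ρ + ρ⁻¹ - 2 = (ρ - 1) ^ 2 / ρ := by field_simp; ring
    have h2 : 0 < (ρ - 1) ^ 2 / ρ := div_pos (pow_pos (by linarith) 2) hρ0
    linarith
  · have e2 := congrArg (starRingEnd ℂ) hx
    simp only [map_sub, map_add, map_mul, map_pow, Complex.conj_conj, map_one, map_zero, hxE,
      Complex.conj_ofReal, hc] at e2
    rw [hxE] at hx
    have hne : (ρ : ℂ) ^ 2 - 1 ≠ 0 := by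
      have : ρ ^ 2 - 1 ≠ 0 := by nlinarith
      exact_mod_cast this
    clear_value E ρ
    have e2' : (ρ : ℂ) ^ 3 - (starRingEnd ℂ) z * ρ ^ 2 * E + z * ρ * E ^ 2 - E ^ 3 = 0 := by
      have c1 : E ^ 3 * E⁻¹ = E ^ 2 := by field_simp
      have c2 : E ^ 3 * E⁻¹ ^ 2 = E := by field_simp
      have c3 : E ^ 3 * E⁻¹ ^ 3 = 1 := by field_simp
      linear_combination E ^ 3 * e2 - (ρ : ℂ) ^ 3 * c3 + (starRingEnd ℂ) z * ρ ^ 2 * c2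
        - z * ρ * c1
    have e3 : (ρ * (ρ ^ 2 - 1) * E ^ 2) * (((ρ + ρ⁻¹ : ℝ) : ℂ) * E + (E ^ 2)⁻¹)
        = (ρ ^ 4 - 1) * E ^ 3 + ρ ^ 3 - ρ := by
      push_cast
      field_simp
      ring
    refine mul_left_cancel₀ (mul_ne_zero (mul_ne_zero hρc hne) (pow_ne_zero 2 hE0)) ?_
    -- Eliminating `z̄` between the cubic and its conjugate leaves a linear equation for `z`.
    rw [e3]
    linear_combination -(ρ : ℂ) * hx - e2'

theorem mem_Sigma2_iff {q : ℝ} (hq : 0 < q) {z : ℂ} :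
    z ∈ Sigma2 q ↔ ∃ s ∈ unitTriples, z / q = s.1 + s.2.1 + s.2.2 := by
  have hqc : (q : ℂ) ≠ 0 := by exact_mod_cast hq.ne'
  constructor
  · rintro ⟨s, hs, rfl⟩
    exact ⟨s, hs, mul_div_cancel_left₀ _ hqc⟩
  · rintro ⟨s, hs, h⟩
    exact ⟨s, hs, by dsimp only; rw [← h, mul_div_cancel₀ _ hqc]⟩

theorem mem_Sigma2_iff_disc {q : ℝ} (hq : 0 < q) {z : ℂ} :
    z ∈ Sigma2 q ↔ deltoidDisc (z / q) ≤ 0 := by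
  rw [mem_Sigma2_iff hq]
  constructor
  · rintro ⟨s, hs, h⟩
    rw [h, deltoidDisc_of_unitTriple hs, neg_nonpos]
    positivity
  · intro h
    by_contra hz
    obtain ⟨T, hT, E, hE, e⟩ := exists_trochoid_of_not_mem hz
    rw [e, deltoidDisc_trochoid T hE] at h
    have hre : (E ^ 3).re ≤ 1 := by
      refine (Complex.re_le_norm _).trans ?_
      rw [norm_pow, hE, one_pow]
    have : 0 < (T ^ 2 - 4) * (T - 2 * (E ^ 3).re) ^ 2 :=
      mul_pos (by nlinarith) (pow_pos (by linarith) 2)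
    linarith

theorem mem_range_hypocycloid_iff {q : ℝ} (hq : 0 < q) {z : ℂ} :
    z ∈ Set.range (hypocycloid q) ↔ deltoidDisc (z / q) = 0 := by
  have hqc : (q : ℂ) ≠ 0 := by exact_mod_cast hq.ne'
  constructor
  · rintro ⟨θ, rfl⟩
    have e : hypocycloid q θ / q = ((2 : ℝ) : ℂ) * Complex.exp (θ * Complex.I)
        + (Complex.exp (θ * Complex.I) ^ 2)⁻¹ := by
      rw [hypocycloid_eq hq.ne', exp_neg_two]
      push_cast
      field_simp
    rw [e, deltoidDisc_trochoid 2 (Complex.norm_exp_ofReal_mul_I θ)]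
    ring
  · intro h
    obtain ⟨⟨x, y, w⟩, hs, e⟩ := (mem_Sigma2_iff hq).1 ((mem_Sigma2_iff_disc hq).2 h.le)
    rw [e, deltoidDisc_of_unitTriple hs] at h
    obtain ⟨hx, hy, hw, hp⟩ := hs
    dsimp only at e h hx hy hw hp
    -- Two of the three unit numbers coincide; they parametrize the curve.
    have key : ∀ {u v : ℂ}, ‖u‖ = 1 → u * u * v = 1 → z / q = u + u + v →
        z ∈ Set.range (hypocycloid q) := by
      intro u v hu huv ez
      refine ⟨Complex.arg u, ?_⟩
      have hE : Complex.exp (Complex.arg u * Complex.I) = u := by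
        have := Complex.norm_mul_exp_arg_mul_I u
        rwa [hu, Complex.ofReal_one, one_mul] at this
      have hv : v = (u ^ 2)⁻¹ := eq_inv_of_mul_eq_one_right (by rw [← huv]; ring)
      rw [hypocycloid_eq hq.ne', exp_neg_two, hE, ← hv]
      rw [div_eq_iff hqc] at ez
      rw [ez]; ring
    have h' : ‖x - y‖ = 0 ∨ ‖x - w‖ = 0 ∨ ‖y - w‖ = 0 := by
      by_contra! hne
      have := hne.1
      have := hne.2.1
      have := hne.2.2
      have : ‖x - y‖ ^ 2 * ‖x - w‖ ^ 2 * ‖y - w‖ ^ 2 ≠ 0 := by positivity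
      exact this (by linarith)
    simp only [norm_eq_zero, sub_eq_zero] at h'
    rcases h' with rfl | rfl | rfl
    · exact key hx hp e
    · exact key (v := y) hx (by rw [← hp]; ring) (by rw [e]; ring)
    · exact key (v := x) hy (by rw [← hp]; ring) (by rw [e]; ring)

theorem continuous_deltoidDisc : Continuous deltoidDisc := by
  unfold deltoidDisc
  fun_prop

theorem isBounded_Sigma2 (q : ℝ) : Bornology.IsBounded (Sigma2 q) := by
  refine (Metric.isBounded_closedBall (x := (0 : ℂ)) (r := ‖(q : ℂ)‖ * 3)).subset ?_
  rintro _ ⟨s, ⟨h1, h2, h3, -⟩, rfl⟩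
  rw [mem_closedBall_zero_iff, norm_mul]
  gcongr
  refine (norm_add₃_le).trans ?_
  rw [h1, h2, h3]; norm_num

theorem Sigma2_eq_range_union_interior {q : ℝ} (hq : 0 < q) :
    Sigma2 q = Set.range (hypocycloid q) ∪ curveInterior (Set.range (hypocycloid q)) := by
  have hqc : (q : ℂ) ≠ 0 := by exact_mod_cast hq.ne'
  set C := Set.range (hypocycloid q) with hC
  have hcont : Continuous fun z : ℂ => deltoidDisc (z / q) := by
    have := continuous_deltoidDisc
    fun_prop
  ext z
  constructor
  · intro hz
    by_cases hzC : z ∈ C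
    · exact Or.inl hzC
    refine Or.inr ⟨hzC, (isBounded_Sigma2 q).subset fun y hy => ?_⟩
    have hneg : deltoidDisc (z / q) < 0 :=
      lt_of_le_of_ne ((mem_Sigma2_iff_disc hq).1 hz)
        fun h => hzC ((mem_range_hypocycloid_iff hq).2 h)
    rw [mem_Sigma2_iff_disc hq]
    by_contra! hpos
    -- The discriminant changes sign on a connected set avoiding its zeros.
    obtain ⟨w, hw, hw0⟩ := isPreconnected_connectedComponentIn.intermediate_value
      (mem_connectedComponentIn hzC) hy hcont.continuousOn
      (show (0 : ℝ) ∈ Set.Icc _ _ from ⟨hneg.le, hpos.le⟩)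
    exact connectedComponentIn_subset _ _ hw ((mem_range_hypocycloid_iff hq).2 hw0)
  · rintro (hz | ⟨hzC, hb⟩)
    · exact (mem_Sigma2_iff_disc hq).2 ((mem_range_hypocycloid_iff hq).1 hz).le
    · by_contra hz
      rw [mem_Sigma2_iff hq] at hz
      obtain ⟨T, hT, E, hE, e⟩ := exists_trochoid_of_not_mem hz
      -- The parallel curves for larger `T` connect `z` to infinity.
      set path : ℝ → ℂ := fun t => q * (t * E + (E ^ 2)⁻¹) with hpath
      have hpc : Continuous path := by fun_prop
      have hzpath : z = path T := by
        rw [hpath]; dsimp only; rw [← e, mul_div_cancel₀ _ hqc]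
      have hsub : path '' Set.Ici T ⊆ connectedComponentIn Cᶜ z := by
        refine IsPreconnected.subset_connectedComponentIn
          (isPreconnected_Ici.image _ hpc.continuousOn) ⟨T, Set.mem_Ici.2 le_rfl, hzpath.symm⟩ ?_
        rintro _ ⟨t, ht, rfl⟩ hmem
        rw [hC, mem_range_hypocycloid_iff hq, hpath] at hmem
        dsimp only at hmem
        rw [mul_div_cancel_left₀ _ hqc, deltoidDisc_trochoid t hE] at hmem
        have hre : (E ^ 3).re ≤ 1 := by
          refine (Complex.re_le_norm _).trans ?_
          rw [norm_pow, hE, one_pow]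
        have ht' : T ≤ t := ht
        have : 0 < (t ^ 2 - 4) * (t - 2 * (E ^ 3).re) ^ 2 :=
          mul_pos (by nlinarith) (pow_pos (by linarith) 2)
        linarith
      obtain ⟨R, hR⟩ := (hb.subset hsub).exists_norm_le
      set t : ℝ := max T (R / q + 2) with ht
      have h1 := hR _ ⟨t, Set.mem_Ici.2 (le_max_left _ _), rfl⟩
      have h2 : R / q + 2 ≤ t := le_max_right _ _
      have h3 : t - 1 ≤ ‖(t : ℂ) * E + (E ^ 2)⁻¹‖ := by
        have := norm_sub_le ((t : ℂ) * E + (E ^ 2)⁻¹) ((E ^ 2)⁻¹)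
        rw [add_sub_cancel_right, norm_mul, hE, mul_one, norm_inv, norm_pow, hE, one_pow, inv_one,
          Complex.norm_real] at this
        have := Real.le_norm_self t
        linarith
      rw [hpath] at h1
      dsimp only at h1
      rw [norm_mul, Complex.norm_real, Real.norm_of_nonneg hq.le] at h1
      have h4 : q * (R / q + 1) ≤ R := by
        refine le_trans ?_ h1
        gcongr
        linarith
      have h5 : q * (R / q + 1) = R + q := by field_simp
      linarith

end

end A2Quotient

end

theorem theorem1p1 (K : Type*) [Field K] [Finite K] (q : ℝ) (hq : q = Nat.card K) :
    (∃ Aw : A2Quotient.L2Quotient K →L[ℂ] A2Quotient.L2Quotient K,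
      (∀ (f : A2Quotient.L2Quotient K) (u : A2Quotient.QVertex K),
        Aw f u = A2Quotient.weightedAdjacency 1 f u) ∧
      A2Quotient.Sigma0 q ∪ A2Quotient.Sigma1 q ∪ A2Quotient.Sigma2 q ⊆ spectrum ℂ Aw) ∧
    (A2Quotient.Sigma0 q).ncard = 3 ∧
    {z ∈ A2Quotient.Sigma1 q | ∀ z' ∈ A2Quotient.Sigma1 q, ‖z'‖ ≤ ‖z‖} =
      A2Quotient.rootTriple (q ^ (3 / 2 : ℝ) + q + q ^ (1 / 2 : ℝ)) ∧
    A2Quotient.Sigma2 q = Set.range (A2Quotient.hypocycloid q) ∪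
      A2Quotient.curveInterior (Set.range (A2Quotient.hypocycloid q)) ∧
    {z | A2Quotient.IsCusp (A2Quotient.hypocycloid q) z} = A2Quotient.rootTriple (3 * q) ∧
    (∃ A₁ A₂ : A2Quotient.L2Building K →L[ℂ] A2Quotient.L2Building K,
      (∀ (f : A2Quotient.L2Building K) (x : A2Quotient.Vertex K),
        A₁ f x = A2Quotient.coloredAdjacency 1 f x) ∧
      (∀ (f : A2Quotient.L2Building K) (x : A2Quotient.Vertex K),
        A₂ f x = A2Quotient.coloredAdjacency 2 f x) ∧
      spectrum ℂ A₁ = A2Quotient.Sigma2 q ∧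
      A2Quotient.simultaneousSpectrum A₁ A₂ = A2Quotient.Sigma2Pairs q) := by
  subst hq
  have hq : (0 : ℝ) < Nat.card K := by exact_mod_cast Nat.card_pos
  have := Fintype.ofFinite K
  obtain ⟨Aw, hAw⟩ := A2Quotient.exists_weightedAdjacency_operator (K := K)
  exact ⟨⟨Aw, hAw, Set.union_subset (Set.union_subset
      (A2Quotient.Sigma0_subset_spectrum hAw) (A2Quotient.Sigma1_subset_spectrum hAw))
      (A2Quotient.Sigma2_subset_spectrum hAw)⟩,
    A2Quotient.ncard_rootTriple (by positivity), A2Quotient.max_norm_Sigma1 hq,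
    A2Quotient.Sigma2_eq_range_union_interior hq, A2Quotient.cusps_hypocycloid hq,
    A2Quotient.A1 K, A2Quotient.A2 K, A2Quotient.A1_apply K, A2Quotient.A2_apply K,
    A2Quotient.spectrum_A1, A2Quotient.simultaneousSpectrum_A1_A2⟩
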